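/- **Theorem 3.1.** For $n,N,y\in\mathbb N$ with $1\le N<2^n$ and $\gcd(y,N)=1$, let $U_{N,y}$ be the unitary on $n$ qubits given on the computational basis by $U_{N,y}|x\rangle=|xy \bmod N\rangle$ for $0\le x<N$ and $U_{N,y}|x\rangle=|x\rangle$ for $N\le x<2^n$ (integers are identified with bit strings through their binary representation), and let $H_{N,y}=U_{N,y}+U_{N,y}^\dagger$. An energy measurement procedure on $n$ qubits is a quantum circuit, that is, a finite sequence of two-qubit gates (arbitrary $4\times4$ unitaries acting on two distinct qubits), on the $n$ system qubits together with two $n$-qubit input registers, initialized to $|N\rangle$ and $|y\bmod N\rangle$, an output register of $k$ qubits and $w$ work qubits, both initialized to $0$. After the circuit the output register is measured in the computational basis, and its content $v\in\{0,\dots,2^k-1\}$ is reported as the energy $E'=-2+4v/2^k$. Its computational complexity is the number of two-qubit gates. It has $\tfrac23$-accuracy $\delta E$ for $H_{N,y}$ if for every unit eigenvector $\psi$ of $H_{N,y}$, with eigenvalue $E$, measured in this way, $\Pr\left(|E-E'|\le\delta E\right)\ge \tfrac23$. There is a polynomial $p$ such that for every $n$ there are one energy measurement procedure $M_n$ (its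 circuit does not depend on $N$ or $y$), with complexity at most $p(n)$ and at most $p(n)$ qubits, and a number $\delta E>0$ with $$\delta E\le e^{-n},\qquad \delta E\cdot \mathrm{complexity}(M_n)\le e^{-n},$$ such that for all $N,y$ with $1\le N<2^n$ and $\gcd(y,N)=1$: 1. $M_n$ has $\tfrac23$-accuracy $\delta E$ for $H_{N,y}$; 2. on every unit vector $\psi$ that is an eigenvector of $U_{N,y}$ (hence also of $H_{N,y}$) the circuit leaves the system exactly in $\psi$: the state before the output register is measured is $\psi\otimes\chi$ for some unit vector $\chi$ of the other registers; 3. on every unit eigenvector $\psi$ of $H_{N,y}$, including superpositions of eigenvectors of $U_{N,y}$ with different eigenvalues, the state before the output register is measured is within norm distance $e^{-n}$ of $\psi\otimes\chi$ for some unit vector $\chi$ of the other registers. -/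

import Mathlib

noncomputable section

/-- The state space of a set `ι` of qubits: its computational basis is indexed by the bit strings
`ι → Bool`. -/
abbrev QState (ι : Type) [Fintype ι] [DecidableEq ι] : Type := EuclideanSpace ℂ (ι → Bool)

/-- A two-qubit gate on the qubits `ι`: an arbitrary `4 × 4` unitary matrix applied to two distinct
qubits. (A one-qubit gate is the special case where the matrix acts trivially on one of them.) -/
structure TwoQubitGate (ι : Type) where
  fst : ι
  snd : ι
  distinct : fst ≠ snd
  mat : Matrix (Bool × Bool) (Bool × Bool) ℂ
  unitary : mat ∈ Matrix.unitaryGroup (Bool × Bool) ℂ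

/-- The action of a gate on a state: its matrix on the qubits `fst`, `snd`, tensored with the
identity on all the other qubits. -/
def TwoQubitGate.apply {ι : Type} [Fintype ι] [DecidableEq ι] (g : TwoQubitGate ι)
    (Φ : QState ι) : QState ι :=
  WithLp.toLp 2 fun b => ∑ c : Bool × Bool,
    g.mat (b g.fst, b g.snd) c *
      Φ (Function.update (Function.update b g.fst c.1) g.snd c.2)

/-- The action of a quantum circuit, that is, of a list of two-qubit gates applied one after the
other, the head of the list first. -/
def runCircuit {ι : Type} [Fintype ι] [DecidableEq ι] (C : List (TwoQubitGate ι))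
    (Φ : QState ι) : QState ι :=
  C.foldl (fun Ψ g => g.apply Ψ) Φ

/-- The product state `ψ ⊗ χ` of two groups of qubits. -/
def tensorState {ι κ : Type} [Fintype ι] [DecidableEq ι] [Fintype κ] [DecidableEq κ]
    (ψ : QState ι) (χ : QState κ) : QState (ι ⊕ κ) :=
  WithLp.toLp 2 fun b => ψ (b ∘ Sum.inl) * χ (b ∘ Sum.inr)

/-- The computational basis state `|a⟩`. -/
def basisState {ι : Type} [Fintype ι] [DecidableEq ι] (a : ι → Bool) : QState ι :=
  EuclideanSpace.single a 1

/-- The operator `U_{N,y}` on `n` qubits: `|x⟩ ↦ |x y mod N⟩` for `x < N`, and `|x⟩ ↦ |x⟩`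
otherwise. A bit string `b` stands for the integer `Nat.ofBits b = ∑ i, b i * 2 ^ i`. -/
def modMul (n N y : ℕ) : Matrix (Fin n → Bool) (Fin n → Bool) ℂ :=
  Matrix.of fun z x =>
    if Nat.ofBits z = (if Nat.ofBits x < N then Nat.ofBits x * y % N else Nat.ofBits x)
    then 1 else 0

/-- The Hamiltonian `H_{N,y} = U_{N,y} + U_{N,y}†`. -/
def shorHamiltonian (n N y : ℕ) : Matrix (Fin n → Bool) (Fin n → Bool) ℂ :=
  modMul n N y + (modMul n N y).conjTranspose

/-- The qubits that a measurement apparatus adds to the system: two `n`-qubit input registers, for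
`N` and `y`, an output register of `k` qubits, and `w` work qubits. -/
abbrev Apparatus (n k w : ℕ) : Type := Fin n ⊕ Fin n ⊕ Fin k ⊕ Fin w

/-- An energy measurement procedure for all the `H_{N,y}` on `n` qubits: one circuit of two-qubit
gates on the system and the apparatus. The circuit does not depend on `N` and `y`. -/
structure EnergyMeasurement (n : ℕ) where
  k : ℕ
  w : ℕ
  circuit : List (TwoQubitGate (Fin n ⊕ Apparatus n k w))

namespace EnergyMeasurement

variable {n : ℕ} (M : EnergyMeasurement n)

/-- The computational complexity of the measurement: the number of two-qubit gates. -/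
def complexity : ℕ := M.circuit.length

/-- The number of qubits that the measurement uses, those of the system included. -/
def qubits : ℕ := Fintype.card (Fin n ⊕ Apparatus n M.k M.w)

/-- The initial content of the apparatus: `N` and `y mod N` in binary in the input registers, and
zeros in the output and work registers. -/
def input (N y : ℕ) : Apparatus n M.k M.w → Bool :=
  Sum.elim (fun i => N.testBit i) (Sum.elim (fun i => (y % N).testBit i) fun _ => false)

/-- The state of the system and the apparatus after the circuit has been applied to a state `ψ` of
the system, just before the output register is measured. -/
def finalState (N y : ℕ) (ψ : QState (Fin n)) : QState (Fin n ⊕ Apparatus n M.k M.w) :=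
  runCircuit M.circuit (tensorState ψ (basisState (M.input N y)))

/-- The energy `E'` reported when all qubits are read in the computational basis and the result is
`b`. It depends on the output register only, whose `k` bits are a binary fixed-point number in the
interval `[-2, 2)`: the register content `v < 2 ^ k` stands for `-2 + 4 v / 2 ^ k`. -/
def readout (b : Fin n ⊕ Apparatus n M.k M.w → Bool) : ℝ :=
  -2 + 4 * (Nat.ofBits fun i : Fin M.k => b (Sum.inr (Sum.inr (Sum.inr (Sum.inl i)))) : ℕ) /
    2 ^ M.k

open Classical in
/-- The probability, by the Born rule, that the reported energy `E'` satisfies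
`|E - E'| ≤ δE` if the state of the system is `ψ`. -/
def probWithin (N y : ℕ) (ψ : QState (Fin n)) (E δE : ℝ) : ℝ :=
  ∑ b : Fin n ⊕ Apparatus n M.k M.w → Bool,
    if |E - M.readout b| ≤ δE then ‖M.finalState N y ψ b‖ ^ 2 else 0

/-- The measurement of the energy of `H_{N,y}` has `η`-accuracy `δE`: on every eigenstate, of
energy `E`, the reported energy is within `δE` of `E` with probability at least `η`. -/
def HasAccuracy (N y : ℕ) (η δE : ℝ) : Prop :=
  ∀ (ψ : QState (Fin n)) (E : ℝ), ‖ψ‖ = 1 →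
    Module.End.HasEigenvector (Matrix.toEuclideanLin (shorHamiltonian n N y)) (E : ℂ) ψ →
      η ≤ M.probWithin N y ψ E δE

/-- The circuit maps the state `ψ` of the system to a state that is within `β` of a product of
`ψ` itself and a state of the apparatus. For `β = 0` the system is left in `ψ` exactly, whatever the
result of the measurement of the output register. -/
def LeavesIntact (N y : ℕ) (ψ : QState (Fin n)) (β : ℝ) : Prop :=
  ∃ χ : QState (Apparatus n M.k M.w), ‖χ‖ = 1 ∧ ‖M.finalState N y ψ - tensorState ψ χ‖ ≤ β

end EnergyMeasurement

end

/-!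
The measurement is phase estimation for `U = U_{N,y}` that is undone after its result has been
copied. Its precision is exponential although the circuit is of polynomial size, because the powers
`U ^ t` with exponentially large `t` are as easy as `U`: they are multiplications by `y ^ t mod N`,
which repeated squaring computes.

*Eigenvalues.* `U` permutes the computational basis (`exists_perm_mulMod`), so its eigenvalues are
`exp (2 π i s / r)` with an orbit length `r ≤ 2 ^ n` (`exists_turn_of_eigen`). An eigenvector of
`H = U + U†` of energy `E = 2 cos (2 π s / r)` is a sum of two eigenvectors of `U`, for the phases
`s / r` and `-s / r` (`exists_decomposition_of_shorHamiltonian`).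

*Circuits.* Boolean circuits are turned into reversible programs (`HasCircuit.exists_xorProg`) and
these into two-qubit gates (`runCircuit_compile`). The map `x ↦ x y ^ t mod N` is computed in place,
with the inverse of `y ^ t` from the extended Euclidean algorithm to erase `x`
(`exists_mulPowProg`). The quantum Fourier transform is `exists_fourierCircuit`. Applied to a register
of zeros it produces the uniform superposition, so it also serves as the first stage.

*Accuracy.* With a phase register of `6 T` qubits, the estimate of `s / r` is rounded to a grid of
`2 ^ T` points. The boundaries of the grid cells are multiples of `1 / 2 ^ (T + 1)` at distance at
least `1 / (r 2 ^ (T + 1))` from `s / r`, so that all the estimates outside of the right cell together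
have a norm of at most `1 / 2 ^ T` (`EstimationApparatus.norm_estimateState_compl_le`). On the right
cell, the number `v` that is copied to the output register is constant: the state before the
measurement is, up to an exponentially small error, the initial state with `v` in the output register
(`Registers.norm_measurementCircuit_sub_le`). Since `v` encodes an approximation of the cosine that is
computed from the grid point up to sign (`energyCode`, `foldIndex_neg`), it is the same for `s / r` and
`-s / r`, and superpositions of the two eigenvectors survive.

*Exactness.* On an eigenvector `ψ` of `U`, phase estimation acts on `ψ ⊗ χ` as an operator on `χ`
alone (phase kickback). It maps the finite-dimensional space of the `χ` with clean work qubits into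
itself and preserves norms, hence so does its inverse, and `ψ` is left exactly intact
(`Registers.exists_measurementCircuit_eq`).

With `T = 4 n + 100`, the errors of order `2 ^ (-T)` beat `exp (-n)` even after multiplication by the
number of gates, which is at most `10 ^ 12 T ^ 4`.
-/

noncomputable section

set_option linter.unusedSectionVars false

section Circuits

variable {ι κ : Type} [Fintype ι] [DecidableEq ι] [Fintype κ] [DecidableEq κ]

/-! ### Circuits as unitary operators -/

namespace TwoQubitGate

lemma apply_apply (g : TwoQubitGate ι) (Φ : QState ι) (b : ι → Bool) :
    g.apply Φ b = ∑ c : Bool × Bool, g.mat (b g.fst, b g.snd) c *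
      Φ (Function.update (Function.update b g.fst c.1) g.snd c.2) := rfl

lemma apply_add (g : TwoQubitGate ι) (Φ Ψ : QState ι) :
    g.apply (Φ + Ψ) = g.apply Φ + g.apply Ψ := by
  ext b
  simp [apply_apply, mul_add, Finset.sum_add_distrib]

lemma apply_sub (g : TwoQubitGate ι) (Φ Ψ : QState ι) :
    g.apply (Φ - Ψ) = g.apply Φ - g.apply Ψ := by
  ext b
  simp [apply_apply, mul_sub, Finset.sum_sub_distrib]

/-- The gate that undoes `g`: the conjugate transposed matrix on the same two qubits. -/
def adjoint (g : TwoQubitGate ι) : TwoQubitGate ι where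
  fst := g.fst
  snd := g.snd
  distinct := g.distinct
  mat := star g.mat
  unitary := Unitary.star_mem g.unitary

lemma update_update_apply (g : TwoQubitGate ι) (b : ι → Bool) (c : Bool × Bool) :
    (Function.update (Function.update b g.fst c.1) g.snd c.2 g.fst,
      Function.update (Function.update b g.fst c.1) g.snd c.2 g.snd) = c := by
  simp [Function.update_of_ne g.distinct]

lemma update_update_update (g : TwoQubitGate ι) (b : ι → Bool) (c d : Bool × Bool) :
    Function.update (Function.update
      (Function.update (Function.update b g.fst c.1) g.snd c.2) g.fst d.1) g.snd d.2 =
      Function.update (Function.update b g.fst d.1) g.snd d.2 := by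
  funext x
  by_cases h1 : x = g.snd
  · subst h1; simp
  · by_cases h2 : x = g.fst
    · subst h2; simp [Function.update_of_ne g.distinct]
    · simp [Function.update_of_ne, h1, h2]

lemma adjoint_apply_apply (g : TwoQubitGate ι) (Φ : QState ι) :
    g.adjoint.apply (g.apply Φ) = Φ := by
  ext b
  have hu : star g.mat * g.mat = 1 := Matrix.mem_unitaryGroup_iff'.1 g.unitary
  rw [apply_apply]
  change ∑ c, (star g.mat) (b g.fst, b g.snd) c * g.apply Φ
    (Function.update (Function.update b g.fst c.1) g.snd c.2) = _
  simp_rw [apply_apply, update_update_apply, update_update_update, Finset.mul_sum]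
  rw [Finset.sum_comm]
  simp_rw [← mul_assoc, ← Finset.sum_mul, ← Matrix.mul_apply, hu, Matrix.one_apply]
  rw [Finset.sum_eq_single (b g.fst, b g.snd)]
  · simp
  · intro c _ hc
    simp [Ne.symm hc]
  · simp

lemma inner_apply_right (g : TwoQubitGate ι) (Φ Ψ : QState ι) :
    inner ℂ Ψ (g.apply Φ) = inner ℂ (g.adjoint.apply Ψ) Φ := by
  -- Exchanging the bits of `b` at the two qubits of the gate with `c` matches the two double sums.
  let e : (ι → Bool) × (Bool × Bool) ≃ (ι → Bool) × (Bool × Bool) :=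
    { toFun := fun p => (Function.update (Function.update p.1 g.fst p.2.1) g.snd p.2.2,
        (p.1 g.fst, p.1 g.snd))
      invFun := fun p => (Function.update (Function.update p.1 g.fst p.2.1) g.snd p.2.2,
        (p.1 g.fst, p.1 g.snd))
      left_inv := by
        rintro ⟨b, c⟩
        ext1
        · simp [update_update_update g b c (b g.fst, b g.snd)]
        · exact update_update_apply g b c
      right_inv := by
        rintro ⟨b, c⟩
        ext1
        · simp [update_update_update g b c (b g.fst, b g.snd)]
        · exact update_update_apply g b c }
  simp only [PiLp.inner_apply, RCLike.inner_apply, apply_apply, map_sum, Finset.sum_mul,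
    Finset.mul_sum, ← Fintype.sum_prod_type']
  rw [← e.sum_comp]
  refine Finset.sum_congr rfl fun p _ => ?_
  obtain ⟨b, c⟩ := p
  have h1 := update_update_apply g b c
  have h2 := update_update_update g b c (b g.fst, b g.snd)
  simp only [e, Equiv.coe_fn_mk, adjoint, Matrix.star_apply, h1] at h2 ⊢
  rw [h2]
  simp
  ring

lemma norm_apply (g : TwoQubitGate ι) (Φ : QState ι) : ‖g.apply Φ‖ = ‖Φ‖ := by
  have h : inner ℂ (g.apply Φ) (g.apply Φ) = inner ℂ Φ Φ := by
    rw [inner_apply_right, adjoint_apply_apply]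
  rw [@norm_eq_sqrt_re_inner ℂ, @norm_eq_sqrt_re_inner ℂ _ _ _ _ Φ, h]

end TwoQubitGate

lemma runCircuit_append (C D : List (TwoQubitGate ι)) (Φ : QState ι) :
    runCircuit (C ++ D) Φ = runCircuit D (runCircuit C Φ) := by
  simp [runCircuit]

@[simp] lemma runCircuit_nil (Φ : QState ι) : runCircuit [] Φ = Φ := rfl

@[simp] lemma runCircuit_cons (g : TwoQubitGate ι) (C : List (TwoQubitGate ι)) (Φ : QState ι) :
    runCircuit (g :: C) Φ = runCircuit C (g.apply Φ) := rfl

lemma runCircuit_add (C : List (TwoQubitGate ι)) (Φ Ψ : QState ι) :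
    runCircuit C (Φ + Ψ) = runCircuit C Φ + runCircuit C Ψ := by
  induction C generalizing Φ Ψ with
  | nil => rfl
  | cons g C ih => simp [TwoQubitGate.apply_add, ih]

lemma runCircuit_sub (C : List (TwoQubitGate ι)) (Φ Ψ : QState ι) :
    runCircuit C (Φ - Ψ) = runCircuit C Φ - runCircuit C Ψ := by
  induction C generalizing Φ Ψ with
  | nil => rfl
  | cons g C ih => simp [TwoQubitGate.apply_sub, ih]

lemma norm_runCircuit (C : List (TwoQubitGate ι)) (Φ : QState ι) :
    ‖runCircuit C Φ‖ = ‖Φ‖ := by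
  induction C generalizing Φ with
  | nil => rfl
  | cons g C ih => simp [ih, TwoQubitGate.norm_apply]

/-- The circuit that undoes `C`. -/
def adjointCircuit (C : List (TwoQubitGate ι)) : List (TwoQubitGate ι) :=
  (C.map TwoQubitGate.adjoint).reverse

@[simp] lemma length_adjointCircuit (C : List (TwoQubitGate ι)) :
    (adjointCircuit C).length = C.length := by
  simp [adjointCircuit]

lemma runCircuit_adjointCircuit (C : List (TwoQubitGate ι)) (Φ : QState ι) :
    runCircuit (adjointCircuit C) (runCircuit C Φ) = Φ := by
  induction C generalizing Φ with
  | nil => rfl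
  | cons g C ih =>
    have : adjointCircuit (g :: C) = adjointCircuit C ++ [g.adjoint] := by
      simp [adjointCircuit]
    rw [this, runCircuit_append, runCircuit_cons g, ih]
    simp [TwoQubitGate.adjoint_apply_apply]

/-! ### Product states -/

@[simp] lemma tensorState_apply (ψ : QState ι) (χ : QState κ) (b : ι ⊕ κ → Bool) :
    tensorState ψ χ b = ψ (b ∘ Sum.inl) * χ (b ∘ Sum.inr) := rfl

lemma tensorState_add_left (ψ ψ' : QState ι) (χ : QState κ) :
    tensorState (ψ + ψ') χ = tensorState ψ χ + tensorState ψ' χ := by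
  ext b; simp [add_mul]

lemma tensorState_sub_right (ψ : QState ι) (χ χ' : QState κ) :
    tensorState ψ (χ - χ') = tensorState ψ χ - tensorState ψ χ' := by
  ext b; simp [mul_sub]

lemma norm_tensorState (ψ : QState ι) (χ : QState κ) :
    ‖tensorState ψ χ‖ = ‖ψ‖ * ‖χ‖ := by
  rw [EuclideanSpace.norm_eq, EuclideanSpace.norm_eq ψ, EuclideanSpace.norm_eq χ,
    ← Real.sqrt_mul (by positivity), ← (Equiv.sumArrowEquivProdArrow ι κ Bool).symm.sum_comp]
  congr 1
  rw [Finset.sum_mul_sum, ← Fintype.sum_prod_type']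
  refine Finset.sum_congr rfl fun p _ => ?_
  rw [← mul_pow, ← norm_mul]
  rfl

lemma norm_basisState (a : ι → Bool) : ‖(basisState a : QState ι)‖ = 1 := by
  simp [basisState]

lemma basisState_apply (a b : ι → Bool) : (basisState a : QState ι) b = if b = a then 1 else 0 := by
  simp [basisState]

/-- The gate `g` on the second one of two groups of qubits. -/
def TwoQubitGate.onRight (ι : Type) {κ : Type} (g : TwoQubitGate κ) : TwoQubitGate (ι ⊕ κ) where
  fst := Sum.inr g.fst
  snd := Sum.inr g.snd
  distinct := fun h => g.distinct (Sum.inr.inj h)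
  mat := g.mat
  unitary := g.unitary

lemma TwoQubitGate.onRight_apply (g : TwoQubitGate κ) (ψ : QState ι) (χ : QState κ) :
    (g.onRight ι).apply (tensorState ψ χ) = tensorState ψ (g.apply χ) := by
  ext b
  simp only [tensorState_apply, TwoQubitGate.apply_apply, Finset.mul_sum, onRight]
  refine Finset.sum_congr rfl fun c _ => ?_
  have h1 : Function.update (Function.update b (Sum.inr g.fst) c.1) (Sum.inr g.snd) c.2 ∘ Sum.inl
      = b ∘ Sum.inl := by
    funext x; simp
  have h2 : Function.update (Function.update b (Sum.inr g.fst) c.1) (Sum.inr g.snd) c.2 ∘ Sum.inr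
      = Function.update (Function.update (b ∘ Sum.inr) g.fst c.1) g.snd c.2 := by
    funext x
    simp [Function.update_apply]
  rw [h1, h2]
  simp only [Function.comp_apply]
  ring

/-- The circuit `C` on the second one of two groups of qubits. -/
def circuitOnRight (ι : Type) (C : List (TwoQubitGate κ)) : List (TwoQubitGate (ι ⊕ κ)) :=
  C.map (TwoQubitGate.onRight ι)

@[simp] lemma length_circuitOnRight (C : List (TwoQubitGate κ)) :
    (circuitOnRight ι C).length = C.length := by
  simp [circuitOnRight]

lemma runCircuit_circuitOnRight (C : List (TwoQubitGate κ)) (ψ : QState ι) (χ : QState κ) :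
    runCircuit (circuitOnRight ι C) (tensorState ψ χ) = tensorState ψ (runCircuit C χ) := by
  induction C generalizing χ with
  | nil => rfl
  | cons g C ih =>
    change runCircuit (circuitOnRight ι C) ((g.onRight ι).apply _) = _
    rw [TwoQubitGate.onRight_apply, ih]
    rfl

/-! ### Hadamard gates, diagonal gates and classical reversible gates -/

section Gates

variable [Nontrivial ι]

lemma sqrtTwoInv_mul_self : ((√2 : ℂ)⁻¹) * (√2 : ℂ)⁻¹ = 1 / 2 := by
  rw [← mul_inv, ← Complex.ofReal_mul, Real.mul_self_sqrt (by norm_num)]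
  norm_num

/-- The Hadamard gate on the qubit `k`, as a two-qubit gate that acts trivially on some other
qubit. -/
def hadamard (k : ι) : TwoQubitGate ι where
  fst := k
  snd := (exists_ne k).choose
  distinct := (exists_ne k).choose_spec.symm
  mat := Matrix.of fun a c =>
    if a.2 = c.2 then (√2 : ℂ)⁻¹ * (if a.1 && c.1 then -1 else 1) else 0
  unitary := by
    rw [Matrix.mem_unitaryGroup_iff]
    ext a c
    obtain ⟨a1, a2⟩ := a
    obtain ⟨c1, c2⟩ := c
    have h := sqrtTwoInv_mul_self
    have h2 : (starRingEnd ℂ) (√2 : ℂ)⁻¹ = (√2 : ℂ)⁻¹ := by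
      rw [map_inv₀, Complex.conj_ofReal]
    cases a1 <;> cases a2 <;> cases c1 <;> cases c2 <;>
      simp [Matrix.mul_apply, Fintype.sum_prod_type, h, h2, -map_inv₀,
        -mul_inv_rev] <;> norm_num

lemma hadamard_snd_ne (k : ι) : (hadamard k).snd ≠ k := (exists_ne k).choose_spec

lemma hadamard_apply (k : ι) (Φ : QState ι) (b : ι → Bool) :
    (hadamard k).apply Φ b = (√2 : ℂ)⁻¹ *
      (Φ (Function.update b k false) + (if b k then -1 else 1) * Φ (Function.update b k true)) := by
  have hs := hadamard_snd_ne k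
  have hm : (hadamard k).mat = Matrix.of fun a c : Bool × Bool =>
    if a.2 = c.2 then (√2 : ℂ)⁻¹ * (if a.1 && c.1 then -1 else 1) else 0 := rfl
  have hf : (hadamard k).fst = k := rfl
  have hu : ∀ c, Function.update (Function.update b k c) (hadamard k).snd (b (hadamard k).snd)
      = Function.update b k c := by
    intro c
    rw [Function.update_eq_self_iff, Function.update_of_ne hs]
  rw [TwoQubitGate.apply_apply, hm, hf]
  have h1 := hu true
  have h2 := hu false
  cases hb : b (hadamard k).snd <;> rw [hb] at h1 h2 <;> cases hk : b k <;>
    simp [Fintype.sum_prod_type, h1, h2] <;> ring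

/-- The gate that multiplies the basis state `b` by the phase `d (b i, b j)`. -/
def phaseGate (i j : ι) (hij : i ≠ j) (d : Bool × Bool → Circle) : TwoQubitGate ι where
  fst := i
  snd := j
  distinct := hij
  mat := Matrix.diagonal fun a => (d a : ℂ)
  unitary := by
    rw [Matrix.mem_unitaryGroup_iff, Matrix.star_eq_conjTranspose, Matrix.diagonal_conjTranspose,
      Matrix.diagonal_mul_diagonal]
    convert Matrix.diagonal_one with a
    simp [Complex.mul_conj]

lemma phaseGate_apply (i j : ι) (hij : i ≠ j) (d : Bool × Bool → Circle) (Φ : QState ι)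
    (b : ι → Bool) : (phaseGate i j hij d).apply Φ b = d (b i, b j) * Φ b := by
  rw [TwoQubitGate.apply_apply]
  have hm : (phaseGate i j hij d).mat = Matrix.diagonal fun a => (d a : ℂ) := rfl
  have hf : (phaseGate i j hij d).fst = i := rfl
  have hs : (phaseGate i j hij d).snd = j := rfl
  rw [hm, hf, hs, Finset.sum_eq_single (b i, b j)]
  · simp
  · intro c _ hc
    rw [Matrix.diagonal_apply_ne' _ hc, zero_mul]
  · simp

/-- Conjugating with a Hadamard gate on `k` turns the phase flip controlled by `k` and `g` into a
bit flip of `k` controlled by `g`. -/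
lemma hadamard_conj (k : ι) (g : (ι → Bool) → Bool) (hg : ∀ b c, g (Function.update b k c) = g b)
    (P : List (TwoQubitGate ι))
    (hP : ∀ Φ b, runCircuit P Φ b = (if b k && g b then -1 else 1) * Φ b)
    (Φ : QState ι) (b : ι → Bool) :
    runCircuit (hadamard k :: P ++ [hadamard k]) Φ b = Φ (Function.update b k (b k ^^ g b)) := by
  rw [List.cons_append, runCircuit_cons, runCircuit_append, runCircuit_cons, runCircuit_nil,
    hadamard_apply, hP, hP, hadamard_apply, hadamard_apply]
  have h := sqrtTwoInv_mul_self
  simp only [Function.update_self, Function.update_idem, hg]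
  cases hk : b k <;> cases hgb : g b <;> simp <;>
    first
    | linear_combination (2 * Φ (Function.update b k false)) * h
    | linear_combination (2 * Φ (Function.update b k true)) * h

/-- The phase `-1`. -/
def negOneCircle : Circle := ⟨-1, by simp [Submonoid.unitSphere]⟩

/-- The phase `i`. -/
def iCircle : Circle := ⟨Complex.I, by simp [Submonoid.unitSphere]⟩

@[simp] lemma coe_negOneCircle : (negOneCircle : ℂ) = -1 := rfl

@[simp] lemma coe_iCircle : (iCircle : ℂ) = Complex.I := rfl

/-- A circuit for the bit flip of `k`. -/
def notCircuit (k : ι) : List (TwoQubitGate ι) :=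
  hadamard k :: [phaseGate k (exists_ne k).choose (exists_ne k).choose_spec.symm
    fun a => if a.1 then negOneCircle else 1] ++ [hadamard k]

lemma runCircuit_notCircuit (k : ι) (Φ : QState ι) (b : ι → Bool) :
    runCircuit (notCircuit k) Φ b = Φ (Function.update b k (b k ^^ true)) := by
  refine hadamard_conj k (fun _ => true) (fun _ _ => rfl) _ (fun Φ b => ?_) Φ b
  rw [runCircuit_cons, runCircuit_nil, phaseGate_apply]
  cases b k <;> simp

/-- A circuit for the bit flip of `k` controlled by `i`. -/
def cnotCircuit (i k : ι) (h : i ≠ k) : List (TwoQubitGate ι) :=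
  hadamard k :: [phaseGate i k h fun a => if a.1 && a.2 then negOneCircle else 1] ++ [hadamard k]

lemma runCircuit_cnotCircuit (i k : ι) (h : i ≠ k) (Φ : QState ι) (b : ι → Bool) :
    runCircuit (cnotCircuit i k h) Φ b = Φ (Function.update b k (b k ^^ b i)) := by
  refine hadamard_conj k (fun b => b i) (fun _ _ => Function.update_of_ne h _ _) _
    (fun Φ b => ?_) Φ b
  rw [runCircuit_cons, runCircuit_nil, phaseGate_apply]
  cases b k <;> cases b i <;> simp

/-- A circuit for the bit flip of `k` controlled by `i` and `j`. -/
def toffoliCircuit (i j k : ι) (hij : i ≠ j) (hik : i ≠ k) (hjk : j ≠ k) :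
    List (TwoQubitGate ι) :=
  hadamard k :: (phaseGate j k hjk (fun a => if a.1 && a.2 then iCircle else 1) ::
    (cnotCircuit i j hij ++
      (phaseGate j k hjk (fun a => if a.1 && a.2 then iCircle⁻¹ else 1) ::
        (cnotCircuit i j hij ++
          [phaseGate i k hik (fun a => if a.1 && a.2 then iCircle else 1)])))) ++ [hadamard k]

lemma runCircuit_toffoliCircuit (i j k : ι) (hij : i ≠ j) (hik : i ≠ k) (hjk : j ≠ k)
    (Φ : QState ι) (b : ι → Bool) :
    runCircuit (toffoliCircuit i j k hij hik hjk) Φ b =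
      Φ (Function.update b k (b k ^^ (b i && b j))) := by
  refine hadamard_conj k (fun b => b i && b j)
    (fun _ _ => by simp [Function.update_of_ne hik, Function.update_of_ne hjk]) _
    (fun Φ b => ?_) Φ b
  -- The phase is `i ^ (b k * (b i + b j - (b i + b j mod 2)))`, and the exponent is
  -- `2 * b i * b j * b k`.
  simp only [runCircuit_cons, runCircuit_append, runCircuit_nil, phaseGate_apply,
    runCircuit_cnotCircuit, Function.update_self, Function.update_of_ne hij,
    Function.update_of_ne hjk.symm, Function.update_idem, Bool.xor_assoc, Bool.xor_self,
    Bool.xor_false, Function.update_eq_self]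
  cases b k <;> cases b i <;> cases b j <;> simp [← mul_assoc]

end Gates

end Circuits

/-! ### Reversible programs -/

/-- An elementary reversible operation on bits `ι`: a bit flip of one bit (the last argument), with
no control bit, one or two. -/
inductive RevOp (ι : Type) : Type
  | not (k : ι)
  | cnot (i k : ι) (hik : i ≠ k)
  | toffoli (i j k : ι) (hij : i ≠ j) (hik : i ≠ k) (hjk : j ≠ k)

section Programs

variable {ι : Type} [DecidableEq ι]

/-- The action of an elementary reversible operation on the memory content. -/
def RevOp.run : RevOp ι → (ι → Bool) → (ι → Bool)
  | .not k, b => Function.update b k (b k ^^ true)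
  | .cnot i k _, b => Function.update b k (b k ^^ b i)
  | .toffoli i j k _ _ _, b => Function.update b k (b k ^^ (b i && b j))

/-- The action of a reversible program, the head of the list first. -/
def runProg (P : List (RevOp ι)) (b : ι → Bool) : ι → Bool := P.foldl (fun b o => o.run b) b

@[simp] lemma runProg_nil (b : ι → Bool) : runProg [] b = b := rfl

@[simp] lemma runProg_cons (o : RevOp ι) (P : List (RevOp ι)) (b : ι → Bool) :
    runProg (o :: P) b = runProg P (o.run b) := rfl

lemma runProg_append (P Q : List (RevOp ι)) (b : ι → Bool) :
    runProg (P ++ Q) b = runProg Q (runProg P b) := by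
  simp [runProg]

lemma RevOp.run_run (o : RevOp ι) (b : ι → Bool) : o.run (o.run b) = b := by
  cases o with
  | not k => simp [RevOp.run]
  | cnot i k h => simp [RevOp.run, Function.update_of_ne h]
  | toffoli i j k hij hik hjk =>
    simp [RevOp.run, Function.update_of_ne hik, Function.update_of_ne hjk]

lemma runProg_reverse_runProg (P : List (RevOp ι)) (b : ι → Bool) :
    runProg P.reverse (runProg P b) = b := by
  induction P generalizing b with
  | nil => rfl
  | cons o P ih => rw [List.reverse_cons, runProg_append, runProg_cons o P, ih, runProg_cons,
      runProg_nil, RevOp.run_run]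

lemma runProg_runProg_reverse (P : List (RevOp ι)) (b : ι → Bool) :
    runProg P (runProg P.reverse b) = b := by
  simpa using runProg_reverse_runProg P.reverse b

variable [Fintype ι] [Nontrivial ι]

/-- The circuit of two-qubit gates for an elementary reversible operation. -/
def RevOp.circuit : RevOp ι → List (TwoQubitGate ι)
  | .not k => notCircuit k
  | .cnot i k h => cnotCircuit i k h
  | .toffoli i j k hij hik hjk => toffoliCircuit i j k hij hik hjk

/-- The circuit of two-qubit gates for a reversible program. -/
def compile (P : List (RevOp ι)) : List (TwoQubitGate ι) := P.flatMap RevOp.circuit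

lemma RevOp.runCircuit_circuit (o : RevOp ι) (Φ : QState ι) (b : ι → Bool) :
    runCircuit o.circuit Φ b = Φ (o.run b) := by
  cases o with
  | not k => exact runCircuit_notCircuit k Φ b
  | cnot i k h => exact runCircuit_cnotCircuit i k h Φ b
  | toffoli i j k hij hik hjk => exact runCircuit_toffoliCircuit i j k hij hik hjk Φ b

lemma runCircuit_compile (P : List (RevOp ι)) (Φ : QState ι) (b : ι → Bool) :
    runCircuit (compile P) Φ (runProg P b) = Φ b := by
  induction P generalizing Φ b with
  | nil => rfl
  | cons o P ih =>
    rw [runProg_cons]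
    change runCircuit (o.circuit ++ compile P) Φ _ = _
    rw [runCircuit_append, ih, RevOp.runCircuit_circuit, RevOp.run_run]

lemma length_compile_le (P : List (RevOp ι)) : (compile P).length ≤ 11 * P.length := by
  induction P with
  | nil => simp [compile]
  | cons o P ih =>
    have h : o.circuit.length ≤ 11 := by
      cases o <;> simp [RevOp.circuit, notCircuit, cnotCircuit, toffoliCircuit]
    have : compile (o :: P) = o.circuit ++ compile P := rfl
    rw [this, List.length_append, List.length_cons]
    omega

end Programs

/-! ### Boolean circuits and their reversible implementation -/

/-- `HasCircuit F s`: the function `F` on bit strings is computed by a Boolean circuit with `s`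
gates of fan-in two. The circuits are built from single gates by composition (`comp`), by joint
evaluation on the same input (`pair`) and by rewiring (`wire`), which is free. -/
inductive HasCircuit : {α β : Type} → ((α → Bool) → (β → Bool)) → ℕ → Prop
  | wire {α β : Type} (g : β → α) : HasCircuit (fun x => x ∘ g) 0
  | gate {α : Type} (op : Bool → Bool → Bool) (i j : α) :
      HasCircuit (fun (x : α → Bool) (_ : Unit) => op (x i) (x j)) 1
  | const {α : Type} (c : Bool) : HasCircuit (fun (_ : α → Bool) (_ : Unit) => c) 1
  | comp {α β γ : Type} {F : (α → Bool) → (β → Bool)} {G : (β → Bool) → (γ → Bool)} {s t : ℕ} :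
      HasCircuit F s → HasCircuit G t → HasCircuit (fun x => G (F x)) (s + t)
  | pair {α β γ : Type} {F : (α → Bool) → (β → Bool)} {G : (α → Bool) → (γ → Bool)} {s t : ℕ} :
      HasCircuit F s → HasCircuit G t → HasCircuit (fun x => Sum.elim (F x) (G x)) (s + t)

section Reversible

variable {ι : Type} [DecidableEq ι]

/-- A gate of fan-in two is written into a clean bit `k` by means of its algebraic normal form. -/
lemma exists_prog_gate (op : Bool → Bool → Bool) (i j k : ι) (hi : i ≠ k) (hj : j ≠ k) :
    ∃ P : List (RevOp ι), P.length ≤ 4 ∧ ∀ b : ι → Bool, b k = false →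
      runProg P b = Function.update b k (op (b i) (b j)) := by
  let c0 := op false false
  let c1 := op true false ^^ c0
  let c2 := op false true ^^ c0
  let c3 := op true true ^^ op true false ^^ op false true ^^ c0
  by_cases hij : i = j
  · subst hij
    refine ⟨(if c0 then [RevOp.not k] else []) ++
      (if op true true ^^ c0 then [RevOp.cnot i k hi] else []), ?_, fun b hb => ?_⟩
    · split_ifs <;> simp
    · by_cases h0 : c0 = true <;> by_cases h1 : (op true true ^^ c0) = true <;>
        cases hbi : b i <;>
        simp_all [c0, runProg, RevOp.run, Function.update_of_ne]
  · refine ⟨(if c0 then [RevOp.not k] else []) ++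
      ((if c1 then [RevOp.cnot i k hi] else []) ++
      ((if c2 then [RevOp.cnot j k hj] else []) ++
      (if c3 then [RevOp.toffoli i j k hij hi hj] else []))), ?_, fun b hb => ?_⟩
    · split_ifs <;> simp
    · have e0 : ∀ m : ι → Bool, runProg (if c0 then [RevOp.not k] else []) m =
          Function.update m k (m k ^^ c0) := by
        intro m; by_cases h : c0 = true <;> simp [h, RevOp.run]
      have e1 : ∀ m : ι → Bool, runProg (if c1 then [RevOp.cnot i k hi] else []) m =
          Function.update m k (m k ^^ (c1 && m i)) := by
        intro m; by_cases h : c1 = true <;> simp [h, RevOp.run]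
      have e2 : ∀ m : ι → Bool, runProg (if c2 then [RevOp.cnot j k hj] else []) m =
          Function.update m k (m k ^^ (c2 && m j)) := by
        intro m; by_cases h : c2 = true <;> simp [h, RevOp.run]
      have e3 : ∀ m : ι → Bool, runProg (if c3 then [RevOp.toffoli i j k hij hi hj] else []) m =
          Function.update m k (m k ^^ (c3 && (m i && m j))) := by
        intro m; by_cases h : c3 = true <;> simp [h, RevOp.run]
      simp only [runProg_append, e0, e1, e2, e3, Function.update_self, Function.update_of_ne hi,
        Function.update_of_ne hj, Function.update_idem, hb]
      congr 1
      simp only [c0, c1, c2, c3]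
      cases b i <;> cases b j <;> cases op false false <;> cases op true false <;>
        cases op false true <;> cases op true true <;> rfl

/-- A Boolean circuit with `s` gates is evaluated by a reversible program on `s` clean bits `anc`.
The string `G x` collects the values of all gates, and `q` tells where the output bits are found
among the inputs and the gates. -/
theorem HasCircuit.exists_prog {α β : Type} {F : (α → Bool) → (β → Bool)} {s : ℕ}
    (h : HasCircuit F s) :
    ∃ (q : β → α ⊕ Fin s) (G : (α → Bool) → (Fin s → Bool)),
      (∀ x b, Sum.elim x (G x) (q b) = F x b) ∧
      ∀ (p : α → ι) (anc : Fin s → ι), Function.Injective anc → (∀ a i, p a ≠ anc i) →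
        ∃ P : List (RevOp ι), P.length ≤ 4 * s ∧ ∀ m : ι → Bool, (∀ i, m (anc i) = false) →
          (∀ i, runProg P m (anc i) = G (m ∘ p) i) ∧
          ∀ x, (∀ i, x ≠ anc i) → runProg P m x = m x := by
  induction h with
  | wire g =>
    exact ⟨fun b => Sum.inl (g b), fun _ i => i.elim0, fun x b => rfl,
      fun p anc _ _ => ⟨[], by simp, fun m _ => ⟨fun i => i.elim0, fun x _ => rfl⟩⟩⟩
  | gate op i j =>
    refine ⟨fun _ => Sum.inr 0, fun x _ => op (x i) (x j), fun x b => rfl,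
      fun p anc _ hp => ?_⟩
    obtain ⟨P, hl, hP⟩ := exists_prog_gate op (p i) (p j) (anc 0) (hp i 0) (hp j 0)
    refine ⟨P, by omega, fun m hm => ?_⟩
    rw [hP m (hm 0)]
    refine ⟨fun l => ?_, fun x hx => Function.update_of_ne (hx 0) _ _⟩
    rw [Subsingleton.elim l 0, Function.update_self]
    rfl
  | const c =>
    refine ⟨fun _ => Sum.inr 0, fun x _ => c, fun x b => rfl, fun p anc _ hp => ?_⟩
    refine ⟨if c then [RevOp.not (anc 0)] else [], by split_ifs <;> simp, fun m hm => ?_⟩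
    refine ⟨fun l => ?_, fun x hx => ?_⟩
    · rw [Subsingleton.elim l 0]
      cases c <;> simp [RevOp.run, hm 0]
    · cases c <;> simp [RevOp.run, Function.update_of_ne (hx 0)]
  | @comp α β γ F G s t _ _ ihF ihG =>
    obtain ⟨q1, G1, hq1, h1⟩ := ihF
    obtain ⟨q2, G2, hq2, h2⟩ := ihG
    refine ⟨fun c => Sum.elim (fun b => Sum.map id (Fin.castAdd t) (q1 b))
        (fun i => Sum.inr (Fin.natAdd s i)) (q2 c),
      fun x => Fin.addCases (G1 x) (G2 (F x)), fun x c => ?_, fun p anc hinj hp => ?_⟩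
    · beta_reduce
      rw [← hq2 (F x) c]
      rcases q2 c with b | i
      · simp only [Sum.elim_inl]
        rw [← hq1 x b]
        rcases q1 b with a | i <;> simp
      · simp
    · obtain ⟨P1, hl1, hP1⟩ := h1 p (anc ∘ Fin.castAdd t)
        (hinj.comp (Fin.castAdd_injective s t)) (fun a i => hp a _)
      obtain ⟨P2, hl2, hP2⟩ := h2 (fun b => Sum.elim p (anc ∘ Fin.castAdd t) (q1 b))
        (anc ∘ Fin.natAdd s) (hinj.comp (Fin.natAdd_injective t s)) (fun b i => by
          rcases q1 b with a | l
          · exact hp a _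
          · simp only [Sum.elim_inr, Function.comp_apply]
            refine fun h => ?_
            have := congrArg Fin.val (hinj h)
            simp at this
            omega)
      refine ⟨P1 ++ P2, by rw [List.length_append]; omega, fun m hm => ?_⟩
      obtain ⟨hA, hB⟩ := hP1 m (fun i => hm _)
      have hne : ∀ (i : Fin t) (l : Fin s), anc (Fin.natAdd s i) ≠ anc (Fin.castAdd t l) := by
        intro i l h
        have := congrArg Fin.val (hinj h)
        simp at this
        omega
      obtain ⟨hC, hD⟩ := hP2 (runProg P1 m) (fun i => by
        exact (hB _ (fun l => hne i l)).trans (hm _))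
      have hF : (runProg P1 m ∘ fun b => Sum.elim p (anc ∘ Fin.castAdd t) (q1 b)) = F (m ∘ p) := by
        funext b
        rw [← hq1 (m ∘ p) b]
        simp only [Function.comp_apply]
        rcases q1 b with a | l
        · exact hB _ (fun i => hp a _)
        · exact hA l
      rw [runProg_append]
      refine ⟨fun i => ?_, fun x hx => ?_⟩
      · refine Fin.addCases (fun l => ?_) (fun l => ?_) i
        · beta_reduce
          rw [Fin.addCases_left, hD _ (fun i => (hne i l).symm)]
          exact hA l
        · beta_reduce
          rw [Fin.addCases_right]
          have := hC l
          rw [hF] at this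
          exact this
      · rw [hD x (fun i => hx _), hB x (fun i => hx _)]
  | @pair α β γ F G s t _ _ ihF ihG =>
    obtain ⟨q1, G1, hq1, h1⟩ := ihF
    obtain ⟨q2, G2, hq2, h2⟩ := ihG
    refine ⟨Sum.elim (fun b => Sum.map id (Fin.castAdd t) (q1 b))
        (fun c => Sum.map id (Fin.natAdd s) (q2 c)),
      fun x => Fin.addCases (G1 x) (G2 x), fun x c => ?_, fun p anc hinj hp => ?_⟩
    · rcases c with b | c
      · beta_reduce
        rw [Sum.elim_inl, Sum.elim_inl, ← hq1 x b]
        rcases q1 b with a | i <;> simp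
      · beta_reduce
        rw [Sum.elim_inr, Sum.elim_inr, ← hq2 x c]
        rcases q2 c with a | i <;> simp
    · obtain ⟨P1, hl1, hP1⟩ := h1 p (anc ∘ Fin.castAdd t)
        (hinj.comp (Fin.castAdd_injective s t)) (fun a i => hp a _)
      obtain ⟨P2, hl2, hP2⟩ := h2 p (anc ∘ Fin.natAdd s)
        (hinj.comp (Fin.natAdd_injective t s)) (fun a i => hp a _)
      refine ⟨P1 ++ P2, by rw [List.length_append]; omega, fun m hm => ?_⟩
      obtain ⟨hA, hB⟩ := hP1 m (fun i => hm _)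
      have hne : ∀ (i : Fin t) (l : Fin s), anc (Fin.natAdd s i) ≠ anc (Fin.castAdd t l) := by
        intro i l h
        have := congrArg Fin.val (hinj h)
        simp at this
        omega
      obtain ⟨hC, hD⟩ := hP2 (runProg P1 m) (fun i => by
        exact (hB _ (fun l => hne i l)).trans (hm _))
      have hF : runProg P1 m ∘ p = m ∘ p := by
        funext a
        exact hB _ (fun i => hp a _)
      rw [runProg_append]
      refine ⟨fun i => ?_, fun x hx => ?_⟩
      · refine Fin.addCases (fun l => ?_) (fun l => ?_) i
        · beta_reduce
          rw [Fin.addCases_left, hD _ (fun i => (hne i l).symm)]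
          exact hA l
        · beta_reduce
          rw [Fin.addCases_right]
          have := hC l
          rw [hF] at this
          exact this
      · rw [hD x (fun i => hx _), hB x (fun i => hx _)]

/-- The simultaneous bit flips of the `tgt j` controlled by the `q j`. -/
def cnotProg {β : Type} (q tgt : β → ι) (h : ∀ j l, q j ≠ tgt l) (l : List β) : List (RevOp ι) :=
  l.map fun j => RevOp.cnot (q j) (tgt j) (h j j)

lemma runProg_cnotProg {β : Type} (q tgt : β → ι) (h : ∀ j l, q j ≠ tgt l)
    (ht : Function.Injective tgt) (l : List β) (hl : l.Nodup) (m : ι → Bool) :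
    (∀ j ∈ l, runProg (cnotProg q tgt h l) m (tgt j) = (m (tgt j) ^^ m (q j))) ∧
    ∀ x, (∀ j ∈ l, x ≠ tgt j) → runProg (cnotProg q tgt h l) m x = m x := by
  induction l generalizing m with
  | nil => simp [cnotProg]
  | cons a l ih =>
    rw [List.nodup_cons] at hl
    obtain ⟨h1, h2⟩ := ih hl.2 ((RevOp.cnot (q a) (tgt a) (h a a)).run m)
    have hc : cnotProg q tgt h (a :: l) = RevOp.cnot (q a) (tgt a) (h a a) :: cnotProg q tgt h l :=
      rfl
    rw [hc, runProg_cons]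
    refine ⟨fun j hj => ?_, fun x hx => ?_⟩
    · rw [List.mem_cons] at hj
      rcases hj with rfl | hj
      · rw [h2 _ (fun l hl' hh => hl.1 (by rwa [ht hh]))]
        simp [RevOp.run]
      · have hja : tgt j ≠ tgt a := fun hh => hl.1 (ht hh ▸ hj)
        rw [h1 j hj]
        simp [RevOp.run, Function.update_of_ne hja, Function.update_of_ne (h j a)]
    · rw [h2 x (fun j hj => hx j (List.mem_cons_of_mem _ hj))]
      simp [RevOp.run, Function.update_of_ne (hx a List.mem_cons_self)]

/-- A function with a small Boolean circuit can be added bitwise (modulo two) to a register `tgt`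
by a short reversible program that uses clean bits `anc` and leaves them clean: the circuit is
evaluated, its output is copied, and the evaluation is undone. -/
theorem HasCircuit.exists_xorProg {α β : Type} [Fintype β] {F : (α → Bool) → (β → Bool)} {s : ℕ}
    (h : HasCircuit F s) (p : α → ι) (anc : Fin s → ι) (tgt : β → ι)
    (hanc : Function.Injective anc) (htgt : Function.Injective tgt)
    (hpa : ∀ a i, p a ≠ anc i) (hpt : ∀ a j, p a ≠ tgt j) (hat : ∀ i j, anc i ≠ tgt j) :
    ∃ P : List (RevOp ι), P.length ≤ 8 * s + Fintype.card β ∧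
      ∀ m : ι → Bool, (∀ i, m (anc i) = false) →
        (∀ j, runProg P m (tgt j) = (m (tgt j) ^^ F (m ∘ p) j)) ∧
        ∀ x, (∀ j, x ≠ tgt j) → runProg P m x = m x := by
  classical
  obtain ⟨q, G, hq, hP⟩ := h.exists_prog (ι := ι)
  obtain ⟨P, hl, hP⟩ := hP p anc hanc hpa
  have hqt : ∀ j l, Sum.elim p anc (q j) ≠ tgt l := by
    intro j l
    rcases q j with a | i
    · exact hpt a l
    · exact hat i l
  refine ⟨P ++ (cnotProg (fun j => Sum.elim p anc (q j)) tgt hqt Finset.univ.toList ++ P.reverse),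
    ?_, fun m hm => ?_⟩
  · simp [cnotProg]
    omega
  -- `m'` is the desired result, and running `P` on it gives the state just after the copying.
  let m' : ι → Bool := fun x => if hx : ∃ j, x = tgt j then m x ^^ F (m ∘ p) hx.choose else m x
  have hm't : ∀ j, m' (tgt j) = (m (tgt j) ^^ F (m ∘ p) j) := by
    intro j
    have hx : ∃ l, tgt j = tgt l := ⟨j, rfl⟩
    simp only [m', dif_pos hx]
    rw [htgt hx.choose_spec.symm]
  have hm'n : ∀ x, (∀ j, x ≠ tgt j) → m' x = m x := by
    intro x hx
    simp only [m']
    rw [dif_neg (fun ⟨j, hj⟩ => hx j hj)]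
  have hm'p : m' ∘ p = m ∘ p := funext fun a => hm'n _ (hpt a)
  obtain ⟨h1, h2⟩ := hP m hm
  obtain ⟨h3, h4⟩ := hP m' (fun i => by rw [hm'n _ (hat i), hm i])
  obtain ⟨h5, h6⟩ := runProg_cnotProg (fun j => Sum.elim p anc (q j)) tgt hqt htgt
    Finset.univ.toList (Finset.nodup_toList _) (runProg P m)
  have key : runProg (cnotProg (fun j => Sum.elim p anc (q j)) tgt hqt Finset.univ.toList)
      (runProg P m) = runProg P m' := by
    funext x
    by_cases hx : ∃ j, x = tgt j
    · obtain ⟨j, rfl⟩ := hx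
      rw [h5 j (by simp), h4 _ (fun i => (hat i j).symm), hm't, h2 _ (fun i => (hat i j).symm),
        ← hq (m ∘ p) j]
      congr 1
      rcases q j with a | i
      · exact h2 _ (hpa a)
      · exact h1 i
    · push Not at hx
      rw [h6 x (fun j _ => hx j)]
      by_cases hxa : ∃ i, x = anc i
      · obtain ⟨i, rfl⟩ := hxa
        rw [h1, h3, hm'p]
      · push Not at hxa
        rw [h2 x hxa, h4 x hxa, hm'n x hx]
  rw [runProg_append, runProg_append, key, runProg_reverse_runProg]
  exact ⟨hm't, hm'n⟩

end Reversible

/-! ### Circuits for functions on encoded data -/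

/-- An encoding of the elements of `A` by bit strings. -/
class BitEncoding (A : Type) where
  Wire : Type
  bits : A → Wire → Bool

instance : BitEncoding Bool := ⟨Unit, fun b _ => b⟩

instance (w : ℕ) : BitEncoding (BitVec w) := ⟨Fin w, fun x i => x.getLsbD i⟩

instance (α : Type) : BitEncoding (α → Bool) := ⟨α, id⟩

instance (A B : Type) [BitEncoding A] [BitEncoding B] : BitEncoding (A × B) :=
  ⟨BitEncoding.Wire A ⊕ BitEncoding.Wire B,
    fun p => Sum.elim (BitEncoding.bits p.1) (BitEncoding.bits p.2)⟩

/-- `Ckt f s`: on encoded data, the function `f` is computed by a Boolean circuit with at most `s`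
gates. -/
def Ckt {A B : Type} [BitEncoding A] [BitEncoding B] (f : A → B) (s : ℕ) : Prop :=
  ∃ (F : (BitEncoding.Wire A → Bool) → (BitEncoding.Wire B → Bool)) (t : ℕ),
    t ≤ s ∧ HasCircuit F t ∧ ∀ a, F (BitEncoding.bits a) = BitEncoding.bits (f a)

namespace Ckt

variable {A B C : Type} [BitEncoding A] [BitEncoding B] [BitEncoding C]

lemma mono {f : A → B} {s t : ℕ} (h : Ckt f s) (hst : s ≤ t) : Ckt f t := by
  obtain ⟨F, r, hr, hF, h⟩ := h
  exact ⟨F, r, hr.trans hst, hF, h⟩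

lemma of_wires {f : A → B} (g : BitEncoding.Wire B → BitEncoding.Wire A)
    (h : ∀ a, BitEncoding.bits a ∘ g = BitEncoding.bits (f a)) (s : ℕ) : Ckt f s :=
  ⟨_, 0, Nat.zero_le s, HasCircuit.wire g, h⟩

lemma id' : Ckt (fun a : A => a) 0 := of_wires id (fun _ => rfl) 0

lemma comp {f : A → B} {g : B → C} {s t : ℕ} (hf : Ckt f s) (hg : Ckt g t) :
    Ckt (fun a => g (f a)) (s + t) := by
  obtain ⟨F, r, hr, hF, hf⟩ := hf
  obtain ⟨G, r', hr', hG, hg⟩ := hg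
  exact ⟨_, r + r', by omega, hF.comp hG, fun a => by rw [hf, hg]⟩

lemma pair {f : A → B} {g : A → C} {s t : ℕ} (hf : Ckt f s) (hg : Ckt g t) :
    Ckt (fun a => (f a, g a)) (s + t) := by
  obtain ⟨F, r, hr, hF, hf⟩ := hf
  obtain ⟨G, r', hr', hG, hg⟩ := hg
  exact ⟨_, r + r', by omega, hF.pair hG, fun a => by rw [hf, hg]; rfl⟩

lemma fst {f : A → B × C} {s : ℕ} (hf : Ckt f s) : Ckt (fun a => (f a).1) s :=
  hf.comp (of_wires (f := fun p : B × C => p.1) Sum.inl (fun _ => rfl) 0)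

lemma snd {f : A → B × C} {s : ℕ} (hf : Ckt f s) : Ckt (fun a => (f a).2) s :=
  hf.comp (of_wires (f := fun p : B × C => p.2) Sum.inr (fun _ => rfl) 0)

lemma boolConst (c : Bool) : Ckt (fun _ : A => c) 1 :=
  ⟨_, 1, le_rfl, HasCircuit.const c, fun _ => rfl⟩

lemma op₂ (op : Bool → Bool → Bool) {f g : A → Bool} {s t : ℕ} (hf : Ckt f s) (hg : Ckt g t) :
    Ckt (fun a => op (f a) (g a)) (s + t + 1) :=
  (hf.pair hg).comp (f := fun a => (f a, g a)) (g := fun p : Bool × Bool => op p.1 p.2)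
    ⟨_, 1, le_rfl, HasCircuit.gate op (Sum.inl ()) (Sum.inr ()), fun _ => rfl⟩

lemma not {f : A → Bool} {s : ℕ} (hf : Ckt f s) : Ckt (fun a => !f a) (s + 1) :=
  hf.comp (g := fun b : Bool => !b)
    ⟨_, 1, le_rfl, HasCircuit.gate (fun b _ => !b) () (), fun _ => rfl⟩

variable {w : ℕ}

lemma getLsbD {f : A → BitVec w} {s : ℕ} (hf : Ckt f s) (i : ℕ) :
    Ckt (fun a => (f a).getLsbD i) (s + 1) := by
  refine hf.comp (g := fun x : BitVec w => x.getLsbD i) ?_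
  by_cases hi : i < w
  · exact of_wires (fun _ => (⟨i, hi⟩ : Fin w)) (fun _ => rfl) 1
  · refine ⟨_, 1, le_rfl, HasCircuit.const false, fun x => ?_⟩
    beta_reduce
    rw [BitVec.getLsbD_of_ge x i (by omega)]
    rfl

/-- The output bits may be computed one by one. -/
lemma of_getLsbD {f : A → BitVec w} {s : ℕ} (h : ∀ i < w, Ckt (fun a => (f a).getLsbD i) s) :
    Ckt f (w * s) := by
  have key : ∀ n ≤ w, ∃ (F : (BitEncoding.Wire A → Bool) → (Fin n → Bool)) (t : ℕ), t ≤ n * s ∧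
      HasCircuit F t ∧ ∀ a i, F (BitEncoding.bits a) i = (f a).getLsbD i := by
    intro n
    induction n with
    | zero =>
      intro _
      exact ⟨_, 0, by omega, HasCircuit.wire (fun i : Fin 0 => i.elim0), fun a i => i.elim0⟩
    | succ n ih =>
      intro hn
      obtain ⟨F, t, ht, hF, hf⟩ := ih (by omega)
      obtain ⟨G, r, hr, hG, hg⟩ := h n (by omega)
      refine ⟨_, t + r + 0, by rw [add_mul]; omega,
        (hF.pair hG).comp (HasCircuit.wire (fun i : Fin (n + 1) =>
          Fin.lastCases (Sum.inr ()) (fun j => Sum.inl j) i)), fun a i => ?_⟩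
      refine Fin.lastCases ?_ (fun j => ?_) i
      · simp [hg a]
        rfl
      · simp [hf a j]
  obtain ⟨F, t, ht, hF, hf⟩ := key w le_rfl
  exact ⟨F, t, ht, hF, fun a => funext fun i => hf a i⟩

lemma bvConst (c : BitVec w) : Ckt (fun _ : A => c) w :=
  (of_getLsbD (s := 1) fun i _ => boolConst (c.getLsbD i)).mono (by omega)

/-! ### Circuits for arithmetic on bit vectors -/

/-- The carry bits of an addition are computed one after the other. -/
lemma carry {x y : A → BitVec w} {s : ℕ} (hx : ∀ i, Ckt (fun a => (x a).getLsbD i) s)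
    (hy : ∀ i, Ckt (fun a => (y a).getLsbD i) s) (c : Bool) (i : ℕ) :
    Ckt (fun a => BitVec.carry i (x a) (y a) c) (i * (4 * s + 4) + 1) := by
  induction i with
  | zero => simpa using boolConst c
  | succ i ih =>
    have h : (fun a => BitVec.carry (i + 1) (x a) (y a) c) = fun a =>
        (((x a).getLsbD i && (y a).getLsbD i) ||
          (((x a).getLsbD i || (y a).getLsbD i) && BitVec.carry i (x a) (y a) c)) := by
      funext a
      rw [BitVec.carry_succ]
      cases (x a).getLsbD i <;> cases (y a).getLsbD i <;> simp
    rw [h]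
    refine (op₂ or (op₂ and (hx i) (hy i)) (op₂ and (op₂ or (hx i) (hy i)) ih)).mono ?_
    rw [add_mul]
    omega

/-- A common bound for the number of gates for a sum, a difference or a comparison. -/
def lightCost (w : ℕ) : ℕ := 20 * (w + 1) ^ 2

lemma add_add_bool {x y : A → BitVec w} (hx : ∀ i, Ckt (fun a => (x a).getLsbD i) 2)
    (hy : ∀ i, Ckt (fun a => (y a).getLsbD i) 2) (c : Bool) :
    Ckt (fun a => x a + y a + BitVec.setWidth w (BitVec.ofBool c)) (lightCost w) := by
  refine (of_getLsbD (s := w * 12 + 7) fun i hi => ?_).mono (by unfold lightCost; nlinarith)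
  simp only [BitVec.getLsbD_add_add_bool hi]
  refine (op₂ xor (hx i) (op₂ xor (hy i) (carry hx hy c i))).mono ?_
  nlinarith

lemma fst_getLsbD (i : ℕ) : Ckt (fun p : BitVec w × BitVec w => p.1.getLsbD i) 2 :=
  (id'.fst.getLsbD i).mono (by omega)

lemma snd_getLsbD (i : ℕ) : Ckt (fun p : BitVec w × BitVec w => p.2.getLsbD i) 2 :=
  (id'.snd.getLsbD i).mono (by omega)

lemma not_snd_getLsbD (i : ℕ) : Ckt (fun p : BitVec w × BitVec w => (~~~p.2).getLsbD i) 2 := by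
  by_cases hi : i < w
  · simp only [BitVec.getLsbD_not, hi, decide_true, Bool.true_and]
    exact (id'.snd.getLsbD i).not
  · have : (fun p : BitVec w × BitVec w => (~~~p.2).getLsbD i) = fun _ => false := by
      funext p
      exact BitVec.getLsbD_of_ge _ _ (by omega)
    rw [this]
    exact (boolConst false).mono (by omega)

lemma add' {f g : A → BitVec w} {s t : ℕ} (hf : Ckt f s) (hg : Ckt g t) :
    Ckt (fun a => f a + g a) (s + t + lightCost w) := by
  refine (hf.pair hg).comp (g := fun p : BitVec w × BitVec w => p.1 + p.2) ?_
  have h := add_add_bool (w := w) fst_getLsbD snd_getLsbD false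
  simpa using h

lemma sub' {f g : A → BitVec w} {s t : ℕ} (hf : Ckt f s) (hg : Ckt g t) :
    Ckt (fun a => f a - g a) (s + t + lightCost w) := by
  refine (hf.pair hg).comp (g := fun p : BitVec w × BitVec w => p.1 - p.2) ?_
  have h := add_add_bool (w := w) fst_getLsbD not_snd_getLsbD true
  convert h using 2 with p
  rw [BitVec.sub_eq_add_neg, BitVec.neg_eq_not_add, BitVec.add_assoc]
  congr 2
  ext i hi
  simp [BitVec.getElem_one]

lemma ult' {f g : A → BitVec w} {s t : ℕ} (hf : Ckt f s) (hg : Ckt g t) :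
    Ckt (fun a => decide (f a < g a)) (s + t + lightCost w) := by
  refine (hf.pair hg).comp (g := fun p : BitVec w × BitVec w => decide (p.1 < p.2)) ?_
  have h := (carry (w := w) fst_getLsbD not_snd_getLsbD true w).not
  have h2 : (fun p : BitVec w × BitVec w => decide (p.1 < p.2)) = fun p =>
      !BitVec.carry w p.1 (~~~p.2) true := by
    funext p
    rw [← BitVec.ult_eq_not_carry]
    rfl
  rw [h2]
  exact h.mono (by unfold lightCost; nlinarith)

lemma ite' {c : A → Bool} {f g : A → BitVec w} {s t r : ℕ} (hc : Ckt c r) (hf : Ckt f s)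
    (hg : Ckt g t) : Ckt (fun a => if c a then f a else g a) (r + (s + t) + lightCost w) := by
  refine (hc.pair (hf.pair hg)).comp
    (g := fun p : Bool × BitVec w × BitVec w => if p.1 then p.2.1 else p.2.2) ?_
  refine (of_getLsbD (s := 6) fun i hi => ?_).mono (by unfold lightCost; nlinarith)
  have h : (fun p : Bool × BitVec w × BitVec w => (if p.1 then p.2.1 else p.2.2).getLsbD i) =
      fun p => ((p.1 && p.2.1.getLsbD i) || (!p.1 && p.2.2.getLsbD i)) := by
    funext p
    cases p.1 <;> simp
  rw [h]
  exact (op₂ or (op₂ and id'.fst (id'.snd.fst.getLsbD i))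
    (op₂ (fun a b => !a && b) id'.fst (id'.snd.snd.getLsbD i))).mono (by omega)

lemma shiftConcat' {f : A → BitVec w} {b : A → Bool} {s t : ℕ} (hf : Ckt f s) (hb : Ckt b t) :
    Ckt (fun a => (f a).shiftConcat (b a)) (s + t + lightCost w) := by
  refine (hf.pair hb).comp (g := fun p : BitVec w × Bool => p.1.shiftConcat p.2) ?_
  refine (of_getLsbD (s := 1) fun i hi => ?_).mono (by unfold lightCost; nlinarith)
  by_cases h0 : i = 0
  · subst h0
    simp only [BitVec.getLsbD_shiftConcat, if_true, hi, decide_true, Bool.true_and]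
    exact id'.snd.mono (by omega)
  · simp only [BitVec.getLsbD_shiftConcat, hi, h0, decide_true, Bool.true_and, if_false]
    exact id'.fst.getLsbD (i - 1)

/-- A common bound for the number of gates for each of the word operations used below. -/
def opCost (w : ℕ) : ℕ := 2000 * (w + 1) ^ 3

lemma lightCost_le_opCost : lightCost w ≤ opCost w := by
  unfold lightCost opCost
  nlinarith [Nat.zero_le (w * (w + 1) ^ 2), Nat.zero_le ((w + 1) ^ 2)]

lemma add {f g : A → BitVec w} {s t : ℕ} (hf : Ckt f s) (hg : Ckt g t) :
    Ckt (fun a => f a + g a) (s + t + opCost w) :=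
  (add' hf hg).mono (by have := lightCost_le_opCost (w := w); omega)

lemma sub {f g : A → BitVec w} {s t : ℕ} (hf : Ckt f s) (hg : Ckt g t) :
    Ckt (fun a => f a - g a) (s + t + opCost w) :=
  (sub' hf hg).mono (by have := lightCost_le_opCost (w := w); omega)

lemma ult {f g : A → BitVec w} {s t : ℕ} (hf : Ckt f s) (hg : Ckt g t) :
    Ckt (fun a => decide (f a < g a)) (s + t + opCost w) :=
  (ult' hf hg).mono (by have := lightCost_le_opCost (w := w); omega)

lemma ite {c : A → Bool} {f g : A → BitVec w} {s t r : ℕ} (hc : Ckt c r) (hf : Ckt f s)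
    (hg : Ckt g t) : Ckt (fun a => if c a then f a else g a) (r + (s + t) + opCost w) :=
  (ite' hc hf hg).mono (by have := lightCost_le_opCost (w := w); omega)

lemma const (c : BitVec w) : Ckt (fun _ : A => c) (opCost w) :=
  (bvConst c).mono (by
    have := lightCost_le_opCost (w := w)
    have : w ≤ lightCost w := by unfold lightCost; nlinarith
    omega)

lemma mul {f g : A → BitVec w} {s t : ℕ} (hf : Ckt f s) (hg : Ckt g t) :
    Ckt (fun a => f a * g a) (s + t + opCost w) := by
  refine (hf.pair hg).comp (g := fun p : BitVec w × BitVec w => p.1 * p.2) ?_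
  have hterm : ∀ j, Ckt (fun p : BitVec w × BitVec w => if p.2.getLsbD j then p.1 <<< j else 0)
      (lightCost w) := by
    intro j
    refine (of_getLsbD (s := 4) fun i hi => ?_).mono (by unfold lightCost; nlinarith)
    by_cases hj : i < j
    · have : (fun p : BitVec w × BitVec w => (if p.2.getLsbD j then p.1 <<< j else 0).getLsbD i) =
          fun _ => false := by
        funext p
        split_ifs <;> simp [hj]
      rw [this]
      exact (boolConst false).mono (by omega)
    · have : (fun p : BitVec w × BitVec w => (if p.2.getLsbD j then p.1 <<< j else 0).getLsbD i) =
          fun p => (p.2.getLsbD j && p.1.getLsbD (i - j)) := by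
        funext p
        cases hp : p.2.getLsbD j
        · simp
        · simp only [if_true, BitVec.getLsbD_shiftLeft, hi, hj, decide_true, decide_false,
            Bool.not_false, Bool.true_and]
      rw [this]
      exact (op₂ and (id'.snd.getLsbD j) (id'.fst.getLsbD (i - j))).mono (by omega)
  have hrec : ∀ j, Ckt (fun p : BitVec w × BitVec w => BitVec.mulRec p.1 p.2 j)
      ((j + 1) * (2 * lightCost w)) := by
    intro j
    induction j with
    | zero =>
      simp only [BitVec.mulRec_zero_eq]
      have h := (hterm 0).mono (t := (0 + 1) * (2 * lightCost w)) (by omega)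
      simpa using h
    | succ j ih =>
      simp only [BitVec.mulRec_succ_eq]
      refine (add' ih (hterm (j + 1))).mono ?_
      rw [add_mul (j + 1)]
      omega
  simp only [BitVec.mul_eq_mulRec]
  exact (hrec w).mono (by unfold lightCost opCost; nlinarith)

/-- The state of a long division, made of the quotient and the remainder, after `m` further
digits. The number `c` of unprocessed digits of the dividend does not depend on the input. -/
lemma divRec {st : BitVec w × BitVec w → BitVec.DivModState w} {s : ℕ} (m c : ℕ)
    (hwn : ∀ p, (st p).wn = c) (h : Ckt (fun p => (p, (st p).q, (st p).r)) s) :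
    Ckt (fun p => ((BitVec.divRec m ⟨p.1, p.2⟩ (st p)).q, (BitVec.divRec m ⟨p.1, p.2⟩ (st p)).r))
      (s + m * (20 * lightCost w)) := by
  induction m generalizing st s c with
  | zero => simpa using h.snd
  | succ m ih =>
    simp only [BitVec.divRec_succ]
    have hL : 0 < lightCost w := by unfold lightCost; positivity
    refine (ih (s := s + 20 * lightCost w) (st := fun p => BitVec.divSubtractShift ⟨p.1, p.2⟩ (st p))
      (c - 1) (fun p => ?_) ?_).mono ?_
    · simp only [BitVec.divSubtractShift]
      split_ifs <;> simp [hwn]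
    · let X := (BitVec w × BitVec w) × BitVec w × BitVec w
      have hr : Ckt (fun x : X => x.2.2.shiftConcat (x.1.1.getLsbD (c - 1))) (2 * lightCost w) :=
        (shiftConcat' id'.snd.snd (id'.fst.fst.getLsbD (c - 1))).mono (by omega)
      have hlt : Ckt (fun x : X =>
          decide (x.2.2.shiftConcat (x.1.1.getLsbD (c - 1)) < x.1.2)) (3 * lightCost w) :=
        (ult' hr id'.fst.snd).mono (by omega)
      have hstep : Ckt (fun x : X => (x.1,
          x.2.1.shiftConcat (!decide (x.2.2.shiftConcat (x.1.1.getLsbD (c - 1)) < x.1.2)),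
          if decide (x.2.2.shiftConcat (x.1.1.getLsbD (c - 1)) < x.1.2) then
            x.2.2.shiftConcat (x.1.1.getLsbD (c - 1)) else
            x.2.2.shiftConcat (x.1.1.getLsbD (c - 1)) - x.1.2)) (20 * lightCost w) :=
        (id'.fst.pair ((shiftConcat' id'.snd.fst hlt.not).pair
          (ite' hlt hr (sub' hr id'.fst.snd)))).mono (by omega)
      convert h.comp hstep using 2 with p
      simp only [BitVec.divSubtractShift, hwn, decide_eq_true_eq]
      split_ifs with h1 <;> simp [h1]
    · rw [add_mul]
      omega

lemma divMod : Ckt (fun p : BitVec w × BitVec w => (p.1 / p.2, p.1 % p.2)) (opCost w) := by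
  have h0 : Ckt (fun p : BitVec w × BitVec w => (p, (BitVec.DivModState.init w).q,
      (BitVec.DivModState.init w).r)) (w + w) := (id'.pair ((bvConst _).pair (bvConst _))).mono (by omega)
  have h := divRec (st := fun _ => BitVec.DivModState.init w) w w (fun _ => rfl) h0
  have hpos : Ckt (fun p : BitVec w × BitVec w => decide (0#w < p.2)) (w + lightCost w) :=
    (ult' (bvConst 0#w) id'.snd).mono (by omega)
  have heq : (fun p : BitVec w × BitVec w => (p.1 / p.2, p.1 % p.2)) = fun p =>
      (if decide (0#w < p.2) then
        (BitVec.divRec w ⟨p.1, p.2⟩ (BitVec.DivModState.init w)).q else 0#w,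
       if decide (0#w < p.2) then
        (BitVec.divRec w ⟨p.1, p.2⟩ (BitVec.DivModState.init w)).r else p.1) := by
    funext p
    by_cases hp : 0#w < p.2
    · simp only [hp, decide_true, if_true]
      rw [BitVec.udiv_eq_divRec hp, BitVec.umod_eq_divRec hp]
    · have : p.2 = 0#w := by
        rw [BitVec.not_lt] at hp
        exact BitVec.le_zero_iff.1 hp
      simp [this]
  rw [heq]
  refine ((ite' hpos h.fst (bvConst 0#w)).pair (ite' hpos h.snd id'.fst)).mono ?_
  have h1 : w * lightCost w ≤ 20 * (w + 1) ^ 3 := by unfold lightCost; nlinarith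
  have h2 : lightCost w ≤ 20 * (w + 1) ^ 3 := by unfold lightCost; nlinarith
  have h3 : w ≤ (w + 1) ^ 3 := by nlinarith [Nat.zero_le (w ^ 2), Nat.zero_le (w ^ 3)]
  have h4 : w * (20 * lightCost w) = 20 * (w * lightCost w) := by ring
  rw [h4]
  unfold opCost
  omega

lemma div {f g : A → BitVec w} {s t : ℕ} (hf : Ckt f s) (hg : Ckt g t) :
    Ckt (fun a => f a / g a) (s + t + opCost w) :=
  (hf.pair hg).comp (g := fun p : BitVec w × BitVec w => p.1 / p.2) divMod.fst

lemma mod {f g : A → BitVec w} {s t : ℕ} (hf : Ckt f s) (hg : Ckt g t) :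
    Ckt (fun a => f a % g a) (s + t + opCost w) :=
  (hf.pair hg).comp (g := fun p : BitVec w × BitVec w => p.1 % p.2) divMod.snd

lemma iterate {f : A → A} {s : ℕ} (hf : Ckt f s) (m : ℕ) : Ckt f^[m] (m * s) := by
  induction m with
  | zero => exact (id' (A := A)).mono (by omega)
  | succ m ih =>
    rw [Function.iterate_succ']
    exact (ih.comp hf).mono (by rw [add_mul]; omega)

/-- A register of the input, read as a word of `w` bits. -/
lemma ofBits {α : Type} {n : ℕ} (g : Fin n → α) :
    Ckt (fun x : α → Bool => BitVec.ofNat w (Nat.ofBits (x ∘ g))) (opCost w) := by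
  refine (of_getLsbD (s := 1) fun i hi => ?_).mono (by unfold opCost; nlinarith [sq_nonneg w, Nat.zero_le (w^3)])
  simp only [BitVec.getLsbD_ofNat, hi, decide_true, Bool.true_and, Nat.testBit_ofBits]
  by_cases hn : i < n
  · simp only [hn, dif_pos]
    exact of_wires (fun _ => g ⟨i, hn⟩) (fun _ => rfl) 1
  · simp only [hn, dif_neg, not_false_iff]
    exact boolConst false

/-- The circuit for the first `n` bits of the result of a computation. -/
lemma hasCircuit {α : Type} {f : (α → Bool) → BitVec w} {s : ℕ} (h : Ckt f s) {n : ℕ}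
    (hn : n ≤ w) : ∃ t ≤ s, HasCircuit (fun x (i : Fin n) => (f x).getLsbD i) t := by
  obtain ⟨F, t, ht, hF, hf⟩ := h
  refine ⟨t + 0, by omega, ?_⟩
  have h2 := hF.comp (HasCircuit.wire (Fin.castLE hn : Fin n → Fin w))
  have h3 : ∀ x, F x = fun i : Fin w => (f x).getLsbD i := hf
  simp only [h3] at h2
  exact h2

end Ckt

/-! ### Modular powers and inverses -/

section ModularArithmetic

variable {w : ℕ}

/-- One step of repeated squaring. The state consists of the modulus, the current square, the
accumulated product and the remaining exponent. -/
def powStep (s : BitVec w × BitVec w × BitVec w × BitVec w) :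
    BitVec w × BitVec w × BitVec w × BitVec w :=
  (s.1, s.2.1 * s.2.1 % s.1,
    if s.2.2.2.getLsbD 0 then s.2.2.1 * s.2.1 % s.1 else s.2.2.1, s.2.2.2 / 2#w)

lemma ckt_powStep : Ckt (powStep (w := w)) (10 * Ckt.opCost w) := by
  have hK : 0 < Ckt.opCost w := by unfold Ckt.opCost; positivity
  let S := BitVec w × BitVec w × BitVec w × BitVec w
  have hid : Ckt (fun s : S => s) 0 := Ckt.id'
  exact (hid.fst.pair (((hid.snd.fst.mul hid.snd.fst).mod hid.fst).pair
    ((Ckt.ite (hid.snd.snd.snd.getLsbD 0) ((hid.snd.snd.fst.mul hid.snd.fst).mod hid.fst)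
      hid.snd.snd.fst).pair (hid.snd.snd.snd.div (Ckt.const 2#w))))).mono (by omega)

lemma toNat_mul_mod_of_le {a b N : BitVec w} {n : ℕ} (hw : 2 * n ≤ w) (hn : N.toNat < 2 ^ n)
    (ha : a.toNat ≤ N.toNat) (hb : b.toNat ≤ N.toNat) :
    (a * b % N).toNat = a.toNat * b.toNat % N.toNat := by
  rw [BitVec.toNat_umod, BitVec.toNat_mul, Nat.mod_eq_of_lt (a := a.toNat * b.toNat)]
  calc a.toNat * b.toNat ≤ N.toNat * N.toNat := Nat.mul_le_mul ha hb
    _ < 2 ^ n * 2 ^ n := Nat.mul_lt_mul'' hn hn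
    _ = 2 ^ (2 * n) := by rw [← pow_add]; ring_nf
    _ ≤ 2 ^ w := Nat.pow_le_pow_right (by norm_num) hw

/-- Repeated squaring: the steps exhaust the `m` bits of the exponent `t`. The intermediate words are
only required to be at most `N`, not less, since the accumulated product starts with `1`, and the
modulus `N = 1` is admitted. -/
lemma toNat_iterate_powStep {n : ℕ} (hw : 2 * n ≤ w) (hw2 : 2 ≤ w) (m : ℕ)
    (N z g t : BitVec w) (hN : 0 < N.toNat) (hn : N.toNat < 2 ^ n) (hz : z.toNat ≤ N.toNat)
    (hg : g.toNat ≤ N.toNat) (ht : t.toNat < 2 ^ m) :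
    (powStep^[m] (N, z, g, t)).2.2.1.toNat ≡ g.toNat * z.toNat ^ t.toNat [MOD N.toNat] ∧
      (powStep^[m] (N, z, g, t)).2.2.1.toNat ≤ N.toNat := by
  induction m generalizing z g t with
  | zero =>
    have : t.toNat = 0 := by simpa using ht
    simp only [Function.iterate_zero, id_eq, this, pow_zero, mul_one]
    exact ⟨Nat.ModEq.refl _, hg⟩
  | succ m ih =>
    rw [Function.iterate_succ_apply]
    have h2 : (2#w).toNat = 2 := by
      rw [BitVec.toNat_ofNat, Nat.mod_eq_of_lt]
      calc 2 < 2 ^ 2 := by norm_num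
        _ ≤ 2 ^ w := Nat.pow_le_pow_right (by norm_num) hw2
    have hzz := toNat_mul_mod_of_le hw hn hz hz
    have hgz := toNat_mul_mod_of_le hw hn hg hz
    have ht2 : (t / 2#w).toNat = t.toNat / 2 := by rw [BitVec.toNat_udiv, h2]
    have hbit : t.getLsbD 0 = decide (t.toNat % 2 = 1) := by
      rw [BitVec.getLsbD, Nat.testBit_zero]
    have hsplit := Nat.div_add_mod t.toNat 2
    obtain ⟨h1, h3⟩ := ih (z * z % N) (if t.getLsbD 0 then g * z % N else g) (t / 2#w)
      (by rw [hzz]; exact (Nat.mod_lt _ hN).le)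
      (by split_ifs
          · rw [hgz]; exact (Nat.mod_lt _ hN).le
          · exact hg)
      (by rw [ht2]; omega)
    refine ⟨h1.trans ?_, h3⟩
    rw [ht2, hzz]
    have hpow : (z.toNat * z.toNat % N.toNat) ^ (t.toNat / 2) ≡
        z.toNat ^ (2 * (t.toNat / 2)) [MOD N.toNat] := by
      rw [pow_mul, pow_two]
      exact (Nat.mod_modEq _ _).pow _
    by_cases hodd : t.toNat % 2 = 1
    · rw [hbit]
      simp only [hodd, decide_true, if_true, hgz]
      refine ((Nat.mod_modEq _ _).mul hpow).trans ?_
      rw [mul_assoc, ← pow_succ', show 2 * (t.toNat / 2) + 1 = t.toNat by omega]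
    · rw [hbit]
      simp only [hodd, decide_false, Bool.false_eq_true, if_false]
      refine ((Nat.ModEq.refl _).mul hpow).trans ?_
      rw [show 2 * (t.toNat / 2) = t.toNat by omega]

/-- One step of the extended Euclidean algorithm. The state consists of the modulus, two
successive remainders and their coefficients. -/
def euclidStep (s : BitVec w × BitVec w × BitVec w × BitVec w × BitVec w) :
    BitVec w × BitVec w × BitVec w × BitVec w × BitVec w :=
  (s.1, if decide (0#w < s.2.2.1) then s.2.2.1 else s.2.1,
    if decide (0#w < s.2.2.1) then s.2.1 % s.2.2.1 else s.2.2.1,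
    if decide (0#w < s.2.2.1) then s.2.2.2.2 else s.2.2.2.1,
    if decide (0#w < s.2.2.1) then
      (s.2.2.2.1 + (s.1 - s.2.1 / s.2.2.1 * s.2.2.2.2 % s.1)) % s.1 else s.2.2.2.2)

lemma ckt_euclidStep : Ckt (euclidStep (w := w)) (30 * Ckt.opCost w) := by
  have hK : w ≤ Ckt.opCost w := by
    unfold Ckt.opCost; nlinarith [Nat.zero_le (w ^ 2), Nat.zero_le (w ^ 3)]
  let S := BitVec w × BitVec w × BitVec w × BitVec w × BitVec w
  have hid : Ckt (fun s : S => s) 0 := Ckt.id'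
  have hN := hid.fst
  have ha := hid.snd.fst
  have hb := hid.snd.snd.fst
  have hu := hid.snd.snd.snd.fst
  have hv := hid.snd.snd.snd.snd
  have hc : Ckt (fun s : S => decide (0#w < s.2.2.1)) (2 * Ckt.opCost w) :=
    ((Ckt.const 0#w).ult hb).mono (by omega)
  exact (hN.pair ((hc.ite hb ha).pair ((hc.ite (ha.mod hb) hb).pair ((hc.ite hv hu).pair
    (hc.ite ((hu.add (hN.sub (((ha.div hb).mul hv).mod hN))).mod hN) hv))))).mono (by omega)

/-- The extended Euclidean algorithm computes the inverse of `y` modulo `N`. It ends within `k` steps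
if the product of the two remainders is less than `2 ^ k`, since each step at least halves this
product; once the second remainder is zero, the state does not change any more. -/
lemma iterate_euclidStep {n y : ℕ} (hw : 2 * n ≤ w) (k : ℕ) (N a b u v : BitVec w)
    (hN : 0 < N.toNat) (hn : N.toNat < 2 ^ n) (hba : b.toNat ≤ a.toNat) (haN : a.toNat ≤ N.toNat)
    (hu : u.toNat ≤ N.toNat) (hv : v.toNat ≤ N.toNat) (hab : a.toNat * b.toNat < 2 ^ k)
    (ha0 : 0 < a.toNat) (hgcd : Nat.gcd a.toNat b.toNat = 1)
    (hua : (u.toNat * y : ZMod N.toNat) = a.toNat) (hvb : (v.toNat * y : ZMod N.toNat) = b.toNat) :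
    ((euclidStep^[k] (N, a, b, u, v)).2.2.2.1.toNat * y : ZMod N.toNat) = 1 ∧
      (euclidStep^[k] (N, a, b, u, v)).2.2.2.1.toNat ≤ N.toNat := by
  induction k generalizing a b u v with
  | zero =>
    have hb : b.toNat = 0 := by
      have h0 : a.toNat * b.toNat = 0 := by simpa using hab
      rcases Nat.mul_eq_zero.1 h0 with h | h <;> omega
    rw [hb, Nat.gcd_zero_right] at hgcd
    simp only [Function.iterate_zero, id_eq]
    exact ⟨by rw [hua, hgcd, Nat.cast_one], hu⟩
  | succ k ih =>
    rw [Function.iterate_succ_apply]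
    by_cases hb : b.toNat = 0
    · have hb' : ¬ (0#w < b) := by rw [BitVec.lt_def]; simp [hb]
      have hs : euclidStep (N, a, b, u, v) = (N, a, b, u, v) := by
        simp [euclidStep, hb']
      rw [hs]
      exact ih a b u v hba haN hu hv (by rw [hb, mul_zero]; positivity) ha0 hgcd hua hvb
    · have hb0 : 0 < b.toNat := Nat.pos_of_ne_zero hb
      have hb' : 0#w < b := by rw [BitVec.lt_def]; simpa using hb0
      have hs : euclidStep (N, a, b, u, v) = (N, b, a % b, v,
          (u + (N - a / b * v % N)) % N) := by
        simp [euclidStep, hb']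
      rw [hs]
      have hq : (a / b * v % N).toNat = a.toNat / b.toNat * v.toNat % N.toNat := by
        rw [toNat_mul_mod_of_le hw hn _ hv, BitVec.toNat_udiv]
        rw [BitVec.toNat_udiv]
        exact (Nat.div_le_self _ _).trans haN
      have hqN : a.toNat / b.toNat * v.toNat % N.toNat < N.toNat := Nat.mod_lt _ hN
      have hsub : (N - a / b * v % N).toNat =
          N.toNat - a.toNat / b.toNat * v.toNat % N.toNat := by
        rw [BitVec.toNat_sub_of_le (by rw [BitVec.le_def, hq]; exact hqN.le), hq]
      have hn1 : 1 ≤ n := by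
        rcases Nat.eq_zero_or_pos n with h | h
        · subst h; simp at hn; omega
        · exact h
      have h2w : 2 * 2 ^ n ≤ 2 ^ w := by
        rw [← pow_succ']
        exact Nat.pow_le_pow_right (by norm_num) (by omega)
      have hadd : ((u + (N - a / b * v % N)) % N).toNat =
          (u.toNat + (N.toNat - a.toNat / b.toNat * v.toNat % N.toNat)) % N.toNat := by
        rw [BitVec.toNat_umod, BitVec.toNat_add, hsub, Nat.mod_eq_of_lt (b := 2 ^ w)]
        omega
      have hmod : (a % b).toNat = a.toNat % b.toNat := BitVec.toNat_umod
      have hlt : a.toNat % b.toNat < b.toNat := Nat.mod_lt _ hb0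
      have hdm := Nat.div_add_mod a.toNat b.toNat
      have hdiv : 1 ≤ a.toNat / b.toNat := (Nat.one_le_div_iff hb0).2 hba
      refine ih b (a % b) v _ (by rw [hmod]; exact hlt.le) (hba.trans haN) hv
        (by rw [hadd]; exact (Nat.mod_lt _ hN).le) ?_ hb0 ?_ hvb ?_
      · rw [hmod]
        have : 2 * (a.toNat % b.toNat) ≤ a.toNat := by nlinarith
        have : b.toNat * (2 * (a.toNat % b.toNat)) ≤ b.toNat * a.toNat := Nat.mul_le_mul_left _ this
        rw [pow_succ] at hab
        nlinarith
      · rw [hmod, ← hgcd, Nat.gcd_comm b.toNat, ← Nat.gcd_rec b.toNat a.toNat, Nat.gcd_comm]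
      · rw [hadd, hmod, ZMod.natCast_mod, Nat.cast_add, Nat.cast_sub hqN.le, ZMod.natCast_mod,
          ZMod.natCast_self, Nat.cast_mul]
        have h3 : (a.toNat : ZMod N.toNat) = b.toNat * (a.toNat / b.toNat : ℕ) +
            (a.toNat % b.toNat : ℕ) := by
          rw [← Nat.cast_mul, ← Nat.cast_add, hdm]
        linear_combination hua - ((a.toNat / b.toNat : ℕ) : ZMod N.toNat) * hvb + h3

end ModularArithmetic

/-! ### Circuits for the powers of modular multiplication -/

section ModularMultiplication

variable {α : Type} {n m : ℕ}

/-- The `w`-bit word in the register `g`. -/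
def word (w : ℕ) (g : Fin n → α) (x : α → Bool) : BitVec w := BitVec.ofNat w (Nat.ofBits (x ∘ g))

lemma toNat_word {w : ℕ} (hw : n ≤ w) (g : Fin n → α) (x : α → Bool) :
    (word w g x).toNat = Nat.ofBits (x ∘ g) := by
  rw [word, BitVec.toNat_ofNat, Nat.mod_eq_of_lt]
  exact (Nat.ofBits_lt_two_pow _).trans_le (Nat.pow_le_pow_right (by norm_num) hw)

lemma ofBits_getLsbD {w : ℕ} (v : BitVec w) (hv : v.toNat < 2 ^ n) :
    Nat.ofBits (fun i : Fin n => v.getLsbD i) = v.toNat := by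
  have : (fun i : Fin n => v.getLsbD i) = fun i : Fin n => v.toNat.testBit i := rfl
  rw [this, Nat.ofBits_testBit, Nat.mod_eq_of_lt hv]

/-- The word `y ^ t mod N`, up to multiples of `N`, for the contents of three registers. -/
def powWord (w : ℕ) (gN gy : Fin n → α) (gt : Fin m → α) (x : α → Bool) : BitVec w :=
  (powStep^[m] (word w gN x, word w gy x % word w gN x, 1#w, word w gt x)).2.2.1

/-- The word `(y ^ t)⁻¹ mod N` for the contents of three registers. -/
def invPowWord (w : ℕ) (gN gy : Fin n → α) (gt : Fin m → α) (x : α → Bool) : BitVec w :=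
  (euclidStep^[2 * n] (word w gN x, word w gN x, powWord w gN gy gt x % word w gN x, 0#w,
    1#w)).2.2.2.1

/-- Multiplication modulo `N` by the word `g`, extended by the identity. -/
def mulWord (w : ℕ) (gN gx : Fin n → α) (g : (α → Bool) → BitVec w) (x : α → Bool) : BitVec w :=
  if decide (word w gx x < word w gN x) then word w gx x * g x % word w gN x else word w gx x

/-- A bound for the number of gates of the circuits for the powers of modular multiplication. -/
def mulPowCost (w n m : ℕ) : ℕ := (10 * m + 60 * n + 100) * Ckt.opCost w

lemma ckt_word {w : ℕ} (g : Fin n → α) : Ckt (word w g) (Ckt.opCost w) := Ckt.ofBits g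

lemma ckt_powWord (w : ℕ) (gN gy : Fin n → α) (gt : Fin m → α) :
    Ckt (powWord w gN gy gt) ((10 * m + 10) * Ckt.opCost w) := by
  have h : Ckt (fun x => (word w gN x, word w gy x % word w gN x, 1#w, word w gt x))
      (10 * Ckt.opCost w) :=
    ((ckt_word gN).pair (((ckt_word gy).mod (ckt_word gN)).pair
      ((Ckt.const 1#w).pair (ckt_word gt)))).mono (by omega)
  exact (h.comp (ckt_powStep.iterate m)).snd.snd.fst.mono (by
    rw [add_mul, mul_comm 10 m, mul_assoc]; omega)

lemma ckt_invPowWord (w : ℕ) (gN gy : Fin n → α) (gt : Fin m → α) :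
    Ckt (invPowWord w gN gy gt) ((10 * m + 60 * n + 50) * Ckt.opCost w) := by
  have h : Ckt (fun x => (word w gN x, word w gN x, powWord w gN gy gt x % word w gN x, 0#w, 1#w))
      ((10 * m + 20) * Ckt.opCost w) :=
    ((ckt_word gN).pair ((ckt_word gN).pair (((ckt_powWord w gN gy gt).mod (ckt_word gN)).pair
      ((Ckt.const 0#w).pair (Ckt.const 1#w))))).mono (by rw [add_mul, add_mul]; omega)
  exact (h.comp (ckt_euclidStep.iterate (2 * n))).snd.snd.snd.fst.mono (by nlinarith)

lemma ckt_mulWord {w s : ℕ} (gN gx : Fin n → α) {g : (α → Bool) → BitVec w} (hg : Ckt g s) :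
    Ckt (mulWord w gN gx g) (s + 10 * Ckt.opCost w) :=
  (((ckt_word gx).ult (ckt_word gN)).ite (((ckt_word gx).mul hg).mod (ckt_word gN))
    (ckt_word gx)).mono (by omega)

lemma toNat_mulWord {w : ℕ} (hw : 2 * n ≤ w) (gN gx : Fin n → α) (g : (α → Bool) → BitVec w)
    (x : α → Bool) (hg : (g x).toNat ≤ Nat.ofBits (x ∘ gN)) :
    (mulWord w gN gx g x).toNat = if Nat.ofBits (x ∘ gx) < Nat.ofBits (x ∘ gN) then
      Nat.ofBits (x ∘ gx) * (g x).toNat % Nat.ofBits (x ∘ gN) else Nat.ofBits (x ∘ gx) := by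
  have hN := toNat_word (w := w) (by omega) gN x
  have hx := toNat_word (w := w) (by omega) gx x
  rw [mulWord]
  simp only [BitVec.lt_def, hN, hx, decide_eq_true_eq]
  split_ifs with h
  · rw [toNat_mul_mod_of_le hw (n := n) (by rw [hN]; exact Nat.ofBits_lt_two_pow _)
      (by rw [hN, hx]; exact h.le) (by rw [hN]; exact hg), hN, hx]
  · exact hx

lemma mulWord_lt {w : ℕ} (hw : 2 * n ≤ w) (gN gx : Fin n → α) (g : (α → Bool) → BitVec w)
    (x : α → Bool) (hg : (g x).toNat ≤ Nat.ofBits (x ∘ gN)) :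
    (mulWord w gN gx g x).toNat < 2 ^ n := by
  rw [toNat_mulWord hw gN gx g x hg]
  have h1 := Nat.ofBits_lt_two_pow (x ∘ gN)
  have h2 := Nat.ofBits_lt_two_pow (x ∘ gx)
  split_ifs with h
  · exact (Nat.mod_lt _ (by omega)).trans h1
  · exact h2

lemma powWord_spec {w : ℕ} (hw : 2 * n ≤ w) (hm : m ≤ w) (hw2 : 2 ≤ w) (gN gy : Fin n → α)
    (gt : Fin m → α) (x : α → Bool) (hN : 0 < Nat.ofBits (x ∘ gN)) :
    (powWord w gN gy gt x).toNat ≡ Nat.ofBits (x ∘ gy) ^ Nat.ofBits (x ∘ gt)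
      [MOD Nat.ofBits (x ∘ gN)] ∧
    (powWord w gN gy gt x).toNat ≤ Nat.ofBits (x ∘ gN) := by
  have hNw := toNat_word (w := w) (by omega) gN x
  have hyw := toNat_word (w := w) (by omega) gy x
  have htw := toNat_word (w := w) (by omega) gt x
  have h1 : (1#w).toNat = 1 := by
    rw [BitVec.toNat_ofNat, Nat.mod_eq_of_lt]
    exact Nat.one_lt_two_pow (by omega)
  obtain ⟨h, h'⟩ := toNat_iterate_powStep hw hw2 m (word w gN x) (word w gy x % word w gN x) 1#w
    (word w gt x) (by rwa [hNw]) (by rw [hNw]; exact Nat.ofBits_lt_two_pow _)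
    (by rw [BitVec.toNat_umod, hNw]; exact (Nat.mod_lt _ hN).le) (by rw [h1, hNw]; exact hN)
    (by rw [htw]; exact Nat.ofBits_lt_two_pow _)
  rw [h1, one_mul, BitVec.toNat_umod, htw, hNw, hyw] at h
  rw [hNw] at h'
  exact ⟨h.trans ((Nat.mod_modEq _ _).pow _), h'⟩

lemma invPowWord_spec {w : ℕ} (hw : 2 * n ≤ w) (hm : m ≤ w) (hw2 : 2 ≤ w) (gN gy : Fin n → α)
    (gt : Fin m → α) (x : α → Bool) (hN : 0 < Nat.ofBits (x ∘ gN))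
    (hcop : Nat.Coprime (Nat.ofBits (x ∘ gy)) (Nat.ofBits (x ∘ gN))) :
    (invPowWord w gN gy gt x).toNat * Nat.ofBits (x ∘ gy) ^ Nat.ofBits (x ∘ gt) ≡ 1
      [MOD Nat.ofBits (x ∘ gN)] ∧
    (invPowWord w gN gy gt x).toNat ≤ Nat.ofBits (x ∘ gN) := by
  obtain ⟨hp, hp'⟩ := powWord_spec hw hm hw2 gN gy gt x hN
  have hNw := toNat_word (w := w) (by omega) gN x
  have hNlt := Nat.ofBits_lt_two_pow (x ∘ gN)
  have h1 : (1#w).toNat = 1 := by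
    rw [BitVec.toNat_ofNat, Nat.mod_eq_of_lt]
    exact Nat.one_lt_two_pow (by omega)
  have hr : (powWord w gN gy gt x % word w gN x).toNat =
      (powWord w gN gy gt x).toNat % Nat.ofBits (x ∘ gN) := by
    rw [BitVec.toNat_umod, hNw]
  have hlt := Nat.mod_lt (powWord w gN gy gt x).toNat hN
  have key := iterate_euclidStep (y := (powWord w gN gy gt x).toNat) hw (2 * n) (word w gN x)
    (word w gN x) (powWord w gN gy gt x % word w gN x) 0#w 1#w (by rwa [hNw]) (by rwa [hNw])
    (by rw [hNw, hr]; exact hlt.le) le_rfl (by simp) (by rw [h1, hNw]; exact hN)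
    (by rw [hNw, hr, two_mul, pow_add]
        exact Nat.mul_lt_mul'' hNlt (hlt.trans hNlt))
    (by rwa [hNw])
    (by rw [hNw, hr, Nat.gcd_comm, ← Nat.gcd_rec, Nat.gcd_comm]
        exact (Nat.ModEq.gcd_eq hp).trans (hcop.pow_left _))
    (by simp) (by rw [h1, hr, hNw]; simp)
  rw [hNw] at key
  refine ⟨?_, key.2⟩
  rw [← ZMod.natCast_eq_natCast_iff] at hp ⊢
  rw [Nat.cast_mul, ← hp, Nat.cast_one]
  exact key.1

end ModularMultiplication

/-! ### Modular multiplication in place -/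

section InPlace

variable {n m : ℕ}

/-- The map `x ↦ x g mod N`, extended by the identity to `x ≥ N`. -/
def mulMod (N g x : ℕ) : ℕ := if x < N then x * g % N else x

lemma mulMod_lt {N g x n : ℕ} (hN : N < 2 ^ n) (hx : x < 2 ^ n) : mulMod N g x < 2 ^ n := by
  unfold mulMod
  split_ifs with h
  · exact (Nat.mod_lt _ (by omega)).trans hN
  · exact hx

lemma mulMod_mulMod {N g h x : ℕ} (hN : 0 < N) : mulMod N h (mulMod N g x) = mulMod N (g * h) x := by
  unfold mulMod
  split_ifs with h1 h2
  · rw [Nat.mod_mul_mod, mul_assoc]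
  · exact absurd (Nat.mod_lt _ hN) h2
  · rfl

lemma mulMod_congr {N g h x : ℕ} (hgh : g ≡ h [MOD N]) : mulMod N g x = mulMod N h x := by
  unfold mulMod
  split_ifs
  · exact (Nat.ModEq.refl x).mul hgh
  · rfl

lemma mulMod_one {N x : ℕ} : mulMod N 1 x = x := by
  unfold mulMod
  split_ifs with h
  · rw [mul_one, Nat.mod_eq_of_lt h]
  · rfl

/-- The inputs of the circuits for modular multiplication: `x`, `N`, `y` and the exponent. -/
abbrev MulInput (n m : ℕ) : Type := Fin n ⊕ Fin n ⊕ Fin n ⊕ Fin m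

/-- The register for `x`. -/
def MulInput.x : Fin n → MulInput n m := Sum.inl

/-- The register for `N`. -/
def MulInput.N : Fin n → MulInput n m := fun i => Sum.inr (Sum.inl i)

/-- The register for `y`. -/
def MulInput.y : Fin n → MulInput n m := fun i => Sum.inr (Sum.inr (Sum.inl i))

/-- The register for the exponent, which is read with the most significant bit first. -/
def MulInput.t : Fin m → MulInput n m := fun i => Sum.inr (Sum.inr (Sum.inr i.rev))

open MulInput in
/-- There are small circuits for the `t`-th power of modular multiplication and for its inverse. -/
lemma exists_mulPow_circuits {w : ℕ} (hw : 2 * n ≤ w) (hm : m ≤ w) (hw2 : 2 ≤ w) :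
    ∃ (F G : (MulInput n m → Bool) → (Fin n → Bool)) (s r : ℕ),
      s ≤ mulPowCost w n m ∧ r ≤ mulPowCost w n m ∧ HasCircuit F s ∧ HasCircuit G r ∧
      ∀ b : MulInput n m → Bool, 0 < Nat.ofBits (b ∘ N) →
        Nat.Coprime (Nat.ofBits (b ∘ y)) (Nat.ofBits (b ∘ N)) →
        Nat.ofBits (F b) = mulMod (Nat.ofBits (b ∘ N))
          (Nat.ofBits (b ∘ y) ^ Nat.ofBits (b ∘ t)) (Nat.ofBits (b ∘ x)) ∧
        ∃ h, h * Nat.ofBits (b ∘ y) ^ Nat.ofBits (b ∘ t) ≡ 1 [MOD Nat.ofBits (b ∘ N)] ∧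
          Nat.ofBits (G b) = mulMod (Nat.ofBits (b ∘ N)) h (Nat.ofBits (b ∘ x)) := by
  obtain ⟨s, hs, hF⟩ := (ckt_mulWord (N : Fin n → MulInput n m) x (ckt_powWord w N y t)).hasCircuit
    (n := n) (by omega)
  obtain ⟨r, hr, hG⟩ := (ckt_mulWord (N : Fin n → MulInput n m) x
    (ckt_invPowWord w N y t)).hasCircuit (n := n) (by omega)
  refine ⟨_, _, s, r, hs.trans ?_, hr.trans ?_, hF, hG, fun b hN hc => ⟨?_, ?_⟩⟩
  · unfold mulPowCost; rw [← add_mul]; exact Nat.mul_le_mul_right _ (by omega)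
  · unfold mulPowCost; rw [← add_mul]; exact Nat.mul_le_mul_right _ (by omega)
  · obtain ⟨h1, h2⟩ := powWord_spec hw hm hw2 N y t b hN
    rw [ofBits_getLsbD _ (mulWord_lt hw N x _ b h2), toNat_mulWord hw N x _ b h2]
    exact mulMod_congr h1
  · obtain ⟨h1, h2⟩ := invPowWord_spec hw hm hw2 N y t b hN hc
    refine ⟨_, h1, ?_⟩
    rw [ofBits_getLsbD _ (mulWord_lt hw N x _ b h2), toNat_mulWord hw N x _ b h2]
    rfl

lemma ofBits_injective : Function.Injective (Nat.ofBits : (Fin n → Bool) → ℕ) := by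
  intro a b h
  funext i
  rw [← Nat.testBit_ofBits_lt a i i.2, ← Nat.testBit_ofBits_lt b i i.2, h]

variable {ι : Type} [DecidableEq ι]

/-- A reversible program for the controlled powers of modular multiplication. The bits are embedded
by `e`: the four registers `MulInput`, an auxiliary register and further bits, all of them clean
before and after. The register `x` is overwritten: first `x yᵗ` is written into the auxiliary
register, then `x` is erased by means of the inverse multiplication. -/
theorem exists_mulPowProg {w S : ℕ} (hw : 2 * n ≤ w) (hm : m ≤ w) (hw2 : 2 ≤ w)
    (hS : mulPowCost w n m ≤ S) (e : MulInput n m ⊕ Fin n ⊕ Fin S → ι)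
    (he : Function.Injective e) :
    ∃ P : List (RevOp ι), P.length ≤ 16 * S + 4 * n ∧ ∀ b : ι → Bool,
      (∀ i, b (e (Sum.inr i)) = false) →
      0 < Nat.ofBits (b ∘ e ∘ Sum.inl ∘ MulInput.N) →
      Nat.Coprime (Nat.ofBits (b ∘ e ∘ Sum.inl ∘ MulInput.y))
        (Nat.ofBits (b ∘ e ∘ Sum.inl ∘ MulInput.N)) →
      Nat.ofBits (runProg P b ∘ e ∘ Sum.inl ∘ MulInput.x) =
        mulMod (Nat.ofBits (b ∘ e ∘ Sum.inl ∘ MulInput.N))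
          (Nat.ofBits (b ∘ e ∘ Sum.inl ∘ MulInput.y) ^
            Nat.ofBits (b ∘ e ∘ Sum.inl ∘ MulInput.t))
          (Nat.ofBits (b ∘ e ∘ Sum.inl ∘ MulInput.x)) ∧
      ∀ q, (∀ i, q ≠ e (Sum.inl (MulInput.x i))) → runProg P b q = b q := by
  obtain ⟨F, G, s, t, hs, ht, hF, hG, hFG⟩ := exists_mulPow_circuits hw hm hw2 (n := n) (m := m)
  let x : Fin n → ι := fun i => e (Sum.inl (Sum.inl i))
  let z : Fin n → ι := fun i => e (Sum.inr (Sum.inl i))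
  let p : MulInput n m → ι := fun a => e (Sum.inl a)
  let p' : MulInput n m → ι := Sum.elim z (fun a => e (Sum.inl (Sum.inr a)))
  have hx : Function.Injective x := fun i j h => by simpa [x] using he h
  have hz : Function.Injective z := fun i j h => by simpa [z] using he h
  have hxz : ∀ i j, x i ≠ z j := fun i j h => by simpa using he h
  have hzx : ∀ i j, z i ≠ x j := fun i j h => by simpa using he h
  obtain ⟨P1, hl1, hP1⟩ := hF.exists_xorProg p
    (fun i => e (Sum.inr (Sum.inr (Fin.castLE (hs.trans hS) i)))) z
    (fun i j h => by simpa using he h) hz (fun a i h => by simpa [p] using he h)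
    (fun a j h => by simpa [p, z] using he h) (fun i j h => by simpa [z] using he h)
  obtain ⟨P2, hl2, hP2⟩ := hG.exists_xorProg p'
    (fun i => e (Sum.inr (Sum.inr (Fin.castLE (ht.trans hS) i)))) x
    (fun i j h => by simpa using he h) hx
    (fun a i h => by rcases a with a | a <;> simpa [p', z] using he h)
    (fun a j h => by rcases a with a | a <;> simpa [p', z, x] using he h)
    (fun i j h => by simpa [x] using he h)
  refine ⟨P1 ++ (P2 ++ (cnotProg z x hzx Finset.univ.toList ++
    cnotProg x z hxz Finset.univ.toList)), ?_, fun b hb hN hc => ?_⟩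
  · simp only [List.length_append, cnotProg, List.length_map, Finset.length_toList,
      Finset.card_univ, Fintype.card_fin] at hl1 hl2 ⊢
    omega
  simp only [runProg_append]
  obtain ⟨h1z, h1⟩ := hP1 b (fun i => hb _)
  set b1 := runProg P1 b with hb1
  obtain ⟨h2x, h2⟩ := hP2 b1 (fun i => by
    rw [h1 _ (fun j h => by simpa [z] using he h)]; exact hb _)
  set b2 := runProg P2 b1 with hb2
  obtain ⟨h3x, h3⟩ := runProg_cnotProg z x hzx hx Finset.univ.toList (Finset.nodup_toList _) b2
  set b3 := runProg (cnotProg z x hzx Finset.univ.toList) b2 with hb3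
  obtain ⟨h4z, h4⟩ := runProg_cnotProg x z hxz hz Finset.univ.toList (Finset.nodup_toList _) b3
  set b4 := runProg (cnotProg x z hxz Finset.univ.toList) b3 with hb4
  obtain ⟨hFb, -⟩ := hFG (b ∘ p) hN hc
  have hz0 : ∀ j, b (z j) = false := fun j => hb _
  have e1z : ∀ j, b1 (z j) = F (b ∘ p) j := fun j => by rw [h1z, hz0, Bool.false_xor]
  have e1x : ∀ j, b1 (x j) = b (x j) := fun j => h1 _ (hxz j)
  have hp'x : (b1 ∘ p') ∘ MulInput.x = F (b ∘ p) := funext e1z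
  have hrest : ∀ a, b1 (e (Sum.inl (Sum.inr a))) = b (e (Sum.inl (Sum.inr a))) := fun a =>
    h1 _ (fun j h => by simpa [z] using he h)
  have hp'N : (b1 ∘ p') ∘ MulInput.N = (b ∘ p) ∘ MulInput.N := funext fun i => hrest _
  have hp'y : (b1 ∘ p') ∘ MulInput.y = (b ∘ p) ∘ MulInput.y := funext fun i => hrest _
  have hp't : (b1 ∘ p') ∘ MulInput.t = (b ∘ p) ∘ MulInput.t := funext fun i => hrest _
  obtain ⟨-, h, hh, hGb⟩ := hFG (b1 ∘ p') (by rw [hp'N]; exact hN) (by rw [hp'N, hp'y]; exact hc)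
  rw [hp'N, hp'y, hp't, mul_comm] at hh
  have hN' : 0 < Nat.ofBits ((b ∘ p) ∘ MulInput.N) := hN
  rw [hp'N, hp'x, hFb, mulMod_mulMod hN', mulMod_congr hh, mulMod_one] at hGb
  have e2x : ∀ j, b2 (x j) = false := fun j => by
    rw [h2x, e1x, ofBits_injective hGb]
    exact Bool.xor_self _
  have e2z : ∀ j, b2 (z j) = F (b ∘ p) j := fun j => by rw [h2 _ (hzx j), e1z]
  have e3x : ∀ j, b3 (x j) = F (b ∘ p) j := fun j => by
    rw [h3x j (by simp), e2x, e2z, Bool.false_xor]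
  have e3z : ∀ j, b3 (z j) = F (b ∘ p) j := fun j => by rw [h3 _ (fun l _ => hzx j l), e2z]
  have e4x : ∀ j, b4 (x j) = F (b ∘ p) j := fun j => by rw [h4 _ (fun l _ => hxz j l), e3x]
  have e4z : ∀ j, b4 (z j) = false := fun j => by rw [h4z j (by simp), e3z, e3x, Bool.xor_self]
  refine ⟨?_, fun q hq => ?_⟩
  · have : b4 ∘ e ∘ Sum.inl ∘ MulInput.x = F (b ∘ p) := funext e4x
    rw [this, hFb]
    rfl
  · by_cases hqz : ∃ j, q = z j
    · obtain ⟨j, rfl⟩ := hqz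
      rw [e4z, hz0]
    · push Not at hqz
      rw [h4 q (fun j _ => hqz j), h3 q (fun j _ => hq j), h2 q hq, h1 q hqz]

end InPlace

open Real

/-! ### The quantum Fourier transform -/

section Fourier

lemma ofBits_eq_sum {n : ℕ} (f : Fin n → Bool) :
    Nat.ofBits f = ∑ i : Fin n, (f i).toNat * 2 ^ (i : ℕ) := by
  induction n with
  | zero => simp
  | succ n ih =>
    rw [Nat.ofBits_succ, ih, Fin.sum_univ_succ, Finset.mul_sum, add_comm]
    simp only [Fin.val_zero, pow_zero, mul_one, Fin.val_succ, pow_succ, Function.comp_apply]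
    congr 1
    exact Finset.sum_congr rfl fun i _ => by ring

lemma ofBits_snoc {n : ℕ} (f : Fin n → Bool) (c : Bool) :
    Nat.ofBits (Fin.snoc f c : Fin (n + 1) → Bool) = Nat.ofBits f + 2 ^ n * c.toNat := by
  rw [ofBits_eq_sum, ofBits_eq_sum, Fin.sum_univ_castSucc]
  simp [mul_comm]

lemma ofBits_snoc_rev {n : ℕ} (f : Fin n → Bool) (c : Bool) :
    Nat.ofBits ((Fin.snoc f c : Fin (n + 1) → Bool) ∘ Fin.rev) =
      2 * Nat.ofBits (f ∘ Fin.rev) + c.toNat := by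
  rw [Nat.ofBits_succ]
  congr 3
  · funext i
    simp [Fin.rev_succ]
  · simp [Fin.rev_zero]

lemma sum_ofBits {n : ℕ} (F : ℕ → ℂ) :
    ∑ b : Fin n → Bool, F (Nat.ofBits b) = ∑ i ∈ Finset.range (2 ^ n), F i := by
  have hinj : Function.Injective (Nat.ofBits : (Fin n → Bool) → ℕ) := ofBits_injective
  have himg : (Finset.univ : Finset (Fin n → Bool)).image Nat.ofBits = Finset.range (2 ^ n) := by
    apply Finset.eq_of_subset_of_card_le
    · intro i hi
      obtain ⟨b, -, rfl⟩ := Finset.mem_image.1 hi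
      exact Finset.mem_range.2 (Nat.ofBits_lt_two_pow b)
    · rw [Finset.card_image_of_injective _ hinj]
      simp
  rw [← himg, Finset.sum_image (fun a _ b _ h => hinj h)]

lemma sum_ofBits_rev {n : ℕ} (F : ℕ → ℂ) :
    ∑ b : Fin n → Bool, F (Nat.ofBits (b ∘ Fin.rev)) = ∑ i ∈ Finset.range (2 ^ n), F i := by
  rw [← sum_ofBits, ← (Equiv.arrowCongr (Fin.revPerm (n := n)) (Equiv.refl Bool)).sum_comp]
  refine Finset.sum_congr rfl fun b _ => ?_
  congr 2
  funext i
  simp [Equiv.arrowCongr]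

/-- The phase `exp (2 π i x)`. -/
def turn (x : ℝ) : Circle := Circle.exp (2 * π * x)

lemma turn_add (x y : ℝ) : turn (x + y) = turn x * turn y := by
  rw [turn, mul_add, Circle.exp_add]; rfl

@[simp] lemma turn_zero : turn 0 = 1 := by simp [turn]

lemma turn_nat_mul (n : ℕ) (x : ℝ) : turn (n * x) = turn x ^ n := by
  induction n with
  | zero => simp
  | succ n ih => rw [Nat.cast_succ, add_mul, one_mul, turn_add, ih, pow_succ]

lemma turn_one : turn 1 = 1 := by simp [turn]

lemma turn_neg (x : ℝ) : turn (-x) = (turn x)⁻¹ := by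
  rw [eq_inv_iff_mul_eq_one, ← turn_add, neg_add_cancel, turn_zero]

lemma turn_int (n : ℤ) : turn n = 1 := by
  obtain ⟨k, rfl | rfl⟩ := n.eq_nat_or_neg
  · have := turn_nat_mul k 1
    simpa [turn_one] using this
  · have := turn_nat_mul k 1
    simp [turn_neg]
    simpa [turn_one] using this

lemma coe_turn (x : ℝ) : (turn x : ℂ) = Complex.exp (2 * π * x * Complex.I) := by
  rw [turn, Circle.coe_exp]
  push_cast
  rfl

lemma coe_turn_half : (turn (1 / 2) : ℂ) = -1 := by
  rw [coe_turn, ← Complex.exp_pi_mul_I]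
  congr 1
  push_cast
  ring

variable {κ : Type} [Fintype κ] [DecidableEq κ] [Nontrivial κ]

/-- Phase gates between a bit `q` and the bits of a register multiply by the phase
`exp (2 π i c x)` if `q` is set, where `c` is the content of the register. -/
lemma exists_registerPhase {m : ℕ} (e : Fin m → κ) (q : κ) (h : ∀ i, e i ≠ q) (x : ℝ) :
    ∃ C : List (TwoQubitGate κ), C.length = m ∧ ∀ Φ b, runCircuit C Φ b =
      (if b q then (turn (Nat.ofBits (b ∘ e) * x) : ℂ) else 1) * Φ b := by
  induction m generalizing x with
  | zero => exact ⟨[], rfl, fun Φ b => by simp⟩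
  | succ m ih =>
    obtain ⟨C, hl, hC⟩ := ih (e ∘ Fin.succ) (fun i => h _) (2 * x)
    refine ⟨phaseGate (e 0) q (h 0) (fun a => if a.1 && a.2 then turn x else 1) :: C,
      by simp [hl], fun Φ b => ?_⟩
    rw [runCircuit_cons, hC, phaseGate_apply, Nat.ofBits_succ]
    have hcomp : (b ∘ e) ∘ Fin.succ = b ∘ e ∘ Fin.succ := rfl
    rw [hcomp]
    cases hq : b q <;> cases he : b (e 0) <;> simp [he]
    · left; congr 2; ring
    · rw [← mul_assoc, ← Circle.coe_mul, ← turn_add]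
      congr 3; ring

/-- The inverse quantum Fourier transform on a register `e` of `m` qubits. The input is read with
the most significant bit first, the output with the least significant bit first. By recursion, the
lower qubits are transformed, then controlled phases couple them to the last qubit, to which a
Hadamard gate is applied at the end. -/
theorem exists_fourierCircuit {m : ℕ} (e : Fin m → κ) (he : Function.Injective e) :
    ∃ C : List (TwoQubitGate κ), C.length ≤ m ^ 2 + m ∧ ∀ Φ b, runCircuit C Φ b =
      (√2 : ℂ)⁻¹ ^ m * ∑ t : Fin m → Bool,
        (turn (-(Nat.ofBits (t ∘ Fin.rev) * Nat.ofBits (b ∘ e) / 2 ^ m)) : ℂ) *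
          Φ (Function.extend e t b) := by
  induction m with
  | zero =>
    refine ⟨[], by simp, fun Φ b => ?_⟩
    have : ∀ t, Function.extend e t b = b := fun t => by
      funext x
      exact Function.extend_apply' _ _ _ (fun ⟨i, _⟩ => i.elim0)
    simp [this]
  | succ m ih =>
    obtain ⟨C, hl, hC⟩ := ih (e ∘ Fin.castSucc) (he.comp (Fin.castSucc_injective m))
    have hne : ∀ i, (e ∘ Fin.castSucc) i ≠ e (Fin.last m) := fun i h =>
      (Fin.castSucc_lt_last i).ne (he h)
    obtain ⟨D, hD, hDΦ⟩ := exists_registerPhase (e ∘ Fin.castSucc) (e (Fin.last m)) hne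
      (-(1 / 2 ^ (m + 1)))
    refine ⟨C ++ D ++ [hadamard (e (Fin.last m))], ?_, fun Φ b => ?_⟩
    · simp only [List.length_append, List.length_singleton, hD]
      nlinarith
    have hext : ∀ (t : Fin m → Bool) (c : Bool),
        Function.extend (e ∘ Fin.castSucc) t (Function.update b (e (Fin.last m)) c) =
          Function.extend e (Fin.snoc t c : Fin (m + 1) → Bool) b := by
      intro t c
      funext x
      by_cases hx : ∃ i, e i = x
      · obtain ⟨i, rfl⟩ := hx
        rw [he.extend_apply]
        refine Fin.lastCases ?_ (fun j => ?_) i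
        · rw [Function.extend_apply' _ _ _ (fun ⟨j, hj⟩ => hne j hj)]
          simp
        · have : e (Fin.castSucc j) = (e ∘ Fin.castSucc) j := rfl
          rw [this, (he.comp (Fin.castSucc_injective m)).extend_apply]
          simp
      · rw [Function.extend_apply' _ _ _ hx,
          Function.extend_apply' _ _ _ (fun ⟨j, hj⟩ => hx ⟨_, hj⟩), Function.update_of_ne]
        exact fun h => hx ⟨_, h.symm⟩
    have hcomp : ∀ c, Function.update b (e (Fin.last m)) c ∘ (e ∘ Fin.castSucc) =
        b ∘ e ∘ Fin.castSucc := by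
      intro c
      funext i
      exact Function.update_of_ne (hne i) _ _
    have hbe : b ∘ e = Fin.snoc (b ∘ e ∘ Fin.castSucc) (b (e (Fin.last m))) := by
      funext i
      refine Fin.lastCases ?_ (fun j => ?_) i <;> simp
    -- Splitting off the last bits of both numbers in the phase leaves the phase of the smaller
    -- transform, the controlled phases, the sign of the Hadamard gate, and a whole number of turns.
    have hterm : ∀ (t : Fin m → Bool) (c : Bool),
        (turn (-(Nat.ofBits ((Fin.snoc t c : Fin (m + 1) → Bool) ∘ Fin.rev) *
          Nat.ofBits (b ∘ e) / 2 ^ (m + 1))) : ℂ) =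
        (if b (e (Fin.last m)) && c then -1 else 1) *
        ((if c then (turn (Nat.ofBits (b ∘ e ∘ Fin.castSucc) * -(1 / 2 ^ (m + 1))) : ℂ) else 1) *
          turn (-(Nat.ofBits (t ∘ Fin.rev) * Nat.ofBits (b ∘ e ∘ Fin.castSucc) / 2 ^ m))) := by
      intro t c
      rw [hbe, ofBits_snoc_rev, ofBits_snoc]
      set T := Nat.ofBits (t ∘ Fin.rev)
      set K := Nat.ofBits (b ∘ e ∘ Fin.castSucc)
      cases hd : b (e (Fin.last m)) <;> cases c
      · simp only [Bool.toNat_false, Bool.and_false, Bool.false_eq_true, if_false, one_mul]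
        congr 2
        push_cast
        field_simp
        ring
      · simp only [Bool.toNat_false, Bool.toNat_true, Bool.false_and, Bool.false_eq_true, if_false,
          if_true, one_mul]
        rw [← Circle.coe_mul, ← turn_add]
        congr 2
        push_cast
        field_simp
        ring
      · simp only [Bool.toNat_false, Bool.toNat_true, Bool.and_false, Bool.false_eq_true,
          if_false, one_mul]
        have : (-(((2 * T + 0 : ℕ) : ℝ) * ((K + 2 ^ m * 1 : ℕ) : ℝ) / 2 ^ (m + 1)) : ℝ) =
            -(T * K / 2 ^ m) + ((-T : ℤ) : ℝ) := by
          push_cast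
          field_simp
          ring
        rw [this, turn_add, turn_int, mul_one]
      · simp only [Bool.toNat_true, Bool.and_true, if_true]
        have : (-(((2 * T + 1 : ℕ) : ℝ) * ((K + 2 ^ m * 1 : ℕ) : ℝ) / 2 ^ (m + 1)) : ℝ) =
            1 / 2 + (K * -(1 / 2 ^ (m + 1)) + -(T * K / 2 ^ m)) + ((-T - 1 : ℤ) : ℝ) := by
          push_cast
          field_simp
          ring
        rw [this, turn_add, turn_int, mul_one, turn_add, turn_add, Circle.coe_mul, Circle.coe_mul,
          coe_turn_half]
    rw [runCircuit_append, runCircuit_append, runCircuit_cons, runCircuit_nil, hadamard_apply,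
      hDΦ, hDΦ, hC, hC, ← (Fin.snocEquiv fun _ => Bool).sum_comp, Fintype.sum_prod_type]
    simp only [Fintype.sum_bool, Fin.snocEquiv, Equiv.coe_fn_mk, hcomp, hext, hterm,
      Function.update_self]
    simp only [Bool.false_eq_true, if_false, if_true, Bool.and_false, Bool.and_true, one_mul,
      pow_succ, mul_assoc, ← Finset.mul_sum]
    ring

end Fourier

/-! ### Fixed-point evaluation of the energy -/

section Energy

/-- One doubling of the angle in `sin ^ 2`, namely `u ↦ 4 u (1 - u)`, for fixed-point numbers with
`3 T` binary digits. -/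
def doubleStep (T u : ℕ) : ℕ := u * (2 ^ (3 * T) - u) / 2 ^ (3 * T - 2)

/-- A fixed-point approximation of `sin ^ 2 (π j / 4 ^ T)`, namely `(π j / 4 ^ T) ^ 2`. -/
def startValue (T j : ℕ) : ℕ := ⌊π ^ 2 * 2 ^ T⌋₊ * (j * j) / 2 ^ (2 * T)

/-- A fixed-point approximation of `cos ^ 2 (π j / 2 ^ T)` with `3 T` binary digits, which comes from
`T` doublings of the angle `π j / 4 ^ T`. -/
def energyCode (T j : ℕ) : ℕ := 2 ^ (3 * T) - 1 - (doubleStep T)^[T] (startValue T j)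

lemma doubleStep_le {T u : ℕ} (hT : 1 ≤ T) (hu : u ≤ 2 ^ (3 * T)) : doubleStep T u ≤ 2 ^ (3 * T) := by
  unfold doubleStep
  apply Nat.div_le_of_le_mul
  obtain ⟨v, hv⟩ := Nat.exists_eq_add_of_le hu
  have h4 : 4 * 2 ^ (3 * T - 2) = 2 ^ (3 * T) := by
    rw [show (4 : ℕ) = 2 ^ 2 by norm_num, ← pow_add]
    congr 1
    omega
  have : 2 ^ (3 * T) - u = v := by omega
  rw [this]
  have h1 : 4 * (u * v) ≤ (u + v) * (u + v) := by
    zify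
    nlinarith [sq_nonneg ((u : ℤ) - v)]
  rw [← hv] at h1
  have h2 : 4 * (2 ^ (3 * T - 2) * 2 ^ (3 * T)) = 2 ^ (3 * T) * 2 ^ (3 * T) := by
    rw [← mul_assoc, h4]
  omega

lemma iterate_doubleStep_le {T u : ℕ} (hT : 1 ≤ T) (hu : u ≤ 2 ^ (3 * T)) (i : ℕ) :
    (doubleStep T)^[i] u ≤ 2 ^ (3 * T) := by
  induction i with
  | zero => exact hu
  | succ i ih => rw [Function.iterate_succ_apply']; exact doubleStep_le hT ih

lemma abs_natDiv_sub_le (a b : ℕ) (hb : 0 < b) : |((a / b : ℕ) : ℝ) - a / b| ≤ 1 := by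
  have hb' : (0 : ℝ) < b := by exact_mod_cast hb
  have h1 : ((a / b : ℕ) : ℝ) ≤ a / b := Nat.cast_div_le
  have h2 : (a : ℝ) / b ≤ (a / b : ℕ) + 1 := by
    rw [div_le_iff₀ hb']
    have := Nat.lt_div_mul_add (a := a) hb
    have h3 : a ≤ (a / b + 1) * b := by rw [add_mul]; omega
    exact_mod_cast h3
  rw [abs_le]
  constructor <;> linarith

lemma abs_doubleStep_sub_le {T u : ℕ} (hT : 1 ≤ T) (hu : u ≤ 2 ^ (3 * T)) {x ε : ℝ}
    (h : |(u : ℝ) / 2 ^ (3 * T) - sin x ^ 2| ≤ ε) :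
    |(doubleStep T u : ℝ) / 2 ^ (3 * T) - sin (2 * x) ^ 2| ≤ 4 * ε + 1 / 2 ^ (3 * T) := by
  set R : ℝ := 2 ^ (3 * T) with hR
  have hR0 : 0 < R := by positivity
  have h4 : (4 : ℝ) * 2 ^ (3 * T - 2) = R := by
    rw [hR, show (4 : ℝ) = 2 ^ 2 by norm_num, ← pow_add]
    congr 1
    omega
  have hq : (0 : ℝ) < 2 ^ (3 * T - 2) := by positivity
  set q : ℝ := 2 ^ (3 * T - 2) with hq'
  have h1 := abs_natDiv_sub_le (u * (2 ^ (3 * T) - u)) (2 ^ (3 * T - 2)) (by positivity)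
  push_cast [Nat.cast_sub hu] at h1
  rw [← hR, ← hq'] at h1
  have h2 : (u : ℝ) * (R - u) / q / R = 4 * ((u : ℝ) / R) * (1 - u / R) := by
    rw [← h4]
    field_simp
  have h3 : |(doubleStep T u : ℝ) / R - 4 * ((u : ℝ) / R) * (1 - u / R)| ≤ 1 / R := by
    rw [← h2, ← sub_div, abs_div, abs_of_pos hR0]
    exact div_le_div_of_nonneg_right h1 hR0.le
  have hsin : sin (2 * x) ^ 2 = 4 * sin x ^ 2 * (1 - sin x ^ 2) := by
    rw [sin_two_mul]
    linear_combination (4 * sin x ^ 2) * cos_sq' x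
  have hu0 : 0 ≤ (u : ℝ) / R := by positivity
  have hu1 : (u : ℝ) / R ≤ 1 := by
    rw [div_le_one hR0, hR]
    exact_mod_cast hu
  have hs0 := sq_nonneg (sin x)
  have hs1 := sin_sq_le_one x
  set a := (u : ℝ) / R
  set s := sin x ^ 2
  have h5 : |4 * a * (1 - a) - 4 * s * (1 - s)| ≤ 4 * ε := by
    have : 4 * a * (1 - a) - 4 * s * (1 - s) = 4 * ((a - s) * (1 - a - s)) := by ring
    rw [this, abs_mul, abs_mul, abs_of_pos (by norm_num : (0 : ℝ) < 4)]
    have h6 : |1 - a - s| ≤ 1 := by rw [abs_le]; constructor <;> linarith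
    have := mul_le_mul h h6 (abs_nonneg _) ((abs_nonneg _).trans h)
    linarith
  rw [hsin]
  calc |(doubleStep T u : ℝ) / R - 4 * s * (1 - s)|
      ≤ |(doubleStep T u : ℝ) / R - 4 * a * (1 - a)| + |4 * a * (1 - a) - 4 * s * (1 - s)| :=
        abs_sub_le _ _ _
    _ ≤ 4 * ε + 1 / R := by linarith

/-- Each doubling multiplies the error by at most four, so that `T` doublings with `3 T` digits leave
about `T` correct digits. -/
lemma abs_iterate_doubleStep_sub_le {T u : ℕ} (hT : 1 ≤ T) (hu : u ≤ 2 ^ (3 * T)) {x ε : ℝ}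
    (h : |(u : ℝ) / 2 ^ (3 * T) - sin x ^ 2| ≤ ε) (i : ℕ) :
    |((doubleStep T)^[i] u : ℝ) / 2 ^ (3 * T) - sin (2 ^ i * x) ^ 2| ≤
      4 ^ i * (ε + 1 / 2 ^ (3 * T)) - 1 / 2 ^ (3 * T) := by
  induction i with
  | zero => simpa using h
  | succ i ih =>
    have h1 := abs_doubleStep_sub_le hT (iterate_doubleStep_le hT hu i) ih
    rw [Function.iterate_succ_apply', pow_succ' (2 : ℝ), mul_assoc]
    refine h1.trans ?_
    have : (0 : ℝ) < 1 / 2 ^ (3 * T) := by positivity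
    rw [pow_succ (4 : ℝ)]
    linarith

lemma abs_sq_sub_sin_sq_le {x : ℝ} (hx0 : 0 ≤ x) (hx1 : x ≤ 1) :
    |x ^ 2 - sin x ^ 2| ≤ x ^ 4 / 2 := by
  have hsin0 : 0 ≤ sin x := sin_nonneg_of_nonneg_of_le_pi hx0 (by linarith [pi_gt_three])
  have hsinx : sin x ≤ x := sin_le hx0
  have hsin3 : x - x ^ 3 / 4 ≤ sin x := by
    rcases hx0.eq_or_lt with h | h
    · rw [← h]; simp
    · have h5 := sin_gt_sub_cube h
      have h6 : 0 < x ^ 3 := by positivity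
      linarith
  have h5 : x ^ 2 - sin x ^ 2 = (x - sin x) * (x + sin x) := by ring
  rw [h5, abs_of_nonneg (mul_nonneg (by linarith) (by linarith))]
  have h6 : (x - sin x) * (x + sin x) ≤ (x ^ 3 / 4) * (2 * x) :=
    mul_le_mul (by linarith) (by linarith) (by linarith) (by positivity)
  have h7 : (x ^ 3 / 4) * (2 * x) = x ^ 4 / 2 := by ring
  linarith

lemma startValue_spec {T j : ℕ} (hT : 1 ≤ T) (hj : 2 * j ≤ 2 ^ T) :
    startValue T j ≤ 2 ^ (3 * T) ∧
      |(startValue T j : ℝ) / 2 ^ (3 * T) - sin (π * j / 4 ^ T) ^ 2| ≤ 4 / 2 ^ (3 * T) := by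
  set P : ℝ := 2 ^ T with hP
  have hP2 : 2 ≤ P := by
    calc (2 : ℝ) = 2 ^ 1 := by norm_num
      _ ≤ 2 ^ T := pow_le_pow_right₀ (by norm_num) hT
  have h3T : (2 : ℝ) ^ (3 * T) = P ^ 3 := by rw [hP, ← pow_mul, mul_comm]
  have h2T : (2 : ℝ) ^ (2 * T) = P ^ 2 := by rw [hP, ← pow_mul, mul_comm]
  have h4T : (4 : ℝ) ^ T = P ^ 2 := by rw [hP, ← pow_mul, mul_comm, pow_mul]; norm_num
  have hjP : 2 * (j : ℝ) ≤ P := by rw [hP]; exact_mod_cast hj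
  have hj0 : (0 : ℝ) ≤ j := by positivity
  set C : ℕ := ⌊π ^ 2 * 2 ^ T⌋₊ with hC
  have hπ := pi_pos
  have hπ4 := pi_lt_d2
  have hC1 : (C : ℝ) ≤ π ^ 2 * P := Nat.floor_le (by positivity)
  have hC2 : π ^ 2 * P < C + 1 := Nat.lt_floor_add_one _
  have h1 := abs_natDiv_sub_le (C * (j * j)) (2 ^ (2 * T)) (by positivity)
  push_cast at h1
  rw [h2T] at h1
  have hs : ((startValue T j : ℕ) : ℝ) = ((C * (j * j) / 2 ^ (2 * T) : ℕ) : ℝ) := rfl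
  rw [← hs] at h1
  have hjj : (j : ℝ) * j / P ^ 2 ≤ 1 / 4 := by
    rw [div_le_iff₀ (by positivity)]
    nlinarith
  have hjj0 : 0 ≤ (j : ℝ) * j / P ^ 2 := by positivity
  -- Only the rounding of `π ^ 2` is taken into account here, not yet that of the quotient.
  have h2 : |(C : ℝ) * (j * j) / P ^ 2 - π ^ 2 * P * (j * j / P ^ 2)| ≤ 1 := by
    have : (C : ℝ) * (j * j) / P ^ 2 - π ^ 2 * P * (j * j / P ^ 2) =
      (C - π ^ 2 * P) * (j * j / P ^ 2) := by ring
    rw [this, abs_le]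
    constructor <;> nlinarith
  set x : ℝ := π * j / 4 ^ T with hx
  have hxP : x = π * j / P ^ 2 := by rw [hx, h4T]
  have hx2 : x ^ 2 * P ^ 3 = π ^ 2 * P * (j * j / P ^ 2) := by
    rw [hxP]; field_simp
  have hx0 : 0 ≤ x := by positivity
  have hxle : x * P ≤ 8 / 5 := by
    have : x * P = π * (j / P) := by rw [hxP]; field_simp
    rw [this]
    have : (j : ℝ) / P ≤ 1 / 2 := by rw [div_le_iff₀ (by positivity)]; linarith
    nlinarith [div_nonneg hj0 (by positivity : (0 : ℝ) ≤ P)]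
  have hx1 : x ≤ 1 := by nlinarith
  have h3 := abs_sq_sub_sin_sq_le hx0 hx1
  have h4 : x ^ 4 / 2 * P ^ 3 ≤ 2 := by
    have h5 : x ^ 4 / 2 * P ^ 3 * P = (x * P) ^ 4 / 2 := by ring
    have h6 : (x * P) ^ 4 ≤ (8 / 5) ^ 4 := pow_le_pow_left₀ (by positivity) hxle 4
    have h7 : 0 ≤ x ^ 4 / 2 * P ^ 3 := by positivity
    have h8 := mul_le_mul_of_nonneg_left hP2 h7
    norm_num at h6
    linarith
  have hfin : |(startValue T j : ℝ) - sin x ^ 2 * P ^ 3| ≤ 4 := by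
    have e1 : |(startValue T j : ℝ) - x ^ 2 * P ^ 3| ≤ 2 := by
      rw [hx2]
      have := abs_sub_le (startValue T j : ℝ) (C * (j * j) / P ^ 2) (π ^ 2 * P * (j * j / P ^ 2))
      linarith
    have e2 : |x ^ 2 * P ^ 3 - sin x ^ 2 * P ^ 3| ≤ 2 := by
      rw [← sub_mul, abs_mul, abs_of_pos (by positivity : 0 < P ^ 3)]
      exact (mul_le_mul_of_nonneg_right h3 (by positivity)).trans h4
    have := abs_sub_le (startValue T j : ℝ) (x ^ 2 * P ^ 3) (sin x ^ 2 * P ^ 3)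
    linarith
  constructor
  · have : (startValue T j : ℝ) ≤ 2 ^ (3 * T) := by
      rw [h3T]
      have e1 : (C : ℝ) * (j * j) / P ^ 2 ≤ 10 * P * (1 / 4) := by
        rw [mul_div_assoc]
        refine mul_le_mul (hC1.trans (mul_le_mul_of_nonneg_right ?_ (by linarith))) hjj hjj0
          (by positivity)
        nlinarith only [hπ, hπ4]
      have e2 : (startValue T j : ℝ) ≤ C * (j * j) / P ^ 2 := by
        rw [hs, ← h2T]
        exact_mod_cast Nat.cast_div_le (α := ℝ) (m := C * (j * j)) (n := 2 ^ (2 * T))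
      have e3 : 2 * (2 * P) ≤ P * (P * P) :=
        (mul_le_mul_of_nonneg_left (mul_le_mul_of_nonneg_right hP2 (by linarith))
          (by norm_num)).trans (mul_le_mul_of_nonneg_right hP2 (by positivity))
      have e4 : P ^ 3 = P * (P * P) := by ring
      linarith
    exact_mod_cast this
  · rw [h3T]
    have : (startValue T j : ℝ) / P ^ 3 - sin x ^ 2 =
        ((startValue T j : ℝ) - sin x ^ 2 * P ^ 3) / P ^ 3 := by field_simp
    rw [this, abs_div, abs_of_pos (by positivity : 0 < P ^ 3)]
    exact div_le_div_of_nonneg_right hfin (by positivity)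

lemma abs_energyCode_sub_le {T j : ℕ} (hT : 1 ≤ T) (hj : 2 * j ≤ 2 ^ T) :
    |(energyCode T j : ℝ) / 2 ^ (3 * T) - cos (π * j / 2 ^ T) ^ 2| ≤ 6 / 2 ^ T := by
  obtain ⟨h1, h2⟩ := startValue_spec hT hj
  have h3 := abs_iterate_doubleStep_sub_le hT h1 h2 T
  have hle := iterate_doubleStep_le hT h1 T
  have h4 : (2 : ℝ) ^ T * (π * j / 4 ^ T) = π * j / 2 ^ T := by
    rw [show (4 : ℝ) = 2 * 2 by norm_num, mul_pow]
    field_simp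
  rw [h4] at h3
  set u := (doubleStep T)^[T] (startValue T j) with hu
  set R : ℝ := 2 ^ (3 * T) with hR
  have hR0 : 0 < R := by positivity
  have h5 : (4 : ℝ) ^ T * (4 / R + 1 / R) = 5 / 2 ^ T := by
    rw [hR, show (4 : ℝ) = 2 ^ 2 by norm_num, mul_comm 3 T, pow_mul, ← pow_mul 2 2, mul_comm 2 T,
      pow_mul]
    field_simp
    norm_num
  rw [h5] at h3
  have h6 : |(energyCode T j : ℝ) / R - (1 - u / R)| ≤ 1 / R := by
    have hu' : (u : ℝ) ≤ R := by rw [hR]; exact_mod_cast hle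
    have e1 : (energyCode T j : ℝ) ≤ R - u := by
      have : energyCode T j ≤ 2 ^ (3 * T) - u := by unfold energyCode; omega
      rw [hR]
      calc (energyCode T j : ℝ) ≤ ((2 ^ (3 * T) - u : ℕ) : ℝ) := by exact_mod_cast this
        _ = _ := by rw [Nat.cast_sub hle]; push_cast; rfl
    have e2 : R - u ≤ (energyCode T j : ℝ) + 1 := by
      have : 2 ^ (3 * T) - u ≤ energyCode T j + 1 := by unfold energyCode; omega
      rw [hR]
      calc (2 : ℝ) ^ (3 * T) - u = ((2 ^ (3 * T) - u : ℕ) : ℝ) := by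
            rw [Nat.cast_sub hle]; push_cast; rfl
        _ ≤ _ := by exact_mod_cast this
    have : (energyCode T j : ℝ) / R - (1 - u / R) = ((energyCode T j : ℝ) - (R - u)) / R := by
      field_simp
    rw [this, abs_div, abs_of_pos hR0]
    refine div_le_div_of_nonneg_right ?_ hR0.le
    rw [abs_le]; constructor <;> linarith
  have h7 : 1 - (u : ℝ) / R - cos (π * j / 2 ^ T) ^ 2 = -(u / R - sin (π * j / 2 ^ T) ^ 2) := by
    rw [sin_sq]; ring
  have h8 := abs_sub_le ((energyCode T j : ℝ) / R) (1 - u / R) (cos (π * j / 2 ^ T) ^ 2)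
  rw [h7, abs_neg] at h8
  have h9 : 5 / (2 : ℝ) ^ T + 1 / 2 ^ T = 6 / 2 ^ T := by ring
  have h10 : (0 : ℝ) < 1 / 2 ^ T := by positivity
  linarith

/-- The residue `j` of a grid point modulo `2 ^ T`, up to sign: opposite phases have the same energy
and get exactly the same code. -/
def foldIndex (T j : ℕ) : ℕ := min j (2 ^ T - j)

lemma foldIndex_neg {T : ℕ} (J : ℤ) :
    foldIndex T ((-J) % 2 ^ T).toNat = foldIndex T (J % 2 ^ T).toNat := by
  have hpos : (0 : ℤ) < 2 ^ T := by positivity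
  have h1 := Int.emod_nonneg J hpos.ne'
  have h2 := Int.emod_lt_of_pos J hpos
  have hc : ((2 ^ T : ℕ) : ℤ) = 2 ^ T := by push_cast; rfl
  unfold foldIndex
  by_cases h0 : J % 2 ^ T = 0
  · have : (-J) % 2 ^ T = 0 := by
      rw [← Int.dvd_iff_emod_eq_zero] at h0 ⊢
      exact h0.neg_right
    rw [this, h0]
  · have : (-J) % 2 ^ T = 2 ^ T - J % 2 ^ T := by
      have h3 : -J = 2 ^ T - J % 2 ^ T + 2 ^ T * (-(J / 2 ^ T) - 1) := by
        have := Int.emod_add_mul_ediv J (2 ^ T)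
        linear_combination this
      conv_lhs => rw [h3, Int.add_mul_emod_self_left]
      rw [Int.emod_eq_of_lt (by omega) (by omega)]
    omega

/-- The energy code of a grid point `J / 2 ^ T` close to `θ` is an approximation of
`2 cos (2 π θ)`. -/
lemma abs_energy_sub_le {T : ℕ} (hT : 1 ≤ T) {θ : ℝ} {J : ℤ} (h : |θ * 2 ^ T - J| < 1 / 2) :
    |2 * cos (2 * π * θ) -
      (-2 + 4 * (energyCode T (foldIndex T (J % 2 ^ T).toNat) : ℝ) / 2 ^ (3 * T))| ≤
        32 / 2 ^ T := by
  set P : ℝ := 2 ^ T with hP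
  have hP0 : 0 < P := by positivity
  have hpos : (0 : ℤ) < 2 ^ T := by positivity
  have hc : ((2 ^ T : ℕ) : ℤ) = 2 ^ T := by push_cast; rfl
  have h1 := Int.emod_nonneg J hpos.ne'
  have h2 := Int.emod_lt_of_pos J hpos
  have hdm := Int.emod_add_mul_ediv J (2 ^ T)
  set j := (J % 2 ^ T).toNat with hj
  have hjJ : (j : ℤ) = J % 2 ^ T := Int.toNat_of_nonneg h1
  have hjlt : j < 2 ^ T := by omega
  set f := foldIndex T j with hf
  have hf2 : 2 * f ≤ 2 ^ T := by rw [hf, foldIndex]; omega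
  have hcos : cos (2 * π * f / P) = cos (2 * π * J / P) := by
    have hJ : (J : ℝ) = j + P * (J / 2 ^ T : ℤ) := by
      have hZ : J = j + 2 ^ T * (J / 2 ^ T) := by rw [hjJ]; exact hdm.symm
      have := congrArg (Int.cast : ℤ → ℝ) hZ
      push_cast at this
      exact this
    have e1 : cos (2 * π * J / P) = cos (2 * π * j / P) := by
      rw [hJ, show 2 * π * (j + P * ((J / 2 ^ T : ℤ) : ℝ)) / P =
        2 * π * j / P + ((J / 2 ^ T : ℤ) : ℝ) * (2 * π) by field_simp, cos_add_int_mul_two_pi]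
    rw [e1, hf, foldIndex]
    rcases min_choice j (2 ^ T - j) with h | h
    · rw [h]
    · rw [h, Nat.cast_sub hjlt.le]
      push_cast
      rw [← hP, show 2 * π * (P - j) / P = 2 * π - 2 * π * j / P by field_simp, cos_two_pi_sub]
  have h3 := abs_energyCode_sub_le hT hf2
  have h4 : |cos (2 * π * θ) - cos (2 * π * J / P)| ≤ 4 / P := by
    refine (abs_cos_sub_cos_le _ _).trans ?_
    have : 2 * π * θ - 2 * π * J / P = 2 * π / P * (θ * P - J) := by field_simp
    rw [this, abs_mul, abs_of_pos (by positivity)]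
    have h5 : 2 * π / P * |θ * P - J| ≤ 2 * π / P * (1 / 2) :=
      mul_le_mul_of_nonneg_left h.le (by positivity)
    refine h5.trans ?_
    rw [div_mul_eq_mul_div]
    exact div_le_div_of_nonneg_right (by linarith [pi_lt_four]) hP0.le
  have h5 : cos (2 * π * f / P) = 2 * cos (π * f / P) ^ 2 - 1 := by
    rw [← cos_two_mul]
    congr 1
    ring
  set a := (energyCode T f : ℝ) / 2 ^ (3 * T) with ha
  have h6 : 4 * (energyCode T f : ℝ) / 2 ^ (3 * T) = 4 * a := by rw [ha]; ring
  rw [h6]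
  rw [← hcos, h5] at h4
  have h7 : (32 : ℝ) / P = 2 * (4 / P) + 4 * (6 / P) := by ring
  rw [h7]
  rw [abs_le] at h3 h4 ⊢
  constructor <;> linarith [h3.1, h3.2, h4.1, h4.2]

end Energy

/-! ### A circuit for the energy -/

section EnergyCircuit

/-- The multiple of `1 / 2 ^ T`, modulo `1`, that is closest to `k / 2 ^ (6 T)`. -/
def gridIndex (T k : ℕ) : ℕ := (k + 2 ^ (5 * T - 1)) / 2 ^ (5 * T) % 2 ^ T

/-- The energy code that is reported if phase estimation gives the phase `k / 2 ^ (6 T)`. -/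
def reportedCode (T k : ℕ) : ℕ := energyCode T (foldIndex T (gridIndex T k))

variable {α : Type} {T : ℕ}

lemma toNat_ofNat_two_pow {w a : ℕ} (h : a < w) : (BitVec.ofNat w (2 ^ a)).toNat = 2 ^ a := by
  rw [BitVec.toNat_ofNat, Nat.mod_eq_of_lt]
  exact Nat.pow_lt_pow_right (by norm_num) h

/-- `gridIndex` on words. -/
def gridWord (T : ℕ) (g : Fin (6 * T) → α) (x : α → Bool) : BitVec (10 * T) :=
  (word (10 * T) g x + BitVec.ofNat (10 * T) (2 ^ (5 * T - 1))) / BitVec.ofNat (10 * T) (2 ^ (5 * T))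
    % BitVec.ofNat (10 * T) (2 ^ T)

lemma toNat_gridWord (hT : 1 ≤ T) (g : Fin (6 * T) → α) (x : α → Bool) :
    (gridWord T g x).toNat = gridIndex T (Nat.ofBits (x ∘ g)) := by
  rw [gridWord, BitVec.toNat_umod, BitVec.toNat_udiv, BitVec.toNat_add, toNat_word (by omega),
    toNat_ofNat_two_pow (by omega), toNat_ofNat_two_pow (by omega), toNat_ofNat_two_pow (by omega),
    Nat.mod_eq_of_lt (b := 2 ^ (10 * T))]
  · rfl
  · have h1 := Nat.ofBits_lt_two_pow (x ∘ g)
    have h2 : 2 ^ (5 * T - 1) ≤ 2 ^ (6 * T) := Nat.pow_le_pow_right (by norm_num) (by omega)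
    have h3 : 2 * 2 ^ (6 * T) ≤ 2 ^ (10 * T) := by
      rw [← pow_succ']
      exact Nat.pow_le_pow_right (by norm_num) (by omega)
    omega

lemma gridIndex_lt (T k : ℕ) : gridIndex T k < 2 ^ T := Nat.mod_lt _ (by positivity)

/-- `foldIndex` on words. -/
def foldWord (T : ℕ) (v : BitVec (10 * T)) : BitVec (10 * T) :=
  if decide (BitVec.ofNat (10 * T) (2 ^ T) - v < v) then BitVec.ofNat (10 * T) (2 ^ T) - v else v

lemma toNat_foldWord (hT : 1 ≤ T) {v : BitVec (10 * T)} (hv : v.toNat < 2 ^ T) :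
    (foldWord T v).toNat = foldIndex T v.toNat := by
  have h1 : (BitVec.ofNat (10 * T) (2 ^ T) - v).toNat = 2 ^ T - v.toNat := by
    rw [BitVec.toNat_sub_of_le, toNat_ofNat_two_pow (by omega)]
    rw [BitVec.le_def, toNat_ofNat_two_pow (by omega)]
    exact hv.le
  rw [foldWord, foldIndex]
  simp only [decide_eq_true_eq, BitVec.lt_def, h1]
  split_ifs with h
  · rw [h1]; omega
  · omega

/-- `startValue` on words. -/
def startWord (T : ℕ) (v : BitVec (10 * T)) : BitVec (10 * T) :=
  BitVec.ofNat (10 * T) ⌊π ^ 2 * 2 ^ T⌋₊ * (v * v) / BitVec.ofNat (10 * T) (2 ^ (2 * T))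

lemma toNat_startWord (hT : 1 ≤ T) {v : BitVec (10 * T)} (hv : v.toNat < 2 ^ T) :
    (startWord T v).toNat = startValue T v.toNat := by
  have hC : ⌊π ^ 2 * 2 ^ T⌋₊ < 2 ^ (5 * T) := by
    have h0 : ⌊π ^ 2 * 2 ^ T⌋₊ < 2 ^ (T + 4) := by
      rw [Nat.floor_lt (by positivity)]
      push_cast
      rw [pow_add, mul_comm]
      refine mul_lt_mul_of_pos_left ?_ (by positivity)
      nlinarith [pi_pos, pi_lt_four]
    exact h0.trans_le (Nat.pow_le_pow_right (by norm_num) (by omega))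
  have hvv : v.toNat * v.toNat < 2 ^ (2 * T) := by
    rw [two_mul, pow_add]
    exact Nat.mul_lt_mul'' hv hv
  have hmul : ⌊π ^ 2 * 2 ^ T⌋₊ * (v.toNat * v.toNat) < 2 ^ (10 * T) := by
    calc _ < 2 ^ (5 * T) * 2 ^ (2 * T) := Nat.mul_lt_mul'' hC hvv
      _ = 2 ^ (7 * T) := by rw [← pow_add]; congr 1; ring
      _ ≤ _ := Nat.pow_le_pow_right (by norm_num) (by omega)
  have hle : ∀ a, a ≤ 10 * T → 2 ^ a ≤ 2 ^ (10 * T) := fun a ha =>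
    Nat.pow_le_pow_right (by norm_num) ha
  rw [startWord, BitVec.toNat_udiv, BitVec.toNat_mul, BitVec.toNat_mul, BitVec.toNat_ofNat,
    toNat_ofNat_two_pow (by omega), Nat.mod_eq_of_lt (hC.trans_le (hle _ (by omega))),
    Nat.mod_eq_of_lt (hvv.trans_le (hle _ (by omega))), Nat.mod_eq_of_lt hmul]
  rfl

/-- `doubleStep` on words. -/
def doubleWord (T : ℕ) (v : BitVec (10 * T)) : BitVec (10 * T) :=
  v * (BitVec.ofNat (10 * T) (2 ^ (3 * T)) - v) / BitVec.ofNat (10 * T) (2 ^ (3 * T - 2))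

lemma toNat_doubleWord (hT : 1 ≤ T) {v : BitVec (10 * T)} (hv : v.toNat ≤ 2 ^ (3 * T)) :
    (doubleWord T v).toNat = doubleStep T v.toNat := by
  have h1 : (BitVec.ofNat (10 * T) (2 ^ (3 * T)) - v).toNat = 2 ^ (3 * T) - v.toNat := by
    rw [BitVec.toNat_sub_of_le, toNat_ofNat_two_pow (by omega)]
    rw [BitVec.le_def, toNat_ofNat_two_pow (by omega)]
    exact hv
  have hmul : v.toNat * (2 ^ (3 * T) - v.toNat) < 2 ^ (10 * T) := by
    calc _ ≤ 2 ^ (3 * T) * 2 ^ (3 * T) := Nat.mul_le_mul hv (Nat.sub_le _ _)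
      _ = 2 ^ (6 * T) := by rw [← pow_add]; congr 1; ring
      _ < _ := Nat.pow_lt_pow_right (by norm_num) (by omega)
  rw [doubleWord, BitVec.toNat_udiv, BitVec.toNat_mul, h1, toNat_ofNat_two_pow (by omega),
    Nat.mod_eq_of_lt hmul]
  rfl

lemma toNat_iterate_doubleWord (hT : 1 ≤ T) {v : BitVec (10 * T)} (hv : v.toNat ≤ 2 ^ (3 * T))
    (i : ℕ) : ((doubleWord T)^[i] v).toNat = (doubleStep T)^[i] v.toNat := by
  induction i with
  | zero => rfl
  | succ i ih =>
    rw [Function.iterate_succ_apply', Function.iterate_succ_apply', toNat_doubleWord hT, ih]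
    rw [ih]
    exact iterate_doubleStep_le hT hv i

/-- The complement `2 ^ (3 T) - 1 - v` on words. -/
def complWord (T : ℕ) (v : BitVec (10 * T)) : BitVec (10 * T) :=
  if decide (v < BitVec.ofNat (10 * T) (2 ^ (3 * T))) then
    BitVec.ofNat (10 * T) (2 ^ (3 * T) - 1) - v else 0#(10 * T)

lemma toNat_complWord (hT : 1 ≤ T) (v : BitVec (10 * T)) :
    (complWord T v).toNat = 2 ^ (3 * T) - 1 - v.toNat := by
  have h0 : (BitVec.ofNat (10 * T) (2 ^ (3 * T) - 1)).toNat = 2 ^ (3 * T) - 1 := by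
    rw [BitVec.toNat_ofNat, Nat.mod_eq_of_lt]
    have : 2 ^ (3 * T) < 2 ^ (10 * T) := Nat.pow_lt_pow_right (by norm_num) (by omega)
    have : 0 < 2 ^ (3 * T) := by positivity
    omega
  have h3 : 3 * T < 10 * T := by omega
  rw [complWord]
  simp only [decide_eq_true_eq, BitVec.lt_def, toNat_ofNat_two_pow h3]
  split_ifs with h
  · rw [BitVec.toNat_sub_of_le, h0]
    rw [BitVec.le_def, h0]
    omega
  · simp
    omega

/-- `reportedCode` on words. -/
def codeWord (T : ℕ) (g : Fin (6 * T) → α) (x : α → Bool) : BitVec (10 * T) :=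
  complWord T ((doubleWord T)^[T] (startWord T (foldWord T (gridWord T g x))))

lemma foldIndex_le {j : ℕ} (hj : j < 2 ^ T) : 2 * foldIndex T j ≤ 2 ^ T := by
  rw [foldIndex]; omega

lemma toNat_codeWord (hT : 1 ≤ T) (g : Fin (6 * T) → α) (x : α → Bool) :
    (codeWord T g x).toNat = reportedCode T (Nat.ofBits (x ∘ g)) := by
  have hg := toNat_gridWord hT g x
  have hlt := gridIndex_lt T (Nat.ofBits (x ∘ g))
  have hf := toNat_foldWord hT (v := gridWord T g x) (by rw [hg]; exact hlt)
  rw [hg] at hf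
  have hfle := foldIndex_le hlt
  have hs := toNat_startWord hT (v := foldWord T (gridWord T g x)) (by rw [hf]; omega)
  rw [hf] at hs
  rw [codeWord, toNat_complWord hT, toNat_iterate_doubleWord hT, hs]
  · rfl
  · rw [hs]
    exact (startValue_spec hT hfle).1

lemma ckt_codeWord (g : Fin (6 * T) → α) :
    Ckt (codeWord T g) ((10 * T + 100) * Ckt.opCost (10 * T)) := by
  have hid : Ckt (fun v : BitVec (10 * T) => v) 0 := Ckt.id'
  have h1 : Ckt (gridWord T g) (10 * Ckt.opCost (10 * T)) :=
    ((((ckt_word g).add (Ckt.const _)).div (Ckt.const _)).mod (Ckt.const _)).mono (by omega)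
  have h2 : Ckt (foldWord T) (10 * Ckt.opCost (10 * T)) :=
    ((((Ckt.const _).sub hid).ult hid).ite ((Ckt.const _).sub hid) hid).mono (by omega)
  have h3 : Ckt (startWord T) (10 * Ckt.opCost (10 * T)) :=
    (((Ckt.const _).mul (hid.mul hid)).div (Ckt.const _)).mono (by omega)
  have h4 : Ckt (doubleWord T) (10 * Ckt.opCost (10 * T)) :=
    ((hid.mul ((Ckt.const _).sub hid)).div (Ckt.const _)).mono (by omega)
  have h5 : Ckt (complWord T) (10 * Ckt.opCost (10 * T)) :=
    ((hid.ult (Ckt.const _)).ite ((Ckt.const _).sub hid) (Ckt.const _)).mono (by omega)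
  exact ((((h1.comp h2).comp h3).comp (h4.iterate T)).comp h5).mono (by
    rw [add_mul, mul_comm 10 T, mul_assoc]; omega)

lemma energyCode_lt (T j : ℕ) : energyCode T j < 2 ^ (3 * T) := by
  have : 0 < 2 ^ (3 * T) := by positivity
  unfold energyCode
  omega

lemma exists_code_circuit (hT : 1 ≤ T) (g : Fin (6 * T) → α) :
    ∃ s ≤ (10 * T + 100) * Ckt.opCost (10 * T), HasCircuit (fun (x : α → Bool) (i : Fin (3 * T)) =>
      (reportedCode T (Nat.ofBits (x ∘ g))).testBit i) s := by
  obtain ⟨s, hs, h⟩ := (ckt_codeWord g).hasCircuit (n := 3 * T) (by omega)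
  refine ⟨s, hs, ?_⟩
  have : (fun (x : α → Bool) (i : Fin (3 * T)) => (codeWord T g x).getLsbD i) =
      fun (x : α → Bool) (i : Fin (3 * T)) => (reportedCode T (Nat.ofBits (x ∘ g))).testBit i := by
    funext x i
    rw [← toNat_codeWord hT g x]
    rfl
  rwa [this] at h

end EnergyCircuit

/-! ### The amplitudes of phase estimation -/

section PhaseEstimation

/-- The amplitude of the outcome `k` in the estimation of the phase `μ` with `m` binary digits. -/
def estimationAmplitude (m : ℕ) (μ : ℂ) (k : ℕ) : ℂ :=
  1 / 2 ^ m * ∑ t ∈ Finset.range (2 ^ m), μ ^ t * (turn (-(t * k / 2 ^ m)) : ℂ)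

lemma norm_turn_sub_one_ge {x d : ℝ} (h : ∀ c : ℤ, d ≤ |x - c|) : 4 * d ≤ ‖(turn x : ℂ) - 1‖ := by
  set y := x - round x with hy
  have hxy : x = y + (round x : ℤ) := by rw [hy]; ring
  have hy2 : |y| ≤ 1 / 2 := abs_sub_round x
  have ht : (turn x : ℂ) = Complex.exp (Complex.I * ((2 * π * y : ℝ) : ℂ)) := by
    rw [hxy, turn_add, turn_int, mul_one, coe_turn]
    congr 1
    push_cast
    ring
  rw [ht, Complex.norm_exp_I_mul_ofReal_sub_one, Real.norm_eq_abs, abs_mul,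
    abs_of_pos (by norm_num : (0 : ℝ) < 2), show 2 * π * y / 2 = π * y by ring]
  have h1 : 2 * |y| ≤ |sin (π * y)| := by
    have h2 : |sin (π * y)| = |sin (π * |y|)| := by
      rcases abs_choice y with h | h <;> rw [h]
      rw [mul_neg, sin_neg, abs_neg]
    have h3 := mul_le_sin (x := π * |y|) (by positivity) (by nlinarith [pi_pos])
    rw [h2]
    refine le_trans (le_of_eq ?_) (h3.trans (le_abs_self _))
    field_simp
  have := h (round x)
  linarith

/-- Outcomes at distance at least `d` (modulo one) from the phase have small amplitude, by the formula
for geometric sums. -/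
lemma norm_estimationAmplitude_le {m k : ℕ} {θ d : ℝ} (hd : 0 < d)
    (h : ∀ c : ℤ, d ≤ |θ - k / 2 ^ m - c|) :
    ‖estimationAmplitude m (turn θ) k‖ ≤ 1 / (2 ^ (m + 1) * d) := by
  have hz := norm_turn_sub_one_ge h
  set z : ℂ := (turn (θ - k / 2 ^ m) : ℂ) with hz'
  have hz1 : z ≠ 1 := by
    intro h1
    rw [h1, sub_self, norm_zero] at hz
    linarith
  have hterm : ∀ t : ℕ, (turn θ : ℂ) ^ t * (turn (-(t * k / 2 ^ m)) : ℂ) = z ^ t := by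
    intro t
    rw [hz', ← Circle.coe_pow, ← Circle.coe_mul, ← Circle.coe_pow, ← turn_nat_mul, ← turn_nat_mul,
      ← turn_add]
    congr 2
    ring
  have hnum : ‖z ^ (2 ^ m) - 1‖ ≤ 2 := by
    refine (norm_sub_le _ _).trans ?_
    rw [norm_pow, hz', Circle.norm_coe]
    norm_num
  rw [estimationAmplitude, Finset.sum_congr rfl fun t _ => hterm t, geom_sum_eq hz1, norm_mul,
    norm_div, norm_div, norm_one, norm_pow, Complex.norm_ofNat]
  have h4 : ‖z ^ (2 ^ m) - 1‖ / ‖z - 1‖ ≤ 2 / (4 * d) :=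
    div_le_div₀ (by norm_num) hnum (by positivity) hz
  calc (1 : ℝ) / 2 ^ m * (‖z ^ (2 ^ m) - 1‖ / ‖z - 1‖) ≤ 1 / 2 ^ m * (2 / (4 * d)) :=
        mul_le_mul_of_nonneg_left h4 (by positivity)
    _ = 1 / (2 ^ (m + 1) * d) := by
        rw [pow_succ]
        field_simp
        norm_num

/-- A fraction `s / r` with `r ≤ 2 ^ T` has a unique closest point in the grid of the multiples of
`1 / 2 ^ T`: the midpoints of the grid have the denominator `2 ^ (T + 1)` in lowest terms. -/
lemma exists_gridPoint {T r : ℕ} (hr : 0 < r) (hrT : r ≤ 2 ^ T) (s : ℤ) :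
    ∃ J : ℤ, |(s : ℝ) / r * 2 ^ T - J| < 1 / 2 := by
  refine ⟨round ((s : ℝ) / r * 2 ^ T), lt_of_le_of_ne (abs_sub_round _) fun h => ?_⟩
  set J := round ((s : ℝ) / r * 2 ^ T)
  have hr' : (r : ℝ) ≠ 0 := by positivity
  have key : ∃ K : ℤ, s * 2 ^ (T + 1) = (2 * K + 1) * r := by
    rcases abs_choice ((s : ℝ) / r * 2 ^ T - J) with h1 | h1 <;> rw [h1] at h
    · refine ⟨J, ?_⟩
      have : (s : ℝ) * 2 ^ (T + 1) = (2 * J + 1) * r := by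
        field_simp at h
        rw [pow_succ]
        linarith
      exact_mod_cast this
    · refine ⟨J - 1, ?_⟩
      have : (s : ℝ) * 2 ^ (T + 1) = (2 * (J - 1) + 1) * r := by
        field_simp at h
        rw [pow_succ]
        linarith
      exact_mod_cast this
  obtain ⟨K, hK⟩ := key
  have hcop : IsCoprime ((2 : ℤ) ^ (T + 1)) (2 * K + 1) :=
    IsCoprime.pow_left ⟨-K, 1, by ring⟩
  have hdvd : (2 : ℤ) ^ (T + 1) ∣ r := hcop.dvd_of_dvd_mul_left ⟨s, by rw [← hK]; ring⟩
  have h2 : 2 ^ (T + 1) ∣ r := by exact_mod_cast hdvd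
  have := Nat.le_of_dvd hr h2
  rw [pow_succ] at this
  have : 0 < 2 ^ T := by positivity
  omega

/-- If the outcome `k` is not rounded to the grid point `J` of the phase `s / r`, then it is far away
from the phase. -/
lemma le_abs_of_gridIndex_ne {T r k : ℕ} (hT : 1 ≤ T) (hr : 0 < r) {s J : ℤ}
    (hJ : |(s : ℝ) / r * 2 ^ T - J| < 1 / 2) (hk : gridIndex T k ≠ (J % 2 ^ T).toNat) (c : ℤ) :
    1 / (r * 2 ^ (T + 1)) ≤ |(s : ℝ) / r - k / 2 ^ (6 * T) - c| := by
  by_contra! hlt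
  apply hk
  have hr0 : (0 : ℝ) < r := by positivity
  -- The fraction has distance at least `1 / (2 r)` from the midpoints of the grid, in units of `1 / 2 ^ T`.
  have h1 : |(s : ℝ) / r * 2 ^ T - J| ≤ 1 / 2 - 1 / (2 * r) := by
    have e : (s : ℝ) / r * 2 ^ T - J = (2 * s * 2 ^ T - 2 * J * r : ℤ) / (2 * r) := by
      push_cast; field_simp
    rw [e, abs_div, abs_of_pos (by positivity : (0 : ℝ) < 2 * r), ← Int.cast_abs] at hJ ⊢
    rw [div_lt_iff₀ (by positivity)] at hJ
    have h2 : |2 * s * 2 ^ T - 2 * J * r| < (r : ℤ) := by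
      have : ((|2 * s * 2 ^ T - 2 * J * r| : ℤ) : ℝ) < ((r : ℤ) : ℝ) := by
        refine hJ.trans_le (le_of_eq ?_)
        push_cast; ring
      exact_mod_cast this
    have h3 : ((|2 * s * 2 ^ T - 2 * J * r| : ℤ) : ℝ) ≤ r - 1 := by
      have : |2 * s * 2 ^ T - 2 * J * r| ≤ (r : ℤ) - 1 := by omega
      exact_mod_cast this
    rw [div_le_iff₀ (by positivity)]
    refine h3.trans (le_of_eq ?_)
    field_simp
  have h2 : |((k + c * 2 ^ (6 * T) : ℤ) : ℝ) / 2 ^ (5 * T) - J| < 1 / 2 := by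
    have hP : (2 : ℝ) ^ (6 * T) = 2 ^ (5 * T) * 2 ^ T := by rw [← pow_add]; congr 1; ring
    have e : ((k + c * 2 ^ (6 * T) : ℤ) : ℝ) / 2 ^ (5 * T) - J =
        ((s : ℝ) / r * 2 ^ T - J) - 2 ^ T * ((s : ℝ) / r - k / 2 ^ (6 * T) - c) := by
      push_cast
      rw [hP]
      field_simp
      ring
    rw [e]
    refine (abs_sub _ _).trans_lt ?_
    rw [abs_mul, abs_of_pos (by positivity : (0 : ℝ) < 2 ^ T)]
    have h3 : 2 ^ T * |(s : ℝ) / r - k / 2 ^ (6 * T) - c| < 2 ^ T * (1 / (r * 2 ^ (T + 1))) :=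
      mul_lt_mul_of_pos_left hlt (by positivity)
    have h4 : (2 : ℝ) ^ T * (1 / (r * 2 ^ (T + 1))) = 1 / (2 * r) := by
      rw [pow_succ]; field_simp
    linarith
  -- Hence the outcome is rounded to `J` modulo `2 ^ T`.
  have hD : (2 : ℤ) ^ (5 * T) = 2 * 2 ^ (5 * T - 1) := by
    rw [← pow_succ']
    congr 1
    omega
  have hDpos : (0 : ℤ) < 2 ^ (5 * T - 1) := by positivity
  have h3 : |k + c * 2 ^ (6 * T) - J * 2 ^ (5 * T)| < (2 : ℤ) ^ (5 * T - 1) := by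
    have hDR : (2 : ℝ) ^ (5 * T) = 2 * 2 ^ (5 * T - 1) := by exact_mod_cast hD
    have e : ((k + c * 2 ^ (6 * T) : ℤ) : ℝ) / 2 ^ (5 * T) - J =
        ((k + c * 2 ^ (6 * T) - J * 2 ^ (5 * T) : ℤ) : ℝ) / 2 ^ (5 * T) := by
      push_cast
      field_simp
    rw [e, abs_div, abs_of_pos (by positivity : (0 : ℝ) < 2 ^ (5 * T)), div_lt_iff₀ (by positivity),
      ← Int.cast_abs, hDR] at h2
    have : ((|k + c * 2 ^ (6 * T) - J * 2 ^ (5 * T)| : ℤ) : ℝ) < ((2 ^ (5 * T - 1) : ℤ) : ℝ) := by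
      refine h2.trans_le (le_of_eq ?_)
      push_cast; ring
    exact_mod_cast this
  rw [abs_lt] at h3
  have h6 : (2 : ℤ) ^ (6 * T) = 2 ^ (5 * T) * 2 ^ T := by rw [← pow_add]; congr 1; ring
  have h4 : (k + 2 ^ (5 * T - 1) : ℤ) / 2 ^ (5 * T) = J - c * 2 ^ T := by
    have e : (k + 2 ^ (5 * T - 1) : ℤ) =
        (k + c * 2 ^ (6 * T) - J * 2 ^ (5 * T) + 2 ^ (5 * T - 1)) +
          (J - c * 2 ^ T) * 2 ^ (5 * T) := by rw [h6]; ring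
    rw [e, Int.add_mul_ediv_right _ _ (by positivity), Int.ediv_eq_zero_of_lt, zero_add]
    · linarith
    · linarith
  have h5 : ((gridIndex T k : ℕ) : ℤ) = J % 2 ^ T := by
    rw [gridIndex]
    push_cast
    rw [h4, mul_comm c, Int.sub_mul_emod_self_left]
  omega

lemma sum_norm_sq_le_of_card {X : Type} [Fintype X] (f : X → ℂ) (S : Finset X) {a : ℝ} {c : ℕ}
    (hS : ∀ x ∉ S, f x = 0) (hf : ∀ x, ‖f x‖ ≤ a) (hc : S.card ≤ c) :
    ∑ x, ‖f x‖ ^ 2 ≤ c * a ^ 2 := by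
  calc ∑ x, ‖f x‖ ^ 2 = ∑ x ∈ S, ‖f x‖ ^ 2 := by
        symm
        refine Finset.sum_subset (Finset.subset_univ S) fun x _ hx => ?_
        rw [hS x hx]; simp
    _ ≤ ∑ _x ∈ S, a ^ 2 := Finset.sum_le_sum fun x _ => pow_le_pow_left₀ (norm_nonneg _) (hf x) 2
    _ = S.card * a ^ 2 := by rw [Finset.sum_const, nsmul_eq_mul]
    _ ≤ c * a ^ 2 := by
        have : (S.card : ℝ) ≤ c := by exact_mod_cast hc
        exact mul_le_mul_of_nonneg_right this (sq_nonneg a)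

end PhaseEstimation

/-! ### Eigenvectors of permutation operators -/

section Permutation

variable {X : Type} [Fintype X]

lemma eq_pow_mul_of_eigen {σ : Equiv.Perm X} {ψ : X → ℂ} {μ : ℂ}
    (h : ∀ x, ψ x = μ * ψ (σ x)) (t : ℕ) (x : X) : ψ x = μ ^ t * ψ ((σ ^ t) x) := by
  induction t with
  | zero => simp
  | succ t ih => rw [ih, h ((σ ^ t) x), pow_succ, ← mul_assoc, pow_succ', Equiv.Perm.mul_apply]

/-- The orbit of a point where an eigenvector does not vanish has at most `card X` elements, and the
eigenvalue is a root of unity of the order of this orbit. -/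
lemma exists_turn_of_eigen {σ : Equiv.Perm X} {ψ : X → ℂ} {μ : ℂ}
    (h : ∀ x, ψ x = μ * ψ (σ x)) (h0 : ψ ≠ 0) :
    ∃ (s : ℤ) (r : ℕ), 0 < r ∧ r ≤ Fintype.card X ∧ μ = turn ((s : ℝ) / r) := by
  obtain ⟨x, hx⟩ : ∃ x, ψ x ≠ 0 := by
    by_contra! hc
    exact h0 (funext hc)
  obtain ⟨i, j, hij, hσ⟩ := Fintype.exists_ne_map_eq_of_card_lt
    (fun i : Fin (Fintype.card X + 1) => (σ ^ (i : ℕ)) x) (by simp)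
  wlog hlt : i < j generalizing i j
  · exact this j i hij.symm hσ.symm (lt_of_le_of_ne (not_lt.1 hlt) hij.symm)
  have hi := eq_pow_mul_of_eigen h i x
  have hj := eq_pow_mul_of_eigen h j x
  rw [← show (σ ^ (i : ℕ)) x = (σ ^ (j : ℕ)) x from hσ] at hj
  have hne : ψ ((σ ^ (i : ℕ)) x) ≠ 0 := by
    intro h'; rw [h', mul_zero] at hi; exact hx hi
  have hμi : μ ^ (i : ℕ) ≠ 0 := by
    intro h'; rw [h', zero_mul] at hi; exact hx hi
  have hμ : μ ^ (j : ℕ) = μ ^ (i : ℕ) := mul_right_cancel₀ hne (hj.symm.trans hi)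
  have hlt' : (i : ℕ) < j := hlt
  set r := (j : ℕ) - i with hr
  have hr0 : 0 < r := by omega
  have hμr : μ ^ r = 1 := by
    have : μ ^ (j : ℕ) = μ ^ (i : ℕ) * μ ^ r := by rw [← pow_add]; congr 1; omega
    rw [hμ] at this
    exact (mul_right_eq_self₀.1 this.symm).resolve_right hμi
  have hj' := j.2
  have : NeZero r := ⟨hr0.ne'⟩
  obtain ⟨s, -, hs⟩ := (Complex.mem_rootsOfUnity r (Units.mk0 μ (by
    intro h'; rw [h', zero_pow hr0.ne'] at hμr; exact zero_ne_one hμr))).1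
    (by rw [mem_rootsOfUnity]; ext; simpa using hμr)
  refine ⟨s, r, hr0, by omega, ?_⟩
  rw [coe_turn]
  simp only [Units.val_mk0] at hs
  rw [← hs]
  push_cast
  congr 1
  ring

end Permutation

/-- An eigenvector of `u + u⁻¹`, for a unitary operator `u`, is the sum of two orthogonal
eigenvectors of `u` (one of which may vanish), whose eigenvalues are conjugate. -/
lemma exists_eigenvector_decomposition {V : Type*} [NormedAddCommGroup V] [InnerProductSpace ℂ V]
    (u : V ≃ₗᵢ[ℂ] V) (ψ : V) (E : ℝ) (hψ : ψ ≠ 0) (h : u ψ + u.symm ψ = (E : ℂ) • ψ) :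
    ∃ (φ : ℝ) (ψ₁ ψ₂ : V), E = 2 * cos (2 * π * φ) ∧ ψ = ψ₁ + ψ₂ ∧
      u ψ₁ = (turn φ : ℂ) • ψ₁ ∧ u ψ₂ = (turn (-φ) : ℂ) • ψ₂ ∧ ‖ψ₁‖ ≤ ‖ψ‖ ∧ ‖ψ₂‖ ≤ ‖ψ‖ := by
  have hE : |E| ≤ 2 := by
    have h1 : ‖(E : ℂ) • ψ‖ ≤ ‖ψ‖ + ‖ψ‖ := by
      rw [← h]
      refine (norm_add_le _ _).trans_eq ?_
      rw [u.norm_map, u.symm.norm_map]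
    rw [norm_smul, Complex.norm_real, Real.norm_eq_abs] at h1
    have := norm_pos_iff.2 hψ
    nlinarith
  obtain ⟨hE1, hE2⟩ := abs_le.1 hE
  set φ : ℝ := arccos (E / 2) / (2 * π) with hφ
  have hφ' : 2 * π * φ = arccos (E / 2) := by rw [hφ]; field_simp
  have hcos : E = 2 * cos (2 * π * φ) := by
    rw [hφ', cos_arccos (by linarith) (by linarith)]; ring
  set μ : ℂ := (turn φ : ℂ) with hμ
  set ν : ℂ := (turn (-φ) : ℂ) with hν
  have hμν : μ * ν = 1 := by
    rw [hμ, hν, ← Circle.coe_mul, ← turn_add, add_neg_cancel, turn_zero, Circle.coe_one]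
  have hsum : (E : ℂ) = μ + ν := by
    rw [hcos, hμ, hν, coe_turn, coe_turn]
    push_cast
    rw [Complex.two_cos]
    congr 2; ring
  have hconj : (starRingEnd ℂ) μ = ν := by
    rw [hμ, hν, turn_neg, Circle.coe_inv_eq_conj]
  have huu : u (u ψ) = (μ + ν) • u ψ - ψ := by
    have := congrArg u h
    rw [map_add, u.apply_symm_apply, map_smul, hsum] at this
    exact eq_sub_of_add_eq this
  by_cases hne : μ = ν
  · refine ⟨φ, ψ, 0, hcos, by simp, ?_, by simp, le_rfl, by simp⟩
    rw [← hne] at huu hμν hconj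
    have hδ : u (u ψ - μ • ψ) = μ • (u ψ - μ • ψ) := by
      rw [map_sub, map_smul, huu]
      have h1 : ψ = (μ * μ) • ψ := by rw [hμν, one_smul]
      nth_rw 2 [h1]
      module
    have h0 : inner ℂ (u ψ - μ • ψ) (u ψ - μ • ψ) = 0 := by
      have h1 : inner ℂ (u ψ) (u (u ψ - μ • ψ)) = inner ℂ ψ (u ψ - μ • ψ) := u.inner_map_map _ _
      rw [hδ, inner_smul_right] at h1
      rw [inner_sub_left, inner_smul_left, hconj, ← h1, ← mul_assoc, hμν, one_mul, sub_self]
    exact sub_eq_zero.1 (inner_self_eq_zero.1 h0)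
  · have hd : μ - ν ≠ 0 := sub_ne_zero.2 hne
    set ψ₁ : V := (μ - ν)⁻¹ • (u ψ - ν • ψ) with hψ₁
    set ψ₂ : V := -(μ - ν)⁻¹ • (u ψ - μ • ψ) with hψ₂
    have hadd : ψ = ψ₁ + ψ₂ := by
      have : ψ₁ + ψ₂ = ((μ - ν)⁻¹ * (μ - ν)) • ψ := by
        rw [hψ₁, hψ₂]; module
      rw [this, inv_mul_cancel₀ hd, one_smul]
    have h1 : u ψ₁ = μ • ψ₁ := by
      have : μ • ψ₁ = (μ - ν)⁻¹ • (μ • u ψ - (μ * ν) • ψ) := by rw [hψ₁]; module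
      rw [this, hμν, hψ₁, map_smul, map_sub, map_smul, huu]
      module
    have h2 : u ψ₂ = ν • ψ₂ := by
      have : ν • ψ₂ = -(μ - ν)⁻¹ • (ν • u ψ - (μ * ν) • ψ) := by rw [hψ₂]; module
      rw [this, hμν, hψ₂, map_smul, map_sub, map_smul, huu]
      module
    have horth : inner ℂ ψ₁ ψ₂ = 0 := by
      have h3 : inner ℂ (u ψ₁) (u ψ₂) = inner ℂ ψ₁ ψ₂ := u.inner_map_map _ _
      rw [h1, h2, inner_smul_left, inner_smul_right, hconj, ← mul_assoc] at h3
      by_contra hc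
      have h4 : ν * ν = 1 := (mul_eq_right₀ hc).1 h3
      apply hne
      calc μ = μ * (ν * ν) := by rw [h4, mul_one]
        _ = ν := by rw [← mul_assoc, hμν, one_mul]
    have hpyth : ‖ψ‖ * ‖ψ‖ = ‖ψ₁‖ * ‖ψ₁‖ + ‖ψ₂‖ * ‖ψ₂‖ := by
      conv_lhs => rw [hadd]
      exact norm_add_sq_eq_norm_sq_add_norm_sq_of_inner_eq_zero _ _ horth
    refine ⟨φ, ψ₁, ψ₂, hcos, hadd, h1, h2, ?_, ?_⟩
    · exact abs_le_of_sq_le_sq' (by nlinarith [mul_self_nonneg ‖ψ₂‖]) (norm_nonneg _) |>.2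
    · exact abs_le_of_sq_le_sq' (by nlinarith [mul_self_nonneg ‖ψ₁‖]) (norm_nonneg _) |>.2

/-! ### The modular multiplication operator -/

section ModMul

variable {n N y : ℕ}

/-- The bit string of length `n` of a natural number. -/
def toBits (n x : ℕ) : Fin n → Bool := fun i => x.testBit i

lemma ofBits_toBits {x : ℕ} (h : x < 2 ^ n) : Nat.ofBits (toBits n x) = x := by
  change Nat.ofBits (fun i : Fin n => x.testBit i) = x
  rw [Nat.ofBits_testBit, Nat.mod_eq_of_lt h]

/-- Multiplication by `y` modulo `N`, on bit strings. -/
lemma exists_perm_mulMod (hN : 0 < N) (hN2 : N < 2 ^ n) (hy : Nat.Coprime y N) :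
    ∃ σ : Equiv.Perm (Fin n → Bool),
      (∀ x, Nat.ofBits (σ x) = mulMod N y (Nat.ofBits x)) ∧
      ∀ t x, Nat.ofBits ((σ ^ t) x) = mulMod N (y ^ t) (Nat.ofBits x) := by
  have hF : ∀ x : Fin n → Bool, Nat.ofBits (toBits n (mulMod N y (Nat.ofBits x))) =
      mulMod N y (Nat.ofBits x) := fun x =>
    ofBits_toBits (mulMod_lt hN2 (Nat.ofBits_lt_two_pow x))
  have hinj : Function.Injective fun x : Fin n → Bool => toBits n (mulMod N y (Nat.ofBits x)) := by
    -- The power `φ(N) - 1` of `y` is an inverse of `y` modulo `N`.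
    have hleft : ∀ x, mulMod N (y ^ (N.totient - 1)) (mulMod N y x) = x := by
      intro x
      rw [mulMod_mulMod hN]
      refine (mulMod_congr ?_).trans (mulMod_one (N := N))
      rw [← pow_succ', Nat.sub_add_cancel (Nat.totient_pos.2 hN)]
      exact Nat.ModEq.pow_totient hy
    intro x x' h
    have h1 : mulMod N y (Nat.ofBits x) = mulMod N y (Nat.ofBits x') := by
      rw [← hF, ← hF x']; exact congrArg Nat.ofBits h
    refine ofBits_injective ?_
    rw [← hleft (Nat.ofBits x), h1, hleft]
  let σ := Equiv.ofBijective _ (Finite.injective_iff_bijective.1 hinj)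
  have hσ : ∀ x, Nat.ofBits (σ x) = mulMod N y (Nat.ofBits x) := hF
  refine ⟨σ, hσ, fun t x => ?_⟩
  induction t with
  | zero => simp [mulMod_one]
  | succ t ih =>
    rw [pow_succ', Equiv.Perm.mul_apply, hσ, ih, mulMod_mulMod hN, pow_succ]

lemma modMul_apply {σ : Equiv.Perm (Fin n → Bool)}
    (hσ : ∀ x, Nat.ofBits (σ x) = mulMod N y (Nat.ofBits x)) (z x : Fin n → Bool) :
    modMul n N y z x = if z = σ x then 1 else 0 := by
  have : (Nat.ofBits z = (if Nat.ofBits x < N then Nat.ofBits x * y % N else Nat.ofBits x)) ↔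
      z = σ x := by
    rw [← ofBits_injective.eq_iff (a := z), hσ, mulMod]
  simp [modMul, this]

lemma toEuclideanLin_modMul {σ : Equiv.Perm (Fin n → Bool)}
    (hσ : ∀ x, Nat.ofBits (σ x) = mulMod N y (Nat.ofBits x)) (ψ : QState (Fin n)) :
    Matrix.toEuclideanLin (modMul n N y) ψ = LinearIsometryEquiv.piLpCongrLeft 2 ℂ ℂ σ ψ := by
  ext z
  have h : ∀ x, (z = σ x) ↔ x = σ.symm z := fun x => by rw [Equiv.eq_symm_apply, eq_comm]
  simp [Matrix.toLpLin_apply, Matrix.mulVec, dotProduct, modMul_apply hσ, h]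

lemma toEuclideanLin_modMul_conjTranspose {σ : Equiv.Perm (Fin n → Bool)}
    (hσ : ∀ x, Nat.ofBits (σ x) = mulMod N y (Nat.ofBits x)) (ψ : QState (Fin n)) :
    Matrix.toEuclideanLin (modMul n N y).conjTranspose ψ =
      (LinearIsometryEquiv.piLpCongrLeft 2 ℂ ℂ σ).symm ψ := by
  ext z
  simp [Matrix.toLpLin_apply, Matrix.mulVec, dotProduct, modMul_apply hσ]

lemma eigen_of_piLpCongrLeft {σ : Equiv.Perm (Fin n → Bool)} {ψ : QState (Fin n)} {μ : ℂ}
    (h : LinearIsometryEquiv.piLpCongrLeft 2 ℂ ℂ σ ψ = μ • ψ) (x : Fin n → Bool) :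
    ψ x = μ * ψ (σ x) := by
  have := congrArg (fun Φ : QState (Fin n) => Φ (σ x)) h
  simpa using this

/-- An eigenvector of `U + U†` is a sum of eigenvectors of `U` for two conjugate roots of unity of
order at most `2 ^ n`. -/
lemma exists_decomposition_of_shorHamiltonian {σ : Equiv.Perm (Fin n → Bool)}
    (hσ : ∀ x, Nat.ofBits (σ x) = mulMod N y (Nat.ofBits x)) (ψ : QState (Fin n)) (E : ℝ)
    (hψ : ‖ψ‖ = 1) (h : Matrix.toEuclideanLin (shorHamiltonian n N y) ψ = (E : ℂ) • ψ) :
    ∃ (s : ℤ) (r : ℕ) (ψ₁ ψ₂ : QState (Fin n)), 0 < r ∧ r ≤ 2 ^ n ∧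
      E = 2 * cos (2 * π * ((s : ℝ) / r)) ∧ ψ = ψ₁ + ψ₂ ∧
      (∀ x, ψ₁ x = turn ((s : ℝ) / r) * ψ₁ (σ x)) ∧
      (∀ x, ψ₂ x = turn (((-s : ℤ) : ℝ) / r) * ψ₂ (σ x)) ∧ ‖ψ₁‖ ≤ 1 ∧ ‖ψ₂‖ ≤ 1 := by
  have hψ0 : ψ ≠ 0 := by
    intro h0; simp [h0] at hψ
  have hu : LinearIsometryEquiv.piLpCongrLeft 2 ℂ ℂ σ ψ +
      (LinearIsometryEquiv.piLpCongrLeft 2 ℂ ℂ σ).symm ψ = (E : ℂ) • ψ := by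
    rw [← h, shorHamiltonian, map_add, LinearMap.add_apply, toEuclideanLin_modMul hσ,
      toEuclideanLin_modMul_conjTranspose hσ]
  obtain ⟨φ, ψ₁, ψ₂, hE, hadd, h1, h2, hn1, hn2⟩ :=
    exists_eigenvector_decomposition _ ψ E hψ0 hu
  rw [hψ] at hn1 hn2
  have e1 := eigen_of_piLpCongrLeft h1
  have e2 := eigen_of_piLpCongrLeft h2
  have hcos : ∀ x : ℝ, ((turn x : ℂ)).re = cos (2 * π * x) := by
    intro x
    rw [coe_turn, Complex.exp_re]
    simp
  have hcard : Fintype.card (Fin n → Bool) = 2 ^ n := by simp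
  have key : ∃ (s : ℤ) (r : ℕ), 0 < r ∧ r ≤ 2 ^ n ∧ turn φ = turn ((s : ℝ) / r) := by
    by_cases h0 : ψ₁ = 0
    · have h0' : (ψ₂ : (Fin n → Bool) → ℂ) ≠ 0 := by
        intro h'
        apply hψ0
        rw [hadd, h0, zero_add]
        ext x
        exact congrFun h' x
      obtain ⟨s, r, hr, hr2, hs⟩ := exists_turn_of_eigen e2 h0'
      refine ⟨-s, r, hr, hcard ▸ hr2, ?_⟩
      have : turn (-φ) = turn ((s : ℝ) / r) := Circle.ext hs
      rw [turn_neg, inv_eq_iff_eq_inv] at this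
      rw [this, ← turn_neg]
      push_cast
      rw [neg_div]
    · have h0' : (ψ₁ : (Fin n → Bool) → ℂ) ≠ 0 := by
        intro h'
        apply h0
        ext x
        exact congrFun h' x
      obtain ⟨s, r, hr, hr2, hs⟩ := exists_turn_of_eigen e1 h0'
      exact ⟨s, r, hr, hcard ▸ hr2, Circle.ext hs⟩
  obtain ⟨s, r, hr, hr2, hs⟩ := key
  refine ⟨s, r, ψ₁, ψ₂, hr, hr2, ?_, hadd, ?_, ?_, hn1, hn2⟩
  · rw [hE, ← hcos, ← hcos, hs]
  · rw [← hs]; exact e1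
  · have : turn (((-s : ℤ) : ℝ) / r) = turn (-φ) := by
      rw [turn_neg, hs, ← turn_neg]; push_cast; rw [neg_div]
    rw [this]; exact e2

end ModMul

section Estimation

variable {ι κ : Type} [Fintype ι] [DecidableEq ι] [Fintype κ] [DecidableEq κ]

/-! ### Linearity of circuits -/

lemma TwoQubitGate.apply_smul (g : TwoQubitGate ι) (c : ℂ) (Φ : QState ι) :
    g.apply (c • Φ) = c • g.apply Φ := by
  ext b
  simp only [apply_apply, PiLp.smul_apply, smul_eq_mul, Finset.mul_sum]
  exact Finset.sum_congr rfl fun _ _ => by ring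

lemma runCircuit_smul (C : List (TwoQubitGate ι)) (c : ℂ) (Φ : QState ι) :
    runCircuit C (c • Φ) = c • runCircuit C Φ := by
  induction C generalizing Φ with
  | nil => rfl
  | cons g C ih => simp [TwoQubitGate.apply_smul, ih]

/-- The linear operator of a circuit. -/
def circuitOp (C : List (TwoQubitGate ι)) : QState ι →ₗ[ℂ] QState ι where
  toFun := runCircuit C
  map_add' := runCircuit_add C
  map_smul' := runCircuit_smul C

/-- A norm-preserving operator that maps a finite-dimensional subspace into itself maps it onto
itself. -/
lemma exists_preimage_of_norm_preserving (f : QState ι →ₗ[ℂ] QState ι) (hf : ∀ v, ‖f v‖ = ‖v‖)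
    (W : Submodule ℂ (QState ι)) (hW : ∀ v ∈ W, f v ∈ W) {v : QState ι} (hv : v ∈ W) :
    ∃ u ∈ W, f u = v := by
  have hinj : Function.Injective (f.restrict hW) := by
    rw [injective_iff_map_eq_zero]
    intro u hu
    have h1 : f u = 0 := congrArg Subtype.val hu
    have h2 : ‖(u : QState ι)‖ = 0 := by rw [← hf, h1, norm_zero]
    exact Subtype.ext (norm_eq_zero.1 h2)
  obtain ⟨u, hu⟩ := LinearMap.surjective_of_injective hinj ⟨v, hv⟩
  exact ⟨u, u.2, congrArg Subtype.val hu⟩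

lemma runCircuit_compile_eq [Nontrivial ι] (P : List (RevOp ι)) (Φ Φ' : QState ι)
    (V : Set (ι → Bool)) (h1 : ∀ b, b ∉ V → Φ b = 0) (h2 : ∀ b ∈ V, Φ' (runProg P b) = Φ b)
    (h3 : ∀ b', Φ' b' ≠ 0 → ∃ b ∈ V, runProg P b = b') :
    runCircuit (compile P) Φ = Φ' := by
  ext b'
  obtain ⟨b, rfl⟩ : ∃ b, runProg P b = b' := ⟨_, runProg_runProg_reverse P b'⟩
  rw [runCircuit_compile]
  by_cases hb : b ∈ V
  · exact (h2 b hb).symm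
  · rw [h1 b hb]
    by_contra h
    obtain ⟨c, hc, hcb⟩ := h3 _ (Ne.symm h)
    apply hb
    rwa [← runProg_reverse_runProg P b, ← hcb, runProg_reverse_runProg]

/-! ### Phase estimation with a register that is restored -/

/-- A phase register of `m` qubits and an output register of `k` qubits in an apparatus. -/
structure Registers (κ : Type) (m k : ℕ) where
  phase : Fin m → κ
  output : Fin k → κ
  phase_injective : Function.Injective phase
  output_injective : Function.Injective output
  phase_ne_output : ∀ i j, phase i ≠ output j

namespace Registers

variable {m k : ℕ} (R : Registers κ m k)

/-- The bit strings that agree with `base` outside of the phase register and the output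
register. -/
def Clean (base : κ → Bool) (a : κ → Bool) : Prop :=
  ∀ x, (∀ i, x ≠ R.phase i) → (∀ j, x ≠ R.output j) → a x = base x

/-- The clean bit strings with the content `o` of the output register. -/
def Slice (base : κ → Bool) (o : Fin k → Bool) (a : κ → Bool) : Prop :=
  (∀ j, a (R.output j) = o j) ∧ R.Clean base a

/-- The bit string with the content `o` of the output register, and equal to `base` elsewhere. -/
def withOutput (base : κ → Bool) (o : Fin k → Bool) : κ → Bool := Function.extend R.output o base

/-- The states of the apparatus that are superpositions of clean bit strings. -/
def cleanSpace (base : κ → Bool) : Submodule ℂ (QState κ) where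
  carrier := {χ | ∀ a, χ a ≠ 0 → R.Clean base a}
  zero_mem' := fun a h => absurd rfl h
  add_mem' := by
    intro χ χ' h h' a ha
    by_cases h0 : χ a = 0
    · refine h' a fun h0' => ha ?_
      simp [h0, h0']
    · exact h a h0
  smul_mem' := by
    intro c χ h a ha
    refine h a fun h0 => ha ?_
    simp [h0]

/-- The number in the phase register, its qubits read in the reverse order. -/
def exponent (a : κ → Bool) : ℕ := Nat.ofBits ((a ∘ R.phase) ∘ Fin.rev)

variable {R} {base : κ → Bool}

lemma clean_of_eq {a a' : κ → Bool} (h : R.Clean base a)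
    (ha : ∀ x, (∀ i, x ≠ R.phase i) → (∀ j, x ≠ R.output j) → a' x = a x) : R.Clean base a' :=
  fun x h1 h2 => (ha x h1 h2).trans (h x h1 h2)

lemma extend_phase_apply (t : Fin m → Bool) (a : κ → Bool) (i : Fin m) :
    Function.extend R.phase t a (R.phase i) = t i := R.phase_injective.extend_apply _ _ _

lemma extend_phase_of_ne (t : Fin m → Bool) (a : κ → Bool) {x : κ} (hx : ∀ i, x ≠ R.phase i) :
    Function.extend R.phase t a x = a x :=
  Function.extend_apply' _ _ _ (by rintro ⟨i, rfl⟩; exact hx i rfl)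

lemma slice_extend_phase {o : Fin k → Bool} {t : Fin m → Bool} {a : κ → Bool} :
    R.Slice base o (Function.extend R.phase t a) ↔ R.Slice base o a := by
  have h1 : ∀ j, Function.extend R.phase t a (R.output j) = a (R.output j) := fun j =>
    extend_phase_of_ne t a fun i => (R.phase_ne_output i j).symm
  refine and_congr (forall_congr' fun j => by rw [h1]) (forall_congr' fun x =>
    forall_congr' fun hx => forall_congr' fun _ => by rw [extend_phase_of_ne t a hx])

lemma withOutput_output (o : Fin k → Bool) (j : Fin k) :
    R.withOutput base o (R.output j) = o j := R.output_injective.extend_apply _ _ _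

lemma withOutput_of_ne (o : Fin k → Bool) {x : κ} (hx : ∀ j, x ≠ R.output j) :
    R.withOutput base o x = base x :=
  Function.extend_apply' _ _ _ (by rintro ⟨i, rfl⟩; exact hx i rfl)

lemma slice_withOutput (o : Fin k → Bool) : R.Slice base o (R.withOutput base o) :=
  ⟨withOutput_output o, fun _ _ h => withOutput_of_ne o h⟩

/-- A bit string of a slice is determined by the content of the phase register. -/
lemma Slice.eq {o : Fin k → Bool} {a a' : κ → Bool} (h : R.Slice base o a)
    (h' : R.Slice base o a') (ht : a ∘ R.phase = a' ∘ R.phase) : a = a' := by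
  funext x
  by_cases h1 : ∃ i, x = R.phase i
  · obtain ⟨i, rfl⟩ := h1
    exact congrFun ht i
  · by_cases h2 : ∃ j, x = R.output j
    · obtain ⟨j, rfl⟩ := h2
      rw [h.1, h'.1]
    · push Not at h1 h2
      rw [h.2 x h1 h2, h'.2 x h1 h2]

open Classical in
lemma card_slice_le (o : Fin k → Bool) :
    (Finset.univ.filter fun a => R.Slice base o a).card ≤ 2 ^ m := by
  have : (Finset.univ : Finset (Fin m → Bool)).card = 2 ^ m := by simp
  rw [← this]
  refine Finset.card_le_card_of_injOn (fun a => a ∘ R.phase) (fun _ _ => Finset.mem_univ _) ?_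
  intro a ha a' ha' h
  simp only [Finset.coe_filter, Finset.mem_univ, true_and, Set.mem_ofPred_eq] at ha ha'
  exact ha.eq ha' h

/-- The circuit `Q` is the inverse quantum Fourier transform of the phase register (up to the order
of the qubits). -/
def IsFourier (R : Registers κ m k) (Q : List (TwoQubitGate κ)) : Prop :=
  ∀ Φ b, runCircuit Q Φ b = (√2 : ℂ)⁻¹ ^ m * ∑ t : Fin m → Bool,
    (turn (-(Nat.ofBits (t ∘ Fin.rev) * Nat.ofBits (b ∘ R.phase) / 2 ^ m)) : ℂ) *
      Φ (Function.extend R.phase t b)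

/-- The program `P` applies to the system the power of the permutation `σ` that the phase register
holds, and leaves the apparatus as it is. -/
def IsPower (R : Registers κ m k) (base : κ → Bool) (σ : Equiv.Perm (ι → Bool))
    (P : List (RevOp (ι ⊕ κ))) : Prop :=
  ∀ b, R.Clean base (b ∘ Sum.inr) → runProg P b ∘ Sum.inr = b ∘ Sum.inr ∧
    runProg P b ∘ Sum.inl = (σ ^ R.exponent (b ∘ Sum.inr)) (b ∘ Sum.inl)

/-- The program `P` adds the number `f j` to the output register bit by bit, for the number `j` in
the phase register. -/
def IsCopy (R : Registers κ m k) (base : κ → Bool) (f : ℕ → ℕ) (P : List (RevOp κ)) : Prop :=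
  ∀ a, R.Clean base a →
    (∀ j : Fin k, runProg P a (R.output j) =
      (a (R.output j) ^^ (f (Nat.ofBits (a ∘ R.phase))).testBit j)) ∧
    ∀ x, (∀ j, x ≠ R.output j) → runProg P a x = a x

/-- The circuit of phase estimation for a permutation operator: since the first Fourier transform is
applied to zeros, it produces the uniform superposition of all exponents. -/
def estimationCircuit [Nontrivial (ι ⊕ κ)] (Q : List (TwoQubitGate κ)) (P : List (RevOp (ι ⊕ κ))) :
    List (TwoQubitGate (ι ⊕ κ)) :=
  circuitOnRight ι Q ++ (compile P ++ circuitOnRight ι Q)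

variable {Q : List (TwoQubitGate κ)} {P : List (RevOp (ι ⊕ κ))} {P' : List (RevOp κ)}
  {σ : Equiv.Perm (ι → Bool)} {f : ℕ → ℕ}

lemma IsFourier.mem_cleanSpace (hQ : R.IsFourier Q) {χ : QState κ} (hχ : χ ∈ R.cleanSpace base) :
    runCircuit Q χ ∈ R.cleanSpace base := by
  intro a ha
  rw [hQ] at ha
  obtain ⟨t, -, ht⟩ := Finset.exists_ne_zero_of_sum_ne_zero (right_ne_zero_of_mul ha)
  refine clean_of_eq (hχ _ (right_ne_zero_of_mul ht)) fun x hx _ => ?_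
  rw [extend_phase_of_ne t a hx]

lemma IsCopy.mem_cleanSpace [Nontrivial κ] (hP' : R.IsCopy base f P') {χ : QState κ}
    (hχ : χ ∈ R.cleanSpace base) : runCircuit (compile P') χ ∈ R.cleanSpace base := by
  intro a ha
  obtain ⟨b, rfl⟩ : ∃ b, runProg P' b = a := ⟨_, runProg_runProg_reverse P' a⟩
  rw [runCircuit_compile] at ha
  have hb := hχ _ ha
  exact clean_of_eq hb fun x _ hx => (hP' b hb).2 x hx

/-- Multiplication of every basis state by the power of `μ` given by the exponent. -/
def phaseOp (R : Registers κ m k) (μ : ℂ) : QState κ →ₗ[ℂ] QState κ where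
  toFun χ := WithLp.toLp 2 fun a => μ ^ R.exponent a * χ a
  map_add' χ χ' := by ext a; simp [mul_add]
  map_smul' c χ := by ext a; simp [mul_left_comm]

lemma phaseOp_apply (μ : ℂ) (χ : QState κ) (a : κ → Bool) :
    R.phaseOp μ χ a = μ ^ R.exponent a * χ a := rfl

lemma norm_phaseOp {μ : ℂ} (hμ : ‖μ‖ = 1) (χ : QState κ) : ‖R.phaseOp μ χ‖ = ‖χ‖ := by
  rw [EuclideanSpace.norm_eq, EuclideanSpace.norm_eq]
  simp [phaseOp_apply, hμ]

lemma phaseOp_mem_cleanSpace {μ : ℂ} {χ : QState κ} (hχ : χ ∈ R.cleanSpace base) :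
    R.phaseOp μ χ ∈ R.cleanSpace base :=
  fun a ha => hχ a (right_ne_zero_of_mul ha)

/-- Phase kickback: on an eigenvector of the permutation operator, the power program acts on the
phase register only. -/
lemma IsPower.runCircuit_compile_tensorState [Nontrivial (ι ⊕ κ)] (hP : R.IsPower base σ P)
    {ψ : QState ι} {μ : ℂ} (hψ : ∀ x, ψ x = μ * ψ (σ x)) {χ : QState κ}
    (hχ : χ ∈ R.cleanSpace base) :
    runCircuit (compile P) (tensorState ψ χ) = tensorState ψ (R.phaseOp μ χ) := by
  refine runCircuit_compile_eq P _ _ {b | R.Clean base (b ∘ Sum.inr)} ?_ ?_ ?_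
  · intro b hb
    rw [tensorState_apply]
    by_contra h
    exact hb (hχ _ (right_ne_zero_of_mul h))
  · intro b hb
    rw [tensorState_apply, tensorState_apply, (hP b hb).1, (hP b hb).2, phaseOp_apply,
      eq_pow_mul_of_eigen hψ (R.exponent (b ∘ Sum.inr)) (b ∘ Sum.inl)]
    ring
  · intro b' hb'
    rw [tensorState_apply, phaseOp_apply] at hb'
    have hcl := hχ _ (right_ne_zero_of_mul (right_ne_zero_of_mul hb'))
    refine ⟨Sum.elim ((σ ^ R.exponent (b' ∘ Sum.inr)).symm (b' ∘ Sum.inl)) (b' ∘ Sum.inr), ?_, ?_⟩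
    · simpa using hcl
    · obtain ⟨h1, h2⟩ := hP (Sum.elim ((σ ^ R.exponent (b' ∘ Sum.inr)).symm (b' ∘ Sum.inl))
        (b' ∘ Sum.inr)) (by simpa using hcl)
      simp only [Sum.elim_comp_inr, Sum.elim_comp_inl, Equiv.apply_symm_apply] at h1 h2
      funext x
      cases x with
      | inl x => exact congrFun h2 x
      | inr x => exact congrFun h1 x

/-- The action of phase estimation on the apparatus, for an eigenvector with the eigenvalue `μ`. -/
def estimationOp (R : Registers κ m k) (Q : List (TwoQubitGate κ)) (μ : ℂ) :
    QState κ →ₗ[ℂ] QState κ :=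
  circuitOp Q ∘ₗ R.phaseOp μ ∘ₗ circuitOp Q

lemma estimationOp_apply (μ : ℂ) (χ : QState κ) :
    R.estimationOp Q μ χ = runCircuit Q (R.phaseOp μ (runCircuit Q χ)) := rfl

lemma norm_estimationOp {μ : ℂ} (hμ : ‖μ‖ = 1) (χ : QState κ) :
    ‖R.estimationOp Q μ χ‖ = ‖χ‖ := by
  rw [estimationOp_apply, norm_runCircuit, norm_phaseOp hμ, norm_runCircuit]

lemma estimationOp_mem_cleanSpace (hQ : R.IsFourier Q) {μ : ℂ} {χ : QState κ}
    (hχ : χ ∈ R.cleanSpace base) : R.estimationOp Q μ χ ∈ R.cleanSpace base :=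
  hQ.mem_cleanSpace (phaseOp_mem_cleanSpace (hQ.mem_cleanSpace hχ))

lemma runCircuit_estimationCircuit [Nontrivial (ι ⊕ κ)] (hQ : R.IsFourier Q)
    (hP : R.IsPower base σ P) {ψ : QState ι} {μ : ℂ} (hψ : ∀ x, ψ x = μ * ψ (σ x)) {χ : QState κ}
    (hχ : χ ∈ R.cleanSpace base) :
    runCircuit (estimationCircuit Q P) (tensorState ψ χ) =
      tensorState ψ (R.estimationOp Q μ χ) := by
  rw [estimationCircuit, runCircuit_append, runCircuit_append, runCircuit_circuitOnRight,
    hP.runCircuit_compile_tensorState hψ (hQ.mem_cleanSpace hχ), runCircuit_circuitOnRight,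
    estimationOp_apply]

/-- The measurement circuit: phase estimation, a copy of the function `f` of the estimate to the
output register, and the inverse of phase estimation. -/
def measurementCircuit [Nontrivial κ] [Nontrivial (ι ⊕ κ)] (Q : List (TwoQubitGate κ))
    (P : List (RevOp (ι ⊕ κ))) (P' : List (RevOp κ)) : List (TwoQubitGate (ι ⊕ κ)) :=
  estimationCircuit Q P ++ (circuitOnRight ι (compile P') ++ adjointCircuit (estimationCircuit Q P))

lemma mem_cleanSpace_basisState {a : κ → Bool} (ha : R.Clean base a) :
    basisState a ∈ R.cleanSpace base := by
  intro b hb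
  rw [basisState_apply] at hb
  have : b = a := by
    by_contra h
    simp [h] at hb
  rwa [this]

lemma clean_base : R.Clean base base := fun _ _ _ => rfl

/-- An eigenvector of the permutation operator is left intact, since each of the three stages maps
its products with clean states to such products. -/
lemma exists_measurementCircuit_eq [Nontrivial κ] [Nontrivial (ι ⊕ κ)] (hQ : R.IsFourier Q)
    (hP : R.IsPower base σ P) (hP' : R.IsCopy base f P') {ψ : QState ι} {μ : ℂ} (hμ : ‖μ‖ = 1)
    (hψ : ∀ x, ψ x = μ * ψ (σ x)) :
    ∃ χ : QState κ, ‖χ‖ = 1 ∧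
      runCircuit (measurementCircuit Q P P') (tensorState ψ (basisState base)) =
        tensorState ψ χ := by
  have h0 : basisState base ∈ R.cleanSpace base := mem_cleanSpace_basisState clean_base
  obtain ⟨χ, hχ, hχ'⟩ := exists_preimage_of_norm_preserving (R.estimationOp Q μ)
    (norm_estimationOp hμ) (R.cleanSpace base) (fun _ h => estimationOp_mem_cleanSpace hQ h)
    (hP'.mem_cleanSpace (estimationOp_mem_cleanSpace hQ (μ := μ) h0))
  refine ⟨χ, ?_, ?_⟩
  · rw [← norm_estimationOp (R := R) (Q := Q) hμ, hχ', norm_runCircuit, norm_estimationOp hμ,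
      norm_basisState]
  · rw [measurementCircuit, runCircuit_append, runCircuit_append,
      runCircuit_estimationCircuit hQ hP hψ h0, runCircuit_circuitOnRight, ← hχ',
      ← runCircuit_estimationCircuit hQ hP hψ hχ, runCircuit_adjointCircuit]

/-! ### The distribution of the estimate -/

open Classical in
/-- The superposition of the bit strings of a slice with the numbers `j ∈ S` in the phase register,
with the amplitudes of phase estimation. -/
def estimateState (R : Registers κ m k) (base : κ → Bool) (o : Fin k → Bool) (μ : ℂ) (S : Set ℕ) :
    QState κ :=
  WithLp.toLp 2 fun a => if R.Slice base o a ∧ Nat.ofBits (a ∘ R.phase) ∈ S then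
    estimationAmplitude m μ (Nat.ofBits (a ∘ R.phase)) else 0

open Classical in
lemma estimateState_apply (o : Fin k → Bool) (μ : ℂ) (S : Set ℕ) (a : κ → Bool) :
    R.estimateState base o μ S a = if R.Slice base o a ∧ Nat.ofBits (a ∘ R.phase) ∈ S then
      estimationAmplitude m μ (Nat.ofBits (a ∘ R.phase)) else 0 := rfl

lemma estimateState_add_compl (o : Fin k → Bool) (μ : ℂ) (S : Set ℕ) :
    R.estimateState base o μ S + R.estimateState base o μ Sᶜ =
      R.estimateState base o μ Set.univ := by
  ext a
  by_cases h1 : R.Slice base o a <;> by_cases h2 : Nat.ofBits (a ∘ R.phase) ∈ S <;>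
    simp [estimateState_apply, h1, h2]

/-- Phase estimation of the eigenvalue `μ`. -/
lemma estimationOp_basisState (hQ : R.IsFourier Q) (hbase : ∀ i, base (R.phase i) = false)
    (o : Fin k → Bool) (μ : ℂ) :
    R.estimationOp Q μ (basisState (R.withOutput base o)) =
      R.estimateState base o μ Set.univ := by
  classical
  have hzero : R.withOutput base o ∘ R.phase = fun _ => false := by
    funext i
    rw [Function.comp_apply, withOutput_of_ne o (R.phase_ne_output i), hbase]
  -- The first Fourier transform gives the uniform superposition over the slice.
  have h1 : ∀ a, runCircuit Q (basisState (R.withOutput base o)) a =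
      if R.Slice base o a then (√2 : ℂ)⁻¹ ^ m else 0 := by
    intro a
    rw [hQ, Finset.sum_eq_single (fun _ => false)]
    · have h2 : Nat.ofBits ((fun _ : Fin m => false) ∘ Fin.rev) = 0 := by
        rw [ofBits_eq_sum]; simp
      have h3 : Function.extend R.phase (fun _ => false) a = R.withOutput base o ↔
          R.Slice base o a := by
        rw [← slice_extend_phase (t := fun _ => false)]
        refine ⟨fun h => h ▸ slice_withOutput o, fun h => h.eq (slice_withOutput o) ?_⟩
        rw [hzero]
        funext i
        exact extend_phase_apply _ _ _
      rw [h2, basisState_apply]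
      simp [h3]
    · intro t _ ht
      rw [basisState_apply, if_neg, mul_zero]
      intro h
      apply ht
      rw [← hzero, ← h]
      funext i
      exact (extend_phase_apply t a i).symm
    · simp
  ext a
  rw [estimationOp_apply, hQ]
  simp only [phaseOp_apply, h1, slice_extend_phase, estimateState_apply, Set.mem_univ, and_true]
  by_cases ha : R.Slice base o a
  · simp only [ha, if_true]
    have h2 : (√2 : ℂ)⁻¹ ^ m * (√2 : ℂ)⁻¹ ^ m = 1 / 2 ^ m := by
      rw [← mul_pow, sqrtTwoInv_mul_self, one_div_pow]
    have h3 : ∀ t : Fin m → Bool, R.exponent (Function.extend R.phase t a) =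
        Nat.ofBits (t ∘ Fin.rev) := by
      intro t
      rw [exponent]
      congr 2
      funext i
      exact extend_phase_apply t a i
    simp only [h3]
    rw [estimationAmplitude, ← h2, mul_assoc, ← sum_ofBits_rev (n := m)
      (fun t => μ ^ t * (turn (-((t : ℝ) * (Nat.ofBits (a ∘ R.phase) : ℕ) / 2 ^ m)) : ℂ)),
      Finset.mul_sum, Finset.mul_sum, Finset.mul_sum]
    refine Finset.sum_congr rfl fun t _ => ?_
    ring
  · simp [ha]

/-- On a set of estimates where `f` is constant, the copy only changes the content of the output
register from `0` to the value of `f`. -/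
lemma IsCopy.runCircuit_estimateState [Nontrivial κ] (hP' : R.IsCopy base f P') {S : Set ℕ}
    {v : ℕ} (hS : ∀ j ∈ S, f j = v) (μ : ℂ) :
    runCircuit (compile P') (R.estimateState base (fun _ => false) μ S) =
      R.estimateState base (fun j => v.testBit j) μ S := by
  refine runCircuit_compile_eq P' _ _
    {a | R.Slice base (fun _ => false) a ∧ Nat.ofBits (a ∘ R.phase) ∈ S} ?_ ?_ ?_
  · intro a ha
    exact if_neg ha
  · rintro a ⟨ha, haS⟩
    obtain ⟨h1, h2⟩ := hP' a ha.2
    have hph : runProg P' a ∘ R.phase = a ∘ R.phase := by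
      funext i
      exact h2 _ (R.phase_ne_output i)
    have hsl : R.Slice base (fun j => v.testBit j) (runProg P' a) := by
      refine ⟨fun j => ?_, clean_of_eq ha.2 fun x _ hx => h2 x hx⟩
      rw [h1, ha.1, hS _ haS, Bool.false_xor]
    rw [estimateState_apply, estimateState_apply, hph, if_pos ⟨hsl, haS⟩, if_pos ⟨ha, haS⟩]
  · intro a' ha'
    rw [estimateState_apply] at ha'
    have ha'' : R.Slice base (fun j => v.testBit j) a' ∧ Nat.ofBits (a' ∘ R.phase) ∈ S := by
      by_contra h
      exact ha' (if_neg h)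
    obtain ⟨hsl, haS⟩ := ha''
    set a := R.withOutput a' (fun _ => false) with hadef
    have hne : ∀ x, (∀ j, x ≠ R.output j) → a x = a' x := fun x hx => withOutput_of_ne _ hx
    have hph : a ∘ R.phase = a' ∘ R.phase := by
      funext i
      exact hne _ (R.phase_ne_output i)
    have hcl : R.Slice base (fun _ => false) a :=
      ⟨withOutput_output _, clean_of_eq hsl.2 fun x _ hx => hne x hx⟩
    refine ⟨a, ⟨hcl, hph ▸ haS⟩, ?_⟩
    obtain ⟨h1, h2⟩ := hP' a hcl.2
    funext x
    by_cases hx : ∃ j, x = R.output j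
    · obtain ⟨j, rfl⟩ := hx
      rw [h1, hcl.1, hph, hS _ haS, Bool.false_xor, hsl.1]
    · push Not at hx
      rw [h2 x hx, hne x hx]

lemma norm_estimateState_le (o : Fin k → Bool) (μ : ℂ) {S : Set ℕ} {ε : ℝ} (hε : 0 ≤ ε)
    (hS : ∀ j ∈ S, ‖estimationAmplitude m μ j‖ ≤ ε) :
    ‖R.estimateState base o μ S‖ ^ 2 ≤ 2 ^ m * ε ^ 2 := by
  classical
  rw [EuclideanSpace.norm_sq_eq]
  have := sum_norm_sq_le_of_card (fun a => R.estimateState base o μ S a)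
    (Finset.univ.filter fun a => R.Slice base o a) (a := ε) (c := 2 ^ m) ?_ ?_ (card_slice_le o)
  · exact_mod_cast this
  · intro a ha
    rw [estimateState_apply, if_neg]
    rintro ⟨h, -⟩
    simp [h] at ha
  · intro a
    rw [estimateState_apply]
    split_ifs with h
    · exact hS _ h.2
    · simpa using hε

/-- If all the estimates outside of `S` have small amplitudes, and `f` is `v` on `S`, then the
measurement circuit approximately writes `v` to the output register and changes nothing else. -/
lemma norm_measurementCircuit_sub_le [Nontrivial κ] [Nontrivial (ι ⊕ κ)] (hQ : R.IsFourier Q)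
    (hP : R.IsPower base σ P) (hP' : R.IsCopy base f P') (hbase : ∀ i, base (R.phase i) = false)
    (hbase' : ∀ j, base (R.output j) = false) {ψ : QState ι} {μ : ℂ}
    (hψ : ∀ x, ψ x = μ * ψ (σ x)) {S : Set ℕ} {v : ℕ} (hS : ∀ j ∈ S, f j = v) {δ : ℝ}
    (hδ : ∀ o, ‖R.estimateState base o μ Sᶜ‖ ≤ δ) :
    ‖runCircuit (measurementCircuit Q P P') (tensorState ψ (basisState base)) -
      tensorState ψ (basisState (R.withOutput base fun j => v.testBit j))‖ ≤ ‖ψ‖ * (2 * δ) := by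
  have hb0 : base = R.withOutput base fun _ => false := by
    funext x
    by_cases hx : ∃ j, x = R.output j
    · obtain ⟨j, rfl⟩ := hx
      rw [withOutput_output, hbase']
    · push Not at hx
      rw [withOutput_of_ne _ hx]
  have h0 : basisState base ∈ R.cleanSpace base := mem_cleanSpace_basisState clean_base
  have hv : basisState (R.withOutput base fun j => v.testBit j) ∈ R.cleanSpace base :=
    mem_cleanSpace_basisState (slice_withOutput _).2
  have e0 : runCircuit (estimationCircuit Q P) (tensorState ψ (basisState base)) =
      tensorState ψ (R.estimateState base (fun _ => false) μ Set.univ) := by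
    rw [runCircuit_estimationCircuit hQ hP hψ h0]
    conv_lhs => rw [show basisState base = basisState (R.withOutput base fun _ => false) from
      congrArg _ hb0]
    rw [estimationOp_basisState hQ hbase]
  have ev : runCircuit (adjointCircuit (estimationCircuit Q P))
      (tensorState ψ (R.estimateState base (fun j => v.testBit j) μ Set.univ)) =
      tensorState ψ (basisState (R.withOutput base fun j => v.testBit j)) := by
    rw [← estimationOp_basisState hQ hbase, ← runCircuit_estimationCircuit hQ hP hψ hv,
      runCircuit_adjointCircuit]
  rw [measurementCircuit, runCircuit_append, runCircuit_append, e0, runCircuit_circuitOnRight,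
    ← ev, ← runCircuit_sub, norm_runCircuit, ← tensorState_sub_right, norm_tensorState,
    ← estimateState_add_compl _ _ S, ← estimateState_add_compl (fun j => v.testBit j) _ S,
    runCircuit_add, hP'.runCircuit_estimateState hS, add_sub_add_left_eq_sub]
  refine mul_le_mul_of_nonneg_left ?_ (norm_nonneg _)
  refine (norm_sub_le _ _).trans ?_
  rw [norm_runCircuit]
  linarith [hδ fun _ => false, hδ fun j => v.testBit j]

end Registers

end Estimation

/-! ### The measurement circuit on the apparatus -/

/-- The size of the memory for intermediate results: enough for both classical circuits. -/
def scratchSize (n T : ℕ) : ℕ :=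
  mulPowCost (10 * T) n (6 * T) + (10 * T + 100) * Ckt.opCost (10 * T)

/-- The apparatus with `3 T` output qubits and, as work qubits, a phase register of `6 T` qubits, a
copy of the system, and the memory for intermediate results. -/
abbrev EstimationApparatus (n T : ℕ) : Type :=
  Apparatus n (3 * T) (6 * T + (n + scratchSize n T))

namespace EstimationApparatus

variable (n T : ℕ)

/-- The phase register and the output register of the apparatus. -/
def registers : Registers (EstimationApparatus n T) (6 * T) (3 * T) where
  phase i := Sum.inr (Sum.inr (Sum.inr (Fin.castAdd _ i)))
  output j := Sum.inr (Sum.inr (Sum.inl j))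
  phase_injective i j h := by simpa using h
  output_injective i j h := by simpa using h
  phase_ne_output i j := by simp

/-- The work qubits outside of the phase register. -/
def work : Fin n ⊕ Fin (scratchSize n T) → EstimationApparatus n T :=
  Sum.elim (fun i => Sum.inr (Sum.inr (Sum.inr (Fin.natAdd _ (Fin.castAdd _ i)))))
    (fun i => Sum.inr (Sum.inr (Sum.inr (Fin.natAdd _ (Fin.natAdd _ i)))))

variable {n T}

lemma work_injective : Function.Injective (work n T) := by
  rintro (i | i) (j | j) h
  · simpa [work] using h
  · have := i.2
    simp [work, Fin.ext_iff] at h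
    omega
  · have := j.2
    simp [work, Fin.ext_iff] at h
    omega
  · simpa [work] using h

lemma phase_ne_work (i : Fin (6 * T)) (j : Fin n ⊕ Fin (scratchSize n T)) :
    (registers n T).phase i ≠ work n T j := by
  have := i.2
  rcases j with j | j <;> simp [registers, work, Fin.ext_iff] <;> omega

lemma output_ne_work (i : Fin (3 * T)) (j : Fin n ⊕ Fin (scratchSize n T)) :
    (registers n T).output i ≠ work n T j := by
  rcases j with j | j <;> simp [registers, work]

variable (n T) in
/-- The initial content of the apparatus. -/
def initial (N y : ℕ) : EstimationApparatus n T → Bool :=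
  Sum.elim (toBits n N) (Sum.elim (toBits n (y % N)) fun _ => false)

lemma initial_work (N y : ℕ) (j : Fin n ⊕ Fin (scratchSize n T)) :
    initial n T N y (work n T j) = false := by
  rcases j with j | j <;> rfl

lemma clean_work {N y : ℕ} {a : EstimationApparatus n T → Bool}
    (ha : (registers n T).Clean (initial n T N y) a) (j : Fin n ⊕ Fin (scratchSize n T)) :
    a (work n T j) = false := by
  rw [ha _ (fun i => (phase_ne_work i j).symm) (fun i => (output_ne_work i j).symm), initial_work]

variable (n) in
instance [NeZero T] : Nontrivial (EstimationApparatus n T) := by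
  have := NeZero.pos T
  refine ⟨(registers n T).phase ⟨0, by omega⟩, (registers n T).output ⟨0, by omega⟩,
    (registers n T).phase_ne_output _ _⟩

instance [NeZero T] : Nontrivial (Fin n ⊕ EstimationApparatus n T) :=
  Sum.inr_injective.nontrivial

lemma exists_isFourier [NeZero T] : ∃ Q : List (TwoQubitGate (EstimationApparatus n T)),
    Q.length ≤ (6 * T) ^ 2 + 6 * T ∧ (registers n T).IsFourier Q :=
  exists_fourierCircuit _ (registers n T).phase_injective

lemma exists_isCopy [NeZero T] : ∃ P : List (RevOp (EstimationApparatus n T)),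
    P.length ≤ 8 * scratchSize n T + 3 * T ∧
      ∀ N y, (registers n T).IsCopy (initial n T N y) (reportedCode T) P := by
  have hT := NeZero.pos T
  obtain ⟨s, hs, hF⟩ := exists_code_circuit hT (id : Fin (6 * T) → Fin (6 * T))
  have hsS : s ≤ scratchSize n T := hs.trans (Nat.le_add_left _ _)
  obtain ⟨P, hl, hP⟩ := hF.exists_xorProg (registers n T).phase
    (fun i => work n T (Sum.inr (Fin.castLE hsS i))) (registers n T).output
    (fun i j h => by simpa using work_injective h) (registers n T).output_injective
    (fun i j => phase_ne_work i _) (registers n T).phase_ne_output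
    (fun i j => (output_ne_work j _).symm)
  refine ⟨P, ?_, fun N y a ha => hP a fun i => clean_work ha _⟩
  rw [Fintype.card_fin] at hl
  omega

/-- The qubits of the program for the powers of modular multiplication. -/
def mulWires (n T : ℕ) : MulInput n (6 * T) ⊕ Fin n ⊕ Fin (scratchSize n T) →
    Fin n ⊕ EstimationApparatus n T :=
  Sum.elim (Sum.elim Sum.inl (Sum.elim (fun i => Sum.inr (Sum.inl i))
    (Sum.elim (fun i => Sum.inr (Sum.inr (Sum.inl i)))
      (fun i => Sum.inr ((registers n T).phase i))))) (fun j => Sum.inr (work n T j))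

lemma mulWires_injective : Function.Injective (mulWires n T) := by
  rintro ((i | i | i | i) | i) ((j | j | j | j) | j) h
  all_goals
    first
    | (simp [mulWires, registers] at h; done)
    | (simpa [mulWires, registers] using h)
    | (simp only [mulWires, Sum.elim_inl, Sum.elim_inr, Sum.inr.injEq] at h
       first
       | exact absurd h (phase_ne_work _ _)
       | exact absurd h.symm (phase_ne_work _ _)
       | exact congrArg Sum.inr (work_injective h)
       | (rcases i with i | i <;> simp [work] at h; done)
       | (rcases j with j | j <;> simp [work] at h))

lemma exists_isPower [NeZero T] (hnT : n ≤ T) :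
    ∃ P : List (RevOp (Fin n ⊕ EstimationApparatus n T)),
      P.length ≤ 16 * scratchSize n T + 4 * n ∧
      ∀ N y, 0 < N → N < 2 ^ n → Nat.Coprime y N → ∀ σ : Equiv.Perm (Fin n → Bool),
        (∀ t x, Nat.ofBits ((σ ^ t) x) = mulMod N (y ^ t) (Nat.ofBits x)) →
        (registers n T).IsPower (initial n T N y) σ P := by
  have hT := NeZero.pos T
  obtain ⟨P, hl, hP⟩ := exists_mulPowProg (w := 10 * T) (n := n) (m := 6 * T)
    (S := scratchSize n T) (by omega) (by omega) (by omega) (Nat.le_add_right _ _)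
    (mulWires n T) mulWires_injective
  refine ⟨P, hl, fun N y hN hN2 hy σ hσ b hb => ?_⟩
  have hbN : Nat.ofBits (b ∘ mulWires n T ∘ Sum.inl ∘ MulInput.N) = N := by
    rw [← ofBits_toBits hN2]
    congr 1
    funext i
    exact hb (Sum.inl i) (by simp [registers]) (by simp [registers])
  have hby : Nat.ofBits (b ∘ mulWires n T ∘ Sum.inl ∘ MulInput.y) = y % N := by
    rw [← ofBits_toBits ((Nat.mod_lt y hN).trans hN2)]
    congr 1
    funext i
    exact hb (Sum.inr (Sum.inl i)) (by simp [registers]) (by simp [registers])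
  obtain ⟨h1, h2⟩ := hP b (fun i => clean_work hb i) (by rw [hbN]; exact hN) (by
    rw [hbN, hby, Nat.Coprime, (Nat.mod_modEq y N).gcd_eq]; exact hy)
  constructor
  · funext q
    exact h2 (Sum.inr q) fun i => Sum.inr_ne_inl
  · refine ofBits_injective ?_
    rw [hσ]
    rw [hbN, hby] at h1
    exact h1.trans (mulMod_congr ((Nat.mod_modEq y N).pow _))

end EstimationApparatus

/-! ### Accuracy and size of the measurement -/

lemma length_measurementCircuit_le {ι κ : Type} [Fintype ι] [DecidableEq ι] [Fintype κ]
    [DecidableEq κ] [Nontrivial κ] [Nontrivial (ι ⊕ κ)] (Q : List (TwoQubitGate κ))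
    (P : List (RevOp (ι ⊕ κ))) (P' : List (RevOp κ)) :
    (Registers.measurementCircuit Q P P').length ≤
      4 * Q.length + 22 * P.length + 11 * P'.length := by
  have h1 := length_compile_le P
  have h2 := length_compile_le P'
  simp only [Registers.measurementCircuit, Registers.estimationCircuit, List.length_append,
    length_adjointCircuit, length_circuitOnRight]
  omega

lemma scratchSize_le {n T : ℕ} (hT : 1 ≤ T) (hnT : n ≤ T) :
    scratchSize n T ≤ 10 ^ 9 * T ^ 4 := by
  have h1 : Ckt.opCost (10 * T) ≤ 2000 * (11 * T) ^ 3 := by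
    unfold Ckt.opCost
    gcongr
    omega
  calc scratchSize n T = (70 * T + 60 * n + 200) * Ckt.opCost (10 * T) := by
        rw [scratchSize, mulPowCost, ← add_mul]
        congr 1
        ring
    _ ≤ (330 * T) * (2000 * (11 * T) ^ 3) := Nat.mul_le_mul (by omega) h1
    _ = 878460000 * T ^ 4 := by ring
    _ ≤ 10 ^ 9 * T ^ 4 := Nat.mul_le_mul_right _ (by norm_num)

lemma exp_growth (n : ℕ) : 32 * (10 ^ 12 * (4 * n + 100) ^ 4) * 4 ^ n ≤ 2 ^ (4 * n + 100) := by
  have h : 32 * (10 ^ 12 * (4 * n + 100) ^ 4) ≤ 2 ^ (2 * n + 100) := by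
    have h2 : ∀ n, (4 * (n + 1) + 100) ^ 2 ≤ 2 * (4 * n + 100) ^ 2 := fun n => by
      rw [show 2 * (4 * n + 100) ^ 2 =
        (4 * (n + 1) + 100) ^ 2 + (16 * n ^ 2 + 768 * n + 9184) by ring]
      exact Nat.le_add_right _ _
    induction n with
    | zero => norm_num
    | succ n ih =>
      calc 32 * (10 ^ 12 * (4 * (n + 1) + 100) ^ 4)
          = 32 * (10 ^ 12 * ((4 * (n + 1) + 100) ^ 2) ^ 2) := by ring
        _ ≤ 32 * (10 ^ 12 * (2 * (4 * n + 100) ^ 2) ^ 2) := by gcongr; exact h2 n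
        _ = 4 * (32 * (10 ^ 12 * (4 * n + 100) ^ 4)) := by ring
        _ ≤ 4 * 2 ^ (2 * n + 100) := by gcongr
        _ = 2 ^ (2 * (n + 1) + 100) := by ring
  calc _ ≤ 2 ^ (2 * n + 100) * 4 ^ n := Nat.mul_le_mul_right _ h
    _ = 2 ^ (4 * n + 100) := by
      rw [show 4 * n + 100 = (2 * n + 100) + 2 * n by ring, pow_add 2 (2 * n + 100), pow_mul 2 2 n]
      norm_num

lemma div_two_pow_le_exp_neg (n : ℕ) {c : ℝ} (hc : c ≤ 32 * (10 ^ 12 * (4 * n + 100) ^ 4)) :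
    c / 2 ^ (4 * n + 100) ≤ exp (-(n : ℝ)) := by
  have h1 : exp (n : ℝ) ≤ 4 ^ n := by
    rw [← mul_one (n : ℝ), exp_nat_mul]
    exact pow_le_pow_left₀ (exp_pos _).le (by linarith [exp_one_lt_d9]) n
  have h2 : (32 * (10 ^ 12 * (4 * n + 100) ^ 4) * 4 ^ n : ℝ) ≤ 2 ^ (4 * n + 100) := by
    exact_mod_cast exp_growth n
  rw [div_le_iff₀ (by positivity), exp_neg, inv_mul_eq_div, le_div_iff₀ (exp_pos _)]
  refine le_trans ?_ h2
  exact mul_le_mul hc h1 (exp_pos _).le (by positivity)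

namespace EstimationApparatus

variable {n T : ℕ} [NeZero T]

/-- The estimate of an eigenvalue `exp (2 π i s / r)` with `r ≤ 2 ^ T` lies in the grid cell of the
eigenvalue up to an exponentially small amplitude, because `s / r` keeps a distance from the
boundaries of the cells. -/
lemma norm_estimateState_compl_le {s J : ℤ} {r : ℕ} (hr : 0 < r) (hrT : r ≤ 2 ^ T)
    (hJ : |(s : ℝ) / r * 2 ^ T - J| < 1 / 2) (base : EstimationApparatus n T → Bool)
    (o : Fin (3 * T) → Bool) :
    ‖(registers n T).estimateState base o (turn ((s : ℝ) / r))
      {k | gridIndex T k = (J % 2 ^ T).toNat}ᶜ‖ ≤ 1 / 2 ^ T := by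
  have hT : 1 ≤ T := NeZero.pos T
  have hr' : (0 : ℝ) < r := by exact_mod_cast hr
  have hrT' : (r : ℝ) ≤ 2 ^ T := by exact_mod_cast hrT
  have hamp : ∀ k ∈ {k | gridIndex T k = (J % 2 ^ T).toNat}ᶜ,
      ‖estimationAmplitude (6 * T) (turn ((s : ℝ) / r)) k‖ ≤ 1 / 2 ^ (4 * T) := by
    intro k hk
    refine (norm_estimationAmplitude_le (d := 1 / (r * 2 ^ (T + 1))) (by positivity)
      (le_abs_of_gridIndex_ne hT hr hJ hk)).trans ?_
    calc (1 : ℝ) / (2 ^ (6 * T + 1) * (1 / (r * 2 ^ (T + 1))))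
        = r * 2 ^ (T + 1) / 2 ^ (6 * T + 1) := by field_simp
      _ ≤ 2 ^ T * 2 ^ (T + 1) / 2 ^ (6 * T + 1) := by gcongr
      _ = 1 / 2 ^ (4 * T) := by
        rw [div_eq_div_iff (by positivity) (by positivity)]
        ring
  refine abs_le_of_sq_le_sq' ?_ (by positivity) |>.2
  refine (Registers.norm_estimateState_le o _ (by positivity) hamp).trans_eq ?_
  rw [div_pow, div_pow, mul_div_assoc', div_eq_div_iff (by positivity) (by positivity)]
  ring

/-- The measurement writes an energy code `v` that depends on `s / r` only to the output register,
and does so up to an exponentially small error. It treats `-s / r` in the same way, so that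
superpositions of the two eigenvectors are not disturbed. -/
lemma norm_measurementCircuit_sub_le {N y : ℕ} {σ : Equiv.Perm (Fin n → Bool)}
    {Q : List (TwoQubitGate (EstimationApparatus n T))}
    {P : List (RevOp (Fin n ⊕ EstimationApparatus n T))}
    {P' : List (RevOp (EstimationApparatus n T))} (hQ : (registers n T).IsFourier Q)
    (hP : (registers n T).IsPower (initial n T N y) σ P)
    (hP' : (registers n T).IsCopy (initial n T N y) (reportedCode T) P')
    {s J : ℤ} {r : ℕ} (hr : 0 < r) (hrT : r ≤ 2 ^ T)
    (hJ : |(s : ℝ) / r * 2 ^ T - J| < 1 / 2) {ψ₁ ψ₂ : QState (Fin n)}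
    (h₁ : ∀ x, ψ₁ x = turn ((s : ℝ) / r) * ψ₁ (σ x))
    (h₂ : ∀ x, ψ₂ x = turn (((-s : ℤ) : ℝ) / r) * ψ₂ (σ x)) (hn₁ : ‖ψ₁‖ ≤ 1) (hn₂ : ‖ψ₂‖ ≤ 1) :
    ‖runCircuit (Registers.measurementCircuit Q P P')
        (tensorState (ψ₁ + ψ₂) (basisState (initial n T N y))) -
      tensorState (ψ₁ + ψ₂) (basisState ((registers n T).withOutput (initial n T N y)
        fun j => (energyCode T (foldIndex T (J % 2 ^ T).toNat)).testBit j))‖ ≤ 4 / 2 ^ T := by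
  have key : ∀ (s J : ℤ) (ψ : QState (Fin n)), |(s : ℝ) / r * 2 ^ T - J| < 1 / 2 →
      (∀ x, ψ x = turn ((s : ℝ) / r) * ψ (σ x)) → ‖ψ‖ ≤ 1 →
      ‖runCircuit (Registers.measurementCircuit Q P P')
          (tensorState ψ (basisState (initial n T N y))) -
        tensorState ψ (basisState ((registers n T).withOutput (initial n T N y)
          fun j => (energyCode T (foldIndex T (J % 2 ^ T).toNat)).testBit j))‖ ≤ 2 / 2 ^ T := by
    intro s J ψ hJ hψ hn
    refine (Registers.norm_measurementCircuit_sub_le hQ hP hP' (fun _ => rfl) (fun _ => rfl) hψ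
      (S := {k | gridIndex T k = (J % 2 ^ T).toNat}) ?_
      (fun o => norm_estimateState_compl_le hr hrT hJ _ o)).trans ?_
    · intro k hk
      rw [reportedCode, show gridIndex T k = _ from hk]
    · calc ‖ψ‖ * (2 * (1 / 2 ^ T)) ≤ 1 * (2 * (1 / 2 ^ T)) := by gcongr
        _ = 2 / 2 ^ T := by ring
  have k₁ := key s J ψ₁ hJ h₁ hn₁
  have k₂ := key (-s) (-J) ψ₂ (by
    rw [← abs_neg]
    convert hJ using 2
    push_cast
    ring) h₂ hn₂
  rw [foldIndex_neg] at k₂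
  rw [tensorState_add_left, tensorState_add_left, runCircuit_add, add_sub_add_comm]
  calc _ ≤ _ := norm_add_le _ _
    _ ≤ 2 / 2 ^ T + 2 / 2 ^ T := add_le_add k₁ k₂
    _ = 4 / 2 ^ T := by ring

end EstimationApparatus

/-- If the final state is close to a state all of whose readouts are accurate, then the measurement
is accurate with high probability. -/
lemma EnergyMeasurement.le_probWithin {n : ℕ} (M : EnergyMeasurement n) (N y : ℕ)
    {ψ : QState (Fin n)} (hψ : ‖ψ‖ = 1) {E δE ε : ℝ} {Ψ : QState (Fin n ⊕ Apparatus n M.k M.w)}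
    (hΨ : ∀ b, Ψ b ≠ 0 → |E - M.readout b| ≤ δE) (h : ‖M.finalState N y ψ - Ψ‖ ≤ ε) :
    1 - ε ^ 2 ≤ M.probWithin N y ψ E δE := by
  classical
  have h1 : ∑ b, ‖M.finalState N y ψ b‖ ^ 2 = 1 := by
    rw [← EuclideanSpace.norm_sq_eq, finalState, norm_runCircuit, norm_tensorState, hψ,
      norm_basisState]
    norm_num
  have h2 : ∑ b, ‖(M.finalState N y ψ - Ψ) b‖ ^ 2 ≤ ε ^ 2 := by
    rw [← EuclideanSpace.norm_sq_eq]
    exact pow_le_pow_left₀ (norm_nonneg _) h 2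
  have h3 : ∑ b, ‖M.finalState N y ψ b‖ ^ 2 ≤
      M.probWithin N y ψ E δE + ∑ b, ‖(M.finalState N y ψ - Ψ) b‖ ^ 2 := by
    rw [probWithin, ← Finset.sum_add_distrib]
    refine Finset.sum_le_sum fun b _ => ?_
    split_ifs with hb
    · exact le_add_of_nonneg_right (by positivity)
    · have : Ψ b = 0 := by
        by_contra h0
        exact hb (hΨ b h0)
      rw [PiLp.sub_apply, this, sub_zero, zero_add]
  linarith

open EstimationApparatus in
/-- The measurement with `T` bits of precision. -/
lemma exists_energyMeasurement {n T : ℕ} (hT : 5 ≤ T) (hnT : n ≤ T) :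
    ∃ M : EnergyMeasurement n, M.complexity ≤ 10 ^ 12 * T ^ 4 ∧ M.qubits ≤ 10 ^ 12 * T ^ 4 ∧
      ∀ N y : ℕ, 0 < N → N < 2 ^ n → Nat.Coprime y N →
        M.HasAccuracy N y (2 / 3) (32 / 2 ^ T) ∧
        (∀ (ψ : QState (Fin n)) (μ : ℂ), ‖ψ‖ = 1 →
          Module.End.HasEigenvector (Matrix.toEuclideanLin (modMul n N y)) μ ψ →
            M.LeavesIntact N y ψ 0) ∧
        (∀ (ψ : QState (Fin n)) (E : ℝ), ‖ψ‖ = 1 →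
          Module.End.HasEigenvector (Matrix.toEuclideanLin (shorHamiltonian n N y)) (E : ℂ) ψ →
            M.LeavesIntact N y ψ (4 / 2 ^ T)) := by
  have : NeZero T := ⟨by omega⟩
  obtain ⟨Q, hQl, hQ⟩ := exists_isFourier (n := n) (T := T)
  obtain ⟨P, hPl, hP⟩ := exists_isPower hnT
  obtain ⟨P', hPl', hP'⟩ := exists_isCopy (n := n) (T := T)
  have hS := scratchSize_le (by omega : 1 ≤ T) hnT
  have hT2 : T ^ 2 ≤ T ^ 4 := Nat.pow_le_pow_right (by omega) (by norm_num)
  have hT1 : T ≤ T ^ 4 := Nat.le_self_pow (by norm_num) T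
  let M : EnergyMeasurement n := ⟨3 * T, 6 * T + (n + scratchSize n T),
    Registers.measurementCircuit Q P P'⟩
  -- The final state for an eigenvector of the Hamiltonian.
  have main : ∀ N y : ℕ, 0 < N → N < 2 ^ n → Nat.Coprime y N → ∀ (ψ : QState (Fin n)) (E : ℝ),
      ‖ψ‖ = 1 →
      Module.End.HasEigenvector (Matrix.toEuclideanLin (shorHamiltonian n N y)) (E : ℂ) ψ →
      ∃ v : ℕ, v < 2 ^ (3 * T) ∧ |E - (-2 + 4 * (v : ℝ) / 2 ^ (3 * T))| ≤ 32 / 2 ^ T ∧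
        ‖M.finalState N y ψ - tensorState ψ (basisState ((registers n T).withOutput
          (initial n T N y) fun j => v.testBit j))‖ ≤ 4 / 2 ^ T := by
    intro N y hN hN2 hy ψ E hψ hE
    obtain ⟨σ, hσ, hσt⟩ := exists_perm_mulMod hN hN2 hy
    obtain ⟨s, r, ψ₁, ψ₂, hr, hr2, hE', rfl, h₁, h₂, hn₁, hn₂⟩ :=
      exists_decomposition_of_shorHamiltonian hσ ψ E hψ hE.apply_eq_smul
    have hrT : r ≤ 2 ^ T := hr2.trans (Nat.pow_le_pow_right (by norm_num) hnT)
    obtain ⟨J, hJ⟩ := exists_gridPoint hr hrT s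
    refine ⟨energyCode T (foldIndex T (J % 2 ^ T).toNat), energyCode_lt _ _, ?_, ?_⟩
    · rw [hE']
      exact abs_energy_sub_le (by omega) hJ
    · exact norm_measurementCircuit_sub_le hQ (hP N y hN hN2 hy σ hσt) (hP' N y) hr hrT hJ h₁ h₂
        hn₁ hn₂
  refine ⟨M, ?_, ?_, fun N y hN hN2 hy => ⟨?_, ?_, ?_⟩⟩
  · refine (length_measurementCircuit_le Q P P').trans ?_
    nlinarith
  · have : M.qubits = n + (n + (n + (3 * T + (6 * T + (n + scratchSize n T))))) := by
      simp [EnergyMeasurement.qubits, M]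
    rw [this]
    nlinarith
  · intro ψ E hψ hE
    obtain ⟨v, hv, hvE, hclose⟩ := main N y hN hN2 hy ψ E hψ hE
    have hprob := M.le_probWithin N y hψ (E := E) (δE := 32 / 2 ^ T) (fun b hb => ?_) hclose
    · refine le_trans ?_ hprob
      have h32 : (2 : ℝ) ^ 5 ≤ 2 ^ T := pow_le_pow_right₀ (by norm_num) hT
      have h8 : (4 : ℝ) / 2 ^ T ≤ 1 / 8 := by
        rw [div_le_div_iff₀ (by positivity) (by norm_num)]
        linarith
      have h0 : (0 : ℝ) ≤ 4 / 2 ^ T := by positivity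
      nlinarith
    · rw [tensorState_apply, basisState_apply] at hb
      have hb' : b ∘ Sum.inr = (registers n T).withOutput (initial n T N y)
          fun j => v.testBit j := by
        by_contra h
        simp [h] at hb
      have hread : M.readout b = -2 + 4 * (v : ℝ) / 2 ^ (3 * T) := by
        have : (fun i : Fin M.k => b (Sum.inr (Sum.inr (Sum.inr (Sum.inl i))))) =
            toBits (3 * T) v := by
          funext j
          exact (congrFun hb' ((registers n T).output j)).trans (Registers.withOutput_output _ j)
        rw [EnergyMeasurement.readout, this, ofBits_toBits hv]
      rw [hread]
      exact hvE
  · intro ψ μ hψ hμ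
    obtain ⟨σ, hσ, hσt⟩ := exists_perm_mulMod hN hN2 hy
    have hψ' := hμ.apply_eq_smul
    rw [toEuclideanLin_modMul hσ] at hψ'
    have hμ1 : ‖μ‖ = 1 := by
      have := congrArg norm hψ'
      rw [LinearIsometryEquiv.norm_map, norm_smul, hψ, mul_one] at this
      exact this.symm
    obtain ⟨χ, hχ, hfin⟩ := Registers.exists_measurementCircuit_eq hQ (hP N y hN hN2 hy σ hσt)
      (hP' N y) hμ1 (eigen_of_piLpCongrLeft hψ')
    refine ⟨χ, hχ, ?_⟩
    have : M.finalState N y ψ = tensorState ψ χ := hfin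
    rw [this, sub_self, norm_zero]
  · intro ψ E hψ hE
    obtain ⟨v, hv, hvE, hclose⟩ := main N y hN hN2 hy ψ E hψ hE
    exact ⟨_, norm_basisState _, hclose⟩

end

theorem theorem3p1 :
    ∃ p : Polynomial ℕ, ∀ n : ℕ, ∃ (M : EnergyMeasurement n) (δE : ℝ),
      M.complexity ≤ p.eval n ∧ M.qubits ≤ p.eval n ∧
      0 < δE ∧ δE ≤ Real.exp (-(n : ℝ)) ∧
      δE * (M.complexity : ℝ) ≤ Real.exp (-(n : ℝ)) ∧
      ∀ N y : ℕ, 0 < N → N < 2 ^ n → Nat.Coprime y N →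
        M.HasAccuracy N y (2 / 3) δE ∧
        (∀ (ψ : QState (Fin n)) (μ : ℂ), ‖ψ‖ = 1 →
          Module.End.HasEigenvector (Matrix.toEuclideanLin (modMul n N y)) μ ψ →
            M.LeavesIntact N y ψ 0) ∧
        (∀ (ψ : QState (Fin n)) (E : ℝ), ‖ψ‖ = 1 →
          Module.End.HasEigenvector (Matrix.toEuclideanLin (shorHamiltonian n N y)) (E : ℂ) ψ →
            M.LeavesIntact N y ψ (Real.exp (-(n : ℝ)))) := by
  refine ⟨Polynomial.C (10 ^ 12) * (Polynomial.C 4 * Polynomial.X + Polynomial.C 100) ^ 4,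
    fun n => ?_⟩
  obtain ⟨M, hM, hq, h⟩ := exists_energyMeasurement (n := n) (T := 4 * n + 100) (by omega)
    (by omega)
  have hone : (1 : ℝ) ≤ (4 * n + 100) ^ 4 := one_le_pow₀ (by
    have : (0 : ℝ) ≤ n := n.cast_nonneg
    linarith)
  have hM' : (M.complexity : ℝ) ≤ 10 ^ 12 * (4 * n + 100) ^ 4 := by exact_mod_cast hM
  refine ⟨M, 32 / 2 ^ (4 * n + 100), ?_, ?_, by positivity, ?_, ?_, fun N y hN hN2 hy => ?_⟩
  · simpa using hM
  · simpa using hq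
  · exact div_two_pow_le_exp_neg n (by linarith)
  · rw [div_mul_eq_mul_div]
    exact div_two_pow_le_exp_neg n (by linarith)
  · obtain ⟨h1, h2, h3⟩ := h N y hN hN2 hy
    refine ⟨h1, h2, fun ψ E hψ hE => ?_⟩
    obtain ⟨χ, hχ, hle⟩ := h3 ψ E hψ hE
    exact ⟨χ, hχ, hle.trans (div_two_pow_le_exp_neg n (by linarith))⟩
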